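/- Let $n\ge 0$, let $S_n[\mathbf q]=\{\mathbf q^{\alpha}w : w\in S_n,\ \alpha\in\mathbb Z_{\ge0}^{n-1}\}$, and put $\ell(\mathbf q^\alpha w)=\ell(w)+2\deg\mathbf q^\alpha$, where $\ell(w)$ is the number of inversions of $w$, and $\mathbf q_{ij}=q_iq_{i+1}\cdots q_{j-1}$ for $i<j$. For $k\in[n-1]$ the covers of the quantum $k$-Bruhat order are $\mathbf q^\alpha w\lessdot_k \mathbf q^\alpha w s_{ij}$ and $\mathbf q^\alpha w\lessdot_k \mathbf q^\alpha\mathbf q_{ij} w s_{ij}$ with $i\le k<j$, whenever the length $\ell$ goes up by exactly $1$. Let $\mathcal F_n$ be the free monoid on the operators $\mathbf v_{ab}$ ($a\ne b$ in $[n]$), and let $\mathcal F_n\cup\{\mathbf 0\}$ act on $S_n[\mathbf q]\cup\{0\}$ from the left (the rightmost operator acts first) by $\mathbf 0\bullet_k x=0$, $\mathbf v_{ab}\bullet_k 0=0$ and, for $x=\mathbf q^\alpha w$, by: $\mathbf v_{ab}\bullet_k x=\mathbf q^\alpha s_{ab}w$ if $a<b$ and $x\lessdot_k\mathbf q^\alpha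 s_{ab}w$; $\mathbf v_{ab}\bullet_k x=\mathbf q^\alpha\mathbf q_{ij}s_{ab}w$ if $a>b$, $w(i)=a$, $w(j)=b$, $i<j$ and $x\lessdot_k\mathbf q^\alpha\mathbf q_{ij}s_{ab}w$; and $\mathbf v_{ab}\bullet_kx=0$ otherwise. Write $\mathbf u\equiv\mathbf v$ if $\mathbf u\bullet_kx=\mathbf v\bullet_kx$ for all $x\in S_n[\mathbf q]$ and all $k\in[n-1]$. The degree of a composition $\mathbf v=\mathbf v_{a_rb_r}\cdots\mathbf v_{a_1b_1}$ is $r$, and its support is $\{a_1,b_1,\dots,a_r,b_r\}$. A zero equivalence of degree $d$ is $\mathbf v\equiv\mathbf 0$ with $\mathbf v$ of degree $d$; a non-zero equivalence of degree $d$ is $\mathbf u\equiv\mathbf v\not\equiv\mathbf 0$ with $\mathbf u,\mathbf v$ of degree $d$. It is minimal if it is not a consequence of equivalences of lower degree, that is, if it does not lie in the congruence on the monoid $\mathcal F_n\cup\{\mathbf 0\}$ generated by all equivalences between elements each of which is $\mathbf 0$ or a composition of degree less than $d$. For a composition $\mathbf v=\mathbf v_{a_rb_r}\cdots\mathbf v_{a_1b_1}$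 with support $\{t_1<\dots<t_m\}$ consider the transformations: flattening (replace every index $t_i$ by $i$); cyclic shift (replace $t_i$ by $t_{i+1}$ for $i<m$, and $t_m$ by $t_1$); horizontal flip (replace every $\mathbf v_{ab}$ by $\mathbf v_{\mathfrak h(b)\mathfrak h(a)}$, where $\mathfrak h(t_i)=t_{m+1-i}$); vertical flip ($\mathbf v\mapsto\mathbf v_{a_1b_1}\cdots\mathbf v_{a_rb_r}$). Two compositions are related if they are connected by finitely many of these transformations and their inverses. Two pairs of compositions are related if they are connected in the same way, where every transformation is applied simultaneously to both members of a pair whose members have the same support. Then, up to these transformations, there are exactly one minimal zero equivalence and exactly one minimal non-zero equivalence of degree four: (i) $\mathbf w\equiv\mathbf 0$ is a minimal zero equivalence of degree four if and only if $\mathbf w$ is related to $\mathbf v_{a_3a_5}\mathbf v_{a_2a_3}\mathbf v_{a_1a_2}\mathbf v_{a_4a_1}$ for some $a_1<a_2<a_3<a_4<a_5$ in $[n]$, and all these compositions are related to one another; (ii) $\mathbf u\equiv\mathbf w$ is a minimal non-zero equivalence of degree four if and only if $(\mathbf u,\mathbf w)$ is related to $(\mathbf v_{a_3a_1}\mathbf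 v_{a_2a_3}\mathbf v_{a_1a_2}\mathbf v_{a_4a_1},\ \mathbf v_{a_4a_1}\mathbf v_{a_3a_4}\mathbf v_{a_2a_3}\mathbf v_{a_4a_2})$ for some $a_1<a_2<a_3<a_4$ in $[n]$, and all these pairs are related to one another. -/

import Mathlib

namespace QuantumBruhat

/-- The set `S_n[q]`: the pair `(α, w)` is `q^α w`. Positions and values `1, …, n` are the elements
`0, …, n - 1` of `Fin n`, and the coordinate `l` of `α` is the exponent of `q_{l+1}`. -/
abbrev QPerm (n : ℕ) : Type := (Fin (n - 1) → ℕ) × Equiv.Perm (Fin n)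

/-- The number of inversions of a permutation. -/
def permLength {n : ℕ} (w : Equiv.Perm (Fin n)) : ℕ :=
  (Finset.univ.filter fun p : Fin n × Fin n => p.1 < p.2 ∧ w p.2 < w p.1).card

/-- `ℓ(q^α w) = ℓ(w) + 2 deg q^α`. -/
def qLength {n : ℕ} (x : QPerm n) : ℕ :=
  permLength x.2 + 2 * ∑ l, x.1 l

/-- The exponent vector of `q_{ij} = q_i q_{i+1} ⋯ q_{j-1}` (used for `i < j`). -/
def qExp {n : ℕ} (i j : Fin n) : Fin (n - 1) → ℕ :=
  fun l => if (i : ℕ) ≤ l ∧ (l : ℕ) < j then 1 else 0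

/-- The cover relation of the quantum `k`-Bruhat order on `S_n[q]`: `q^α w` is covered by
`q^α w s_{ij}` and by `q^α q_{ij} w s_{ij}` whenever `i ≤ k < j` (positions counted from one) and
the length goes up by exactly one. -/
def QCover {n : ℕ} (k : ℕ) (x y : QPerm n) : Prop :=
  ∃ i j : Fin n, (i : ℕ) + 1 ≤ k ∧ k < (j : ℕ) + 1 ∧
    (y = (x.1, x.2 * Equiv.swap i j) ∨ y = (x.1 + qExp i j, x.2 * Equiv.swap i j)) ∧
    qLength y = qLength x + 1

instance {n : ℕ} (k : ℕ) (x y : QPerm n) : Decidable (QCover k x y) := by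
  unfold QCover; infer_instance

/-- The generators `v_{ab}`, `a ≠ b`. -/
abbrev Op (n : ℕ) : Type := {p : Fin n × Fin n // p.1 ≠ p.2}

/-- The free monoid on the operators; its elements are the compositions of operators, and the
degree of a composition is its `FreeMonoid.length`. -/
abbrev Comp (n : ℕ) : Type := FreeMonoid (Op n)

/-- The action of a single operator on `S_n[q]`, with values in `S_n[q] ∪ {0}` (`none` is `0`). -/
def opAct {n : ℕ} (k : ℕ) (o : Op n) (x : QPerm n) : Option (QPerm n) :=
  let a := o.1.1
  let b := o.1.2
  let i := x.2⁻¹ a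
  let j := x.2⁻¹ b
  if a < b ∧ QCover k x (x.1, Equiv.swap a b * x.2) then
    some (x.1, Equiv.swap a b * x.2)
  else if b < a ∧ i < j ∧ QCover k x (x.1 + qExp i j, Equiv.swap a b * x.2) then
    some (x.1 + qExp i j, Equiv.swap a b * x.2)
  else none

/-- The left action of a composition on `S_n[q] ∪ {0}`: the rightmost operator acts first. -/
def compAct {n : ℕ} (k : ℕ) (v : Comp n) (x : Option (QPerm n)) : Option (QPerm n) :=
  v.toList.foldr (fun o y => y.bind (opAct k o)) x

/-- The action of the free monoid with a zero element adjoined; `0` sends everything to `0`. -/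
def act {n : ℕ} (k : ℕ) (v : WithZero (Comp n)) (x : Option (QPerm n)) : Option (QPerm n) :=
  WithZero.recZeroCoe none (fun w => compAct k w x) v

/-- `u ≡ v`: equal action on `S_n[q]` for every `k ∈ {1, …, n - 1}`. -/
def Equivalent {n : ℕ} (u v : WithZero (Comp n)) : Prop :=
  ∀ k : ℕ, 1 ≤ k → k < n → ∀ x : QPerm n, act k u (some x) = act k v (some x)

/-- `v` is `0` or a composition of degree less than `d`. -/
def DegreeLT {n : ℕ} (d : ℕ) (v : WithZero (Comp n)) : Prop :=
  ∀ w : Comp n, v = (w : WithZero (Comp n)) → w.length < d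

/-- The equivalences that involve only compositions of fewer than `d` operators, and `0`. -/
def LowerEquivalence {n : ℕ} (d : ℕ) (u v : WithZero (Comp n)) : Prop :=
  Equivalent u v ∧ DegreeLT d u ∧ DegreeLT d v

/-- `u ≡ v` is a consequence of equivalences of degree less than `d`: it lies in the congruence on
the monoid with zero that they generate. -/
def IsConsequence {n : ℕ} (d : ℕ) (u v : WithZero (Comp n)) : Prop :=
  conGen (LowerEquivalence d) u v

/-- `v ≡ 0` is a minimal zero equivalence of degree `d`. -/
def IsMinimalZero {n : ℕ} (d : ℕ) (v : Comp n) : Prop :=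
  v.length = d ∧ Equivalent (v : WithZero (Comp n)) 0 ∧ ¬ IsConsequence d (v : WithZero (Comp n)) 0

/-- `u ≡ v` is a minimal non-zero equivalence of degree `d`. -/
def IsMinimalNonzero {n : ℕ} (d : ℕ) (u v : Comp n) : Prop :=
  u.length = d ∧ v.length = d ∧
    Equivalent (u : WithZero (Comp n)) v ∧ ¬ Equivalent (u : WithZero (Comp n)) 0 ∧
    ¬ IsConsequence d (u : WithZero (Comp n)) v

/-- The set of indices that occur in a composition. -/
def supp {n : ℕ} (v : Comp n) : Finset (Fin n) :=
  v.toList.toFinset.biUnion fun o => {o.1.1, o.1.2}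

/-- `v_{ab} ↦ v_{σ(a)σ(b)}`. -/
def relabel {n : ℕ} (σ : Equiv.Perm (Fin n)) (o : Op n) : Op n :=
  ⟨(σ o.1.1, σ o.1.2), σ.injective.ne o.2⟩

/-- `v_{ab} ↦ v_{σ(b)σ(a)}`. -/
def relabelSwap {n : ℕ} (σ : Equiv.Perm (Fin n)) (o : Op n) : Op n :=
  ⟨(σ o.1.2, σ o.1.1), σ.injective.ne o.2.symm⟩

/-- A permutation of the indices that restricts to the order-preserving bijection from `S` onto the
first `|S|` indices (and lists the complement of `S` after them). -/
def flattenPerm {n : ℕ} (S : Finset (Fin n)) : Equiv.Perm (Fin n) :=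
  (finSumEquivOfFinset (s := S) rfl rfl).symm.trans
    (finSumFinEquiv.trans (finCongr (S.card_add_card_compl.trans (Fintype.card_fin n))))

/-- On `S = {t_1 < ⋯ < t_m}` this is `t_i ↦ t_{i+1}`, `t_m ↦ t_1`; it fixes the complement. -/
def shiftPerm {n : ℕ} (S : Finset (Fin n)) : Equiv.Perm (Fin n) :=
  (finRotate S.card).extendDomain (S.orderIsoOfFin rfl).toEquiv

/-- On `S = {t_1 < ⋯ < t_m}` this is `t_i ↦ t_{m-i+1}`; it fixes the complement. -/
def flipPerm {n : ℕ} (S : Finset (Fin n)) : Equiv.Perm (Fin n) :=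
  (Fin.revPerm (n := S.card)).extendDomain (S.orderIsoOfFin rfl).toEquiv

/-- Flattening. -/
def flatten {n : ℕ} (v : Comp n) : Comp n := FreeMonoid.map (relabel (flattenPerm (supp v))) v

/-- The cyclic shift of the indices along the support. -/
def cyclicShift {n : ℕ} (v : Comp n) : Comp n := FreeMonoid.map (relabel (shiftPerm (supp v))) v

/-- The horizontal flip. -/
def horizontalFlip {n : ℕ} (v : Comp n) : Comp n :=
  FreeMonoid.map (relabelSwap (flipPerm (supp v))) v

/-- The vertical flip: the operators in reverse order. -/
def verticalFlip {n : ℕ} (v : Comp n) : Comp n := FreeMonoid.reverse v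

/-- The four equivalence-preserving transformations. -/
inductive IsTransformation {n : ℕ} : (Comp n → Comp n) → Prop
  | flatten : IsTransformation flatten
  | cyclicShift : IsTransformation cyclicShift
  | horizontalFlip : IsTransformation horizontalFlip
  | verticalFlip : IsTransformation verticalFlip

/-- `v` and `w` are connected by finitely many transformations and inverses of such. -/
def Related {n : ℕ} : Comp n → Comp n → Prop :=
  Relation.EqvGen fun v w => ∃ T, IsTransformation T ∧ w = T v

/-- The pairs `p` and `q` are connected by finitely many transformations and inverses of such, each
applied to both members of a pair of compositions with the same support. -/
def PairRelated {n : ℕ} : Comp n × Comp n → Comp n × Comp n → Prop :=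
  Relation.EqvGen fun p q =>
    supp p.1 = supp p.2 ∧ ∃ T, IsTransformation T ∧ q = (T p.1, T p.2)

/-- The composition `v_{a_i a_j}` of degree one, for a strictly increasing family `a` that is
indexed from zero. -/
def v {m n : ℕ} (a : Fin m ↪o Fin n) (i j : Fin m) (h : i ≠ j := by decide) : Comp n :=
  FreeMonoid.of ⟨(a i, a j), a.injective.ne h⟩

/-- `v_{a₃a₅} v_{a₂a₃} v_{a₁a₂} v_{a₄a₁}` for `a₁ < a₂ < a₃ < a₄ < a₅`. -/
def zeroWord {n : ℕ} (a : Fin 5 ↪o Fin n) : Comp n :=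
  v a 2 4 * v a 1 2 * v a 0 1 * v a 3 0

/-- `v_{a₃a₁} v_{a₂a₃} v_{a₁a₂} v_{a₄a₁}` for `a₁ < a₂ < a₃ < a₄`. -/
def leftWord {n : ℕ} (a : Fin 4 ↪o Fin n) : Comp n :=
  v a 2 0 * v a 1 2 * v a 0 1 * v a 3 0

/-- `v_{a₄a₁} v_{a₃a₄} v_{a₂a₃} v_{a₄a₂}` for `a₁ < a₂ < a₃ < a₄`. -/
def rightWord {n : ℕ} (a : Fin 4 ↪o Fin n) : Comp n :=
  v a 3 0 * v a 2 3 * v a 1 2 * v a 3 1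

end QuantumBruhat

/-! The proof rests on a cyclic description of the action (`opAct_eq_some_iff`, `allowed_iff`). The
operator `v_{ab}` acts on `q^α w` exactly when `a` stands left of the bar after position `k`, `b`
stands right of it, and no value met on the way up from `a` to `b`, read cyclically, stands between
them. Classical operators (`a < b`) and quantum operators (`a > b`) thus obey one rule, which is
invariant under rotation of the values.

A composition acts through three data (`act_word`): a condition `Ok` on the order of the positions,
a product of transpositions, and an exponent of `q`. The exponent is encoded by `wsum`, which is
linear in a function of the positions. `equivalent_of_forall` and `ok_of_equivalent` turn
equivalence of compositions into a comparison of these data.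

Four operators involve at most eight indices, and nonzero equivalent compositions have the same
support (`occ_of_equivalent`), so the classification is a finite problem about words in `0, …, m -
1` with `m ≤ 8`. Enough consequences of low degree are established by hand: commutation of operators
without a common index, vanishing of certain words of degree two and three, and the cubic relations
`equivalent_long_up`, `equivalent_short_up` and their reversals. Commutation brings a word into
sorted form (`exists_sorted`). A finite check then shows that every sorted word without a visible
zero factor acts somewhere, is reduced to zero by the relations, or lies in `zeroOrbit`. It also
shows that two such nonzero words are connected by relations, distinguished by their data, or form a
pair in `pairOrbit`.

Conversely, the exceptional equivalences hold for reasons of position (`equivalent_zero_cascade_up`,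
`equivalent_quartic_up` and their reversals). They are minimal because deleting the first or the
last operator leaves a rigid word of degree three, one equivalent to nothing but itself. A
consequence of lower equivalences therefore never changes the exceptional word
(`eq_of_isConsequence`).

Finally, the transformations become shift, flip and reversal of flattened words, under which
`zeroOrbit` (ten words) and `pairOrbit` (sixteen pairs) are single orbits. -/

namespace QuantumBruhat
open Equiv

/-! ### Lengths -/

lemma permLength_eq_sum {n : ℕ} (w : Perm (Fin n)) :
    permLength w = ∑ p, ∑ q, if p < q ∧ w q < w p then 1 else 0 := by
  rw [permLength, Finset.card_filter, ← Finset.univ_product_univ, Finset.sum_product]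

/-- Pairs are sorted by how they meet `{i, j}`; composing with the transposition leaves the pairs
that miss it untouched. -/
lemma sum_sum_eq_of_pair {n : ℕ} {i j : Fin n} (hij : i ≠ j) (f : Fin n → Fin n → ℕ) :
    ∑ p, ∑ q, f p q = (∑ p ∈ {i, j}ᶜ, ∑ q ∈ {i, j}ᶜ, f p q) +
      (∑ l ∈ {i, j}ᶜ, (f i l + f j l + f l i + f l j)) + (f i i + f i j + f j i + f j j) := by
  have key : ∀ g : Fin n → ℕ, ∑ p, g p = g i + g j + ∑ p ∈ {i, j}ᶜ, g p := by
    intro g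
    rw [← Finset.sum_add_sum_compl {i, j} g, Finset.sum_pair hij]
  simp only [key, Finset.sum_add_distrib]
  ring

/-- The pair `(i, j)` becomes an inversion. A third position `l` gives two new inversions with `i`
and `j` if it lies between them both in position and in value; otherwise its contribution is
unchanged. -/
lemma permLength_mul_swap {n : ℕ} (w : Perm (Fin n)) {i j : Fin n} (hij : i < j)
    (hw : w i < w j) :
    permLength (w * swap i j) = permLength w + 1 +
      2 * (Finset.univ.filter fun l => i < l ∧ l < j ∧ w i < w l ∧ w l < w j).card := by
  have hi : (w * swap i j) i = w j := by simp
  have hj : (w * swap i j) j = w i := by simp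
  have hl : ∀ l, l ∈ ({i, j} : Finset (Fin n))ᶜ → (w * swap i j) l = w l := by
    intro l hl
    simp only [Finset.mem_compl, Finset.mem_insert, Finset.mem_singleton, not_or] at hl
    simp [swap_apply_of_ne_of_ne hl.1 hl.2]
  rw [permLength_eq_sum, permLength_eq_sum, sum_sum_eq_of_pair hij.ne, sum_sum_eq_of_pair hij.ne,
    Finset.card_filter,
    ← Finset.sum_add_sum_compl {i, j}
      (fun l => if i < l ∧ l < j ∧ w i < w l ∧ w l < w j then 1 else 0), Finset.sum_pair hij.ne]
  have h1 : ∀ p ∈ ({i, j} : Finset (Fin n))ᶜ, ∀ q ∈ ({i, j} : Finset (Fin n))ᶜ,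
      (if p < q ∧ (w * swap i j) q < (w * swap i j) p then 1 else 0) =
        if p < q ∧ w q < w p then 1 else 0 := by
    intro p hp q hq
    rw [hl p hp, hl q hq]
  rw [Finset.sum_congr rfl fun p hp => Finset.sum_congr rfl (h1 p hp)]
  have h2 : ∀ l ∈ ({i, j} : Finset (Fin n))ᶜ,
      ((if i < l ∧ (w * swap i j) l < (w * swap i j) i then 1 else 0) +
        (if j < l ∧ (w * swap i j) l < (w * swap i j) j then 1 else 0) +
        (if l < i ∧ (w * swap i j) i < (w * swap i j) l then 1 else 0) +
        (if l < j ∧ (w * swap i j) j < (w * swap i j) l then 1 else 0)) =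
      ((if i < l ∧ w l < w i then 1 else 0) + (if j < l ∧ w l < w j then 1 else 0) +
        (if l < i ∧ w i < w l then 1 else 0) + (if l < j ∧ w j < w l then 1 else 0)) +
      2 * (if i < l ∧ l < j ∧ w i < w l ∧ w l < w j then 1 else 0) := by
    intro l hl'
    have e := hl l hl'
    rw [hi, hj, e]
    simp only [Finset.mem_compl, Finset.mem_insert, Finset.mem_singleton, not_or] at hl'
    have a1 : (w l : ℕ) ≠ w i := fun h => hl'.1 (w.injective (Fin.ext h))
    have a2 : (w l : ℕ) ≠ w j := fun h => hl'.2 (w.injective (Fin.ext h))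
    have a3 : (l : ℕ) ≠ i := fun h => hl'.1 (Fin.ext h)
    have a4 : (l : ℕ) ≠ j := fun h => hl'.2 (Fin.ext h)
    simp only [Fin.lt_def] at *
    split_ifs <;> omega
  rw [Finset.sum_congr rfl h2, Finset.sum_add_distrib, ← Finset.mul_sum, hi, hj]
  simp [hij, hw, not_lt.2 hij.le, not_lt.2 hw.le]
  ring

lemma sum_qExp {n : ℕ} (i j : Fin n) : ∑ l, qExp i j l = (j : ℕ) - i := by
  have h : ∑ l, qExp i j l = ∑ l ∈ Finset.range (n - 1), if (i : ℕ) ≤ l ∧ l < j then 1 else 0 := by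
    rw [Finset.sum_range]; rfl
  rw [h, ← Finset.card_filter]
  have : (Finset.range (n - 1)).filter (fun l => (i : ℕ) ≤ l ∧ l < j) = Finset.Ico (i : ℕ) j := by
    ext l
    simp only [Finset.mem_filter, Finset.mem_range, Finset.mem_Ico]
    have := j.2
    omega
  rw [this, Nat.card_Ico]

lemma qExp_apply_self {n : ℕ} {i j : Fin n} (hij : i < j) :
    qExp i j ⟨i, by have := j.2; have : (i : ℕ) < j := hij; omega⟩ = 1 := by
  have : (i : ℕ) < j := hij
  simp [qExp, this]

/-- Lets the exponent tell the classical covers from the quantum ones. -/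
lemma qExp_ne_zero {n : ℕ} {i j : Fin n} (hij : i < j) (α : Fin (n - 1) → ℕ) :
    α ≠ α + qExp i j := by
  intro h
  have h1 := congrFun h ⟨i, by have := j.2; have : (i : ℕ) < j := hij; omega⟩
  have h2 := qExp_apply_self hij
  simp only [Pi.add_apply] at h1
  omega

/-! ### The action of one operator -/

lemma perm_inv_apply_self {α : Type*} (w : Perm α) (c : α) : w⁻¹ (w c) = c := w.symm_apply_apply c

lemma perm_apply_inv_self {α : Type*} (w : Perm α) (c : α) : w (w⁻¹ c) = c := w.apply_symm_apply c


/-- `c` lies strictly between `a` and `b` on the way up from `a` to `b`, read cyclically. -/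
def Cyc {α : Type*} [LT α] (a c b : α) : Prop := (a < c ∧ c < b) ∨ (c < b ∧ b < a) ∨ (b < a ∧ a < c)

instance {α : Type*} [LT α] [DecidableRel (α := α) (· < ·)] (a c b : α) :
    Decidable (Cyc a c b) := by
  unfold Cyc; infer_instance

lemma swap_mul_eq_mul_swap_iff {n : ℕ} (w : Perm (Fin n)) (a b i j : Fin n) (hij : i ≠ j) :
    swap a b * w = w * swap i j ↔ (a = w i ∧ b = w j) ∨ (a = w j ∧ b = w i) := by
  have h : w * swap i j = swap (w i) (w j) * w := by
    rw [Equiv.swap_apply_apply]; group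
  rw [h, mul_left_inj]
  constructor
  · intro h
    have h1 : swap a b (w i) = w j := by rw [h]; simp
    rw [swap_apply_def] at h1
    split_ifs at h1 with e1 e2
    · exact Or.inl ⟨e1.symm, h1⟩
    · exact Or.inr ⟨h1, e2.symm⟩
    · exact absurd (w.injective h1) hij
  · rintro (⟨rfl, rfl⟩ | ⟨rfl, rfl⟩)
    · rfl
    · exact swap_comm _ _

lemma length_condition_of_lt {n : ℕ} (x : QPerm n) {i j : Fin n} (hij : i < j)
    (hw : x.2 i < x.2 j) :
    qLength (x.1, x.2 * swap i j) = qLength x + 1 ↔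
      ∀ l, i < l → l < j → ¬ (x.2 i < x.2 l ∧ x.2 l < x.2 j) := by
  have h := permLength_mul_swap x.2 hij hw
  have : qLength (x.1, x.2 * swap i j) = qLength x + 1 ↔
      (Finset.univ.filter fun l => i < l ∧ l < j ∧ x.2 i < x.2 l ∧ x.2 l < x.2 j).card = 0 := by
    simp only [qLength, h]
    omega
  rw [this, Finset.card_eq_zero, Finset.filter_eq_empty_iff]
  simp only [Finset.mem_univ, true_imp_iff, not_and]

/-- The power of `q` contributes `2(j - i)`, so the length of the permutation has to drop by `2(j -
i) - 1`. This is the largest possible drop, attained when each of the `j - i - 1` intermediate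
positions counts in `permLength_mul_swap`. -/
lemma length_condition_of_gt {n : ℕ} (x : QPerm n) {i j : Fin n} (hij : i < j)
    (hw : x.2 j < x.2 i) :
    qLength (x.1 + qExp i j, x.2 * swap i j) = qLength x + 1 ↔
      ∀ l, i < l → l < j → (x.2 j < x.2 l ∧ x.2 l < x.2 i) := by
  have h := permLength_mul_swap (x.2 * swap i j) hij (by simpa using hw)
  have e : x.2 * swap i j * swap i j = x.2 := by simp [mul_assoc]
  rw [e] at h
  set s := Finset.univ.filter fun l => i < l ∧ l < j ∧ (x.2 * swap i j) i < (x.2 * swap i j) l ∧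
    (x.2 * swap i j) l < (x.2 * swap i j) j with hs
  have hsub : s ⊆ Finset.Ioo i j := by
    intro l hl
    simp only [hs, Finset.mem_filter] at hl
    exact Finset.mem_Ioo.2 ⟨hl.2.1, hl.2.2.1⟩
  have hlt : (i : ℕ) < j := hij
  have hcard : (Finset.Ioo i j).card = (j : ℕ) - i - 1 := Fin.card_Ioo i j
  have : qLength (x.1 + qExp i j, x.2 * swap i j) = qLength x + 1 ↔
      s.card = (Finset.Ioo i j).card := by
    have hle := Finset.card_le_card hsub
    simp only [qLength, Pi.add_apply, Finset.sum_add_distrib, sum_qExp, h, hcard] at hle ⊢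
    omega
  rw [this]
  have hiff : s.card = (Finset.Ioo i j).card ↔ s = Finset.Ioo i j :=
    ⟨fun hc => Finset.eq_of_subset_of_card_le hsub hc.ge, fun hc => by rw [hc]⟩
  rw [hiff, Finset.ext_iff]
  refine forall_congr' fun l => ?_
  simp only [hs, Finset.mem_filter, Finset.mem_univ, true_and, Finset.mem_Ioo]
  constructor
  · intro hh h1 h2
    have := (hh.2 ⟨h1, h2⟩).2.2
    simpa [swap_apply_of_ne_of_ne h1.ne' h2.ne] using this
  · intro hh
    refine ⟨fun q => ⟨q.1, q.2.1⟩, fun q => ⟨q.1, q.2, ?_⟩⟩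
    simpa [swap_apply_of_ne_of_ne q.1.ne' q.2.ne] using hh q.1 q.2

/-- The condition under which `v_{ab}` does not annihilate `x`. -/
def Allowed {n : ℕ} (k : ℕ) (a b : Fin n) (w : Perm (Fin n)) : Prop :=
  (w⁻¹ a : ℕ) < k ∧ k ≤ (w⁻¹ b : ℕ) ∧ ∀ c, Cyc a c b → w⁻¹ c < w⁻¹ a ∨ w⁻¹ b < w⁻¹ c

lemma qCover_of_lt_iff {n : ℕ} (k : ℕ) {a b : Fin n} (hab : a < b) (x : QPerm n) :
    QCover k x (x.1, swap a b * x.2) ↔ Allowed k a b x.2 := by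
  constructor
  · rintro ⟨i, j, hi, hj, hy | hy, hl⟩
    · have hij : i < j := by rw [Fin.lt_def]; omega
      have hy2 : swap a b * x.2 = x.2 * swap i j := congrArg Prod.snd hy
      rw [hy] at hl
      rcases (swap_mul_eq_mul_swap_iff x.2 a b i j hij.ne).1 hy2 with ⟨ha, hb⟩ | ⟨ha, hb⟩
      · rw [length_condition_of_lt x hij (by rwa [← ha, ← hb])] at hl
        subst ha hb
        refine ⟨by simp; omega, by simp; omega, fun c hc => ?_⟩
        simp only [perm_inv_apply_self]
        by_contra hcon
        push Not at hcon
        have h3 : x.2 (x.2⁻¹ c) = c := by simp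
        have h1 : i < x.2⁻¹ c := lt_of_le_of_ne hcon.1 (by
          rintro e; rw [← e] at h3; rw [← h3] at hc
          simp [Cyc] at hc; exact absurd hc (by simp [hab.le]))
        have h2 : x.2⁻¹ c < j := lt_of_le_of_ne hcon.2 (by
          rintro e; rw [e] at h3; rw [← h3] at hc
          simp [Cyc] at hc; exact absurd hc (by simp [hab.le]))
        refine hl _ h1 h2 ?_
        rw [h3]
        rcases hc with hc | hc | hc
        · exact hc
        · exact absurd hc.2 hab.not_gt
        · exact absurd hc.1 hab.not_gt
      -- Here the larger value stands first, so the transposition shortens the permutation while the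
      -- exponent stays the same.
      · exfalso
        have h := permLength_mul_swap (x.2 * swap i j) hij (by simp [← ha, ← hb, hab])
        have e : x.2 * swap i j * swap i j = x.2 := by simp [mul_assoc]
        rw [e] at h
        simp only [qLength] at hl
        omega
    · exact absurd (congrArg Prod.fst hy) (qExp_ne_zero (by rw [Fin.lt_def]; omega) _)
  · rintro ⟨h1, h2, h3⟩
    have hij : x.2⁻¹ a < x.2⁻¹ b := by rw [Fin.lt_def]; omega
    have e : swap a b * x.2 = x.2 * swap (x.2⁻¹ a) (x.2⁻¹ b) := by
      rw [swap_mul_eq_mul_swap_iff _ _ _ _ _ hij.ne]; simp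
    refine ⟨x.2⁻¹ a, x.2⁻¹ b, by omega, by omega, Or.inl (by rw [e]), ?_⟩
    rw [e, length_condition_of_lt x hij (by simpa using hab)]
    intro l hl1 hl2 hl3
    simp only [perm_apply_inv_self] at hl3
    have := h3 (x.2 l) (Or.inl hl3)
    simp only [perm_inv_apply_self] at this
    exact this.elim hl1.not_gt hl2.not_gt

/-- For `b < a` the values cyclically between `a` and `b` are those above `a` or below `b`.
Excluding them from the intermediate positions means that all intermediate values lie between `b`
and `a`, which is the quantum length condition. -/
lemma qCover_of_gt_iff {n : ℕ} (k : ℕ) {a b : Fin n} (hab : b < a) (x : QPerm n) :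
    (x.2⁻¹ a < x.2⁻¹ b ∧ QCover k x (x.1 + qExp (x.2⁻¹ a) (x.2⁻¹ b), swap a b * x.2)) ↔
      Allowed k a b x.2 := by
  constructor
  · rintro ⟨hpos, i, j, hi, hj, hy | hy, hl⟩
    · exact absurd (congrArg Prod.fst hy).symm (qExp_ne_zero hpos _)
    · have hij : i < j := by rw [Fin.lt_def]; omega
      have hy2 : swap a b * x.2 = x.2 * swap i j := congrArg Prod.snd hy
      rw [hy] at hl
      rcases (swap_mul_eq_mul_swap_iff x.2 a b i j hij.ne).1 hy2 with ⟨ha, hb⟩ | ⟨ha, hb⟩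
      · rw [length_condition_of_gt x hij (by rwa [← ha, ← hb])] at hl
        subst ha hb
        refine ⟨by simp; omega, by simp; omega, fun c hc => ?_⟩
        simp only [perm_inv_apply_self]
        by_contra hcon
        push Not at hcon
        have h3 : x.2 (x.2⁻¹ c) = c := by simp
        have h1 : i < x.2⁻¹ c := lt_of_le_of_ne hcon.1 (by
          rintro e; rw [← e] at h3; rw [← h3] at hc
          simp [Cyc] at hc; exact absurd hc (by simp [hab.le]))
        have h2 : x.2⁻¹ c < j := lt_of_le_of_ne hcon.2 (by
          rintro e; rw [e] at h3; rw [← h3] at hc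
          simp [Cyc] at hc; exact absurd hc (by simp [hab.le]))
        have h4 := hl _ h1 h2
        rw [h3] at h4
        rcases hc with hc | hc | hc
        · exact absurd (hc.1.trans hc.2) hab.not_gt
        · exact absurd hc.1 h4.1.not_gt
        · exact absurd hc.2 h4.2.not_gt
      · exfalso
        rw [ha, hb] at hpos
        simp only [perm_inv_apply_self] at hpos
        exact absurd hpos hij.not_gt
  · rintro ⟨h1, h2, h3⟩
    have hij : x.2⁻¹ a < x.2⁻¹ b := by rw [Fin.lt_def]; omega
    have e : swap a b * x.2 = x.2 * swap (x.2⁻¹ a) (x.2⁻¹ b) := by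
      rw [swap_mul_eq_mul_swap_iff _ _ _ _ _ hij.ne]; simp
    refine ⟨hij, x.2⁻¹ a, x.2⁻¹ b, by omega, by omega, Or.inr (by rw [e]), ?_⟩
    rw [e, length_condition_of_gt x hij (by simpa using hab)]
    intro l hl1 hl2
    simp only [perm_apply_inv_self]
    have hla : x.2 l ≠ a := by rintro rfl; simp at hl1
    have hlb : x.2 l ≠ b := by rintro rfl; simp at hl2
    by_contra hcon
    have hc : Cyc a (x.2 l) b := by
      simp only [Cyc, Fin.lt_def, ne_eq, Fin.ext_iff] at *
      omega
    have := h3 _ hc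
    simp only [perm_inv_apply_self] at this
    exact this.elim hl1.not_gt hl2.not_gt

lemma opAct_eq_some_iff {n : ℕ} (k : ℕ) (o : Op n) (x y : QPerm n) :
    opAct k o x = some y ↔ Allowed k o.1.1 o.1.2 x.2 ∧
      y = (x.1 + (if o.1.2 < o.1.1 then qExp (x.2⁻¹ o.1.1) (x.2⁻¹ o.1.2) else 0),
        swap o.1.1 o.1.2 * x.2) := by
  obtain ⟨⟨a, b⟩, hab⟩ := o
  simp only at hab
  simp only [opAct]
  rcases lt_or_gt_of_ne hab with h | h
  · have hQ := qCover_of_lt_iff k h x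
    by_cases hA : Allowed k a b x.2
    · rw [if_pos ⟨h, hQ.2 hA⟩, if_neg h.not_gt]
      simp only [hA, true_and, add_zero, Option.some.injEq, eq_comm]
    · rw [if_neg fun q => hA (hQ.1 q.2), if_neg fun q => h.not_gt q.1]
      simp [hA]
  · have hQ := qCover_of_gt_iff k h x
    by_cases hA : Allowed k a b x.2
    · rw [if_neg fun q => h.not_gt q.1, if_pos ⟨h, hQ.2 hA⟩, if_pos h]
      simp only [hA, true_and, Option.some.injEq, eq_comm]
    · rw [if_neg fun q => h.not_gt q.1, if_neg fun q => hA (hQ.1 q.2)]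
      simp [hA]

lemma qLength_of_opAct {n : ℕ} {k : ℕ} {o : Op n} {x y : QPerm n} (h : opAct k o x = some y) :
    qLength y = qLength x + 1 := by
  simp only [opAct] at h
  split_ifs at h with h1 h2
  · obtain ⟨_, _, _, _, _, hl⟩ := h1.2
    rwa [Option.some.inj h] at hl
  · obtain ⟨_, _, _, _, _, hl⟩ := h2.2.2
    rwa [Option.some.inj h] at hl

/-! ### The action of a composition -/

/-- The operator `v_{ab}`, or `0` if `a = b`. -/
def opWord {n : ℕ} (p : Fin n × Fin n) : WithZero (Comp n) :=
  if h : p.1 ≠ p.2 then ((FreeMonoid.of ⟨p, h⟩ : Comp n) : WithZero (Comp n)) else 0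

/-- The composition of the operators in a list whose head acts first. -/
def word {n : ℕ} : List (Fin n × Fin n) → WithZero (Comp n)
  | [] => 1
  | p :: T => word T * opWord p

/-- The operators of a composition, the one that acts first at the head. -/
def opList {n : ℕ} (v : Comp n) : List (Fin n × Fin n) := (v.toList.map Subtype.val).reverse

/-- The positions of the values, relative to the bar between the positions `k` and `k + 1`. -/
def place {n : ℕ} (k : ℕ) (w : Perm (Fin n)) (c : Fin n) : ℤ := ((w⁻¹ c : ℕ) : ℤ) - k

/-- The operators in the list can be applied successively if the values have positions `F`. -/
def Ok {n : ℕ} : (Fin n → ℤ) → List (Fin n × Fin n) → Prop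
  | _, [] => True
  | F, (a, b) :: T => F a < 0 ∧ 0 ≤ F b ∧ (∀ c, Cyc a c b → F c < F a ∨ F b < F c) ∧
      Ok (F ∘ swap a b) T

/-- The product of the transpositions. -/
def permOf {n : ℕ} : List (Fin n × Fin n) → Perm (Fin n)
  | [] => 1
  | (a, b) :: T => permOf T * swap a b

/-- The exponent of the power of `q` that arises. -/
def expo {n : ℕ} : List (Fin n × Fin n) → Perm (Fin n) → Fin (n - 1) → ℕ
  | [], _ => 0
  | (a, b) :: T, w => (if b < a then qExp (w⁻¹ a) (w⁻¹ b) else 0) + expo T (swap a b * w)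

/-- The total increment of the function `φ` of the positions over the quantum operators. -/
def wsum {n : ℕ} : (Fin n → ℤ) → List (Fin n × Fin n) → ℤ
  | _, [] => 0
  | φ, (a, b) :: T => (if b < a then φ b - φ a else 0) + wsum (φ ∘ swap a b) T

lemma act_zero {n : ℕ} (k : ℕ) (x : Option (QPerm n)) : act k 0 x = none := rfl

lemma act_coe {n : ℕ} (k : ℕ) (v : Comp n) (x : Option (QPerm n)) :
    act k (v : WithZero (Comp n)) x = compAct k v x := rfl

lemma act_none {n : ℕ} (k : ℕ) (u : WithZero (Comp n)) : act k u none = none := by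
  induction u with
  | zero => rfl
  | coe v =>
    rw [act_coe, compAct]
    induction v.toList with
    | nil => rfl
    | cons o l ih => rw [List.foldr_cons, ih]; rfl

lemma act_mul {n : ℕ} (k : ℕ) (u v : WithZero (Comp n)) (x : Option (QPerm n)) :
    act k (u * v) x = act k u (act k v x) := by
  induction u with
  | zero => rw [zero_mul, act_zero, act_zero]
  | coe u =>
    induction v with
    | zero => rw [mul_zero, act_zero, act_none]
    | coe v =>
      rw [← WithZero.coe_mul, act_coe, act_coe, act_coe]
      simp [compAct, FreeMonoid.toList_mul]

lemma act_one {n : ℕ} (k : ℕ) (x : Option (QPerm n)) : act k 1 x = x := rfl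

lemma act_opWord {n : ℕ} (k : ℕ) (p : Fin n × Fin n) (x y : QPerm n) :
    act k (opWord p) (some x) = some y ↔ Allowed k p.1 p.2 x.2 ∧
      y = (x.1 + (if p.2 < p.1 then qExp (x.2⁻¹ p.1) (x.2⁻¹ p.2) else 0),
        swap p.1 p.2 * x.2) := by
  by_cases h : p.1 ≠ p.2
  · rw [opWord, dif_pos h, ← opAct_eq_some_iff k ⟨p, h⟩ x y, act_coe]
    simp [compAct]
  · rw [opWord, dif_neg h, act_zero]
    push Not at h
    simp only [reduceCtorEq, false_iff, not_and]
    rintro ⟨h1, h2, -⟩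
    rw [h] at h1
    omega

lemma equivalent_mul {n : ℕ} {u u' v v' : WithZero (Comp n)} (h : Equivalent u u')
    (h' : Equivalent v v') : Equivalent (u * v) (u' * v') := by
  intro k hk hk' x
  rw [act_mul, act_mul, h' k hk hk' x]
  cases hx : act k v' (some x) with
  | none => rw [act_none, act_none]
  | some y => exact h k hk hk' y

lemma Equivalent.refl {n : ℕ} (u : WithZero (Comp n)) : Equivalent u u := fun _ _ _ _ => rfl

lemma Equivalent.symm {n : ℕ} {u v : WithZero (Comp n)} (h : Equivalent u v) : Equivalent v u :=
  fun k hk hk' x => (h k hk hk' x).symm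

lemma Equivalent.trans {n : ℕ} {u v w : WithZero (Comp n)} (h : Equivalent u v)
    (h' : Equivalent v w) : Equivalent u w :=
  fun k hk hk' x => (h k hk hk' x).trans (h' k hk hk' x)

lemma word_append {n : ℕ} (S T : List (Fin n × Fin n)) : word (S ++ T) = word T * word S := by
  induction S with
  | nil => simp [word]
  | cons p S ih => rw [List.cons_append, word, ih, word, mul_assoc]

lemma word_opList {n : ℕ} (v : Comp n) : word (opList v) = (v : WithZero (Comp n)) := by
  induction v using FreeMonoid.recOn with
  | one => rfl
  | of_mul o v ih =>
    have : opList (FreeMonoid.of o * v) = opList v ++ [o.1] := by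
      simp [opList, FreeMonoid.toList_mul]
    rw [this, word_append, ih, WithZero.coe_mul]
    simp [word, opWord, o.2]

lemma opList_length {n : ℕ} (v : Comp n) : (opList v).length = v.length := by
  simp [opList, FreeMonoid.length]

lemma opList_injective {n : ℕ} : Function.Injective (opList (n := n)) := by
  intro u v h
  have := congrArg word h
  rw [word_opList, word_opList] at this
  exact WithZero.coe_inj.1 this

lemma place_swap {n : ℕ} (k : ℕ) (w : Perm (Fin n)) (a b : Fin n) :
    place k (swap a b * w) = place k w ∘ swap a b := by
  funext c
  simp [place, mul_inv_rev]

lemma allowed_iff {n : ℕ} (k : ℕ) (a b : Fin n) (w : Perm (Fin n)) :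
    Allowed k a b w ↔ place k w a < 0 ∧ 0 ≤ place k w b ∧
      ∀ c, Cyc a c b → place k w c < place k w a ∨ place k w b < place k w c := by
  simp only [Allowed, place, Fin.lt_def]
  refine and_congr (by omega) (and_congr (by omega) (forall_congr' fun c => ?_))
  refine imp_congr Iff.rfl (or_congr ?_ ?_) <;> omega

/-- Whether a word acts depends on `x` only through the positions of the values relative to the bar.
-/
lemma act_word {n : ℕ} (k : ℕ) (T : List (Fin n × Fin n)) (x y : QPerm n) :
    act k (word T) (some x) = some y ↔
      Ok (place k x.2) T ∧ y = (x.1 + expo T x.2, permOf T * x.2) := by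
  induction T generalizing x with
  | nil => simp [word, act_one, Ok, expo, permOf, eq_comm]
  | cons p T ih =>
    obtain ⟨a, b⟩ := p
    rw [word, act_mul, Ok]
    cases h : act k (opWord (a, b)) (some x) with
    | none =>
      rw [act_none]
      simp only [reduceCtorEq, false_iff, not_and]
      intro h1
      exfalso
      have h2 : Allowed k a b x.2 := (allowed_iff k a b x.2).2 ⟨h1.1, h1.2.1, h1.2.2.1⟩
      have := (act_opWord k (a, b) x _).2 ⟨h2, rfl⟩
      rw [h] at this
      cases this
    | some z =>
      obtain ⟨hA, rfl⟩ := (act_opWord k (a, b) x z).1 h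
      rw [ih, place_swap]
      rw [allowed_iff] at hA
      simp only [hA, true_and, expo, permOf, mul_assoc, add_assoc]
      exact ⟨fun q => ⟨⟨hA.2.2, q.1⟩, q.2⟩, fun q => ⟨q.1.2, q.2⟩⟩

lemma act_word_eq_none {n : ℕ} (k : ℕ) (T : List (Fin n × Fin n)) (x : QPerm n) :
    act k (word T) (some x) = none ↔ ¬ Ok (place k x.2) T := by
  rw [Option.eq_none_iff_forall_ne_some]
  simp only [ne_eq, act_word]
  exact ⟨fun h h' => h _ ⟨h', rfl⟩, fun h y h' => h h'.1⟩

lemma qLength_of_act_word {n : ℕ} {k : ℕ} {T : List (Fin n × Fin n)} {x y : QPerm n}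
    (h : act k (word T) (some x) = some y) : qLength y = qLength x + T.length := by
  induction T generalizing x with
  | nil => simp only [word, act_one, Option.some.injEq] at h; simp [h]
  | cons p T ih =>
    rw [word, act_mul] at h
    cases hz : act k (opWord p) (some x) with
    | none => rw [hz, act_none] at h; cases h
    | some z =>
      rw [hz] at h
      have : qLength z = qLength x + 1 := by
        by_cases hp : p.1 ≠ p.2
        · rw [opWord, dif_pos hp, act_coe] at hz
          exact qLength_of_opAct (k := k) (o := ⟨p, hp⟩) (by simpa [compAct] using hz)
        · rw [opWord, dif_neg hp, act_zero] at hz; cases hz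
      rw [ih h, this, List.length_cons]
      ring

lemma Ok.sides {n : ℕ} {F : Fin n → ℤ} {a b : Fin n} {T : List (Fin n × Fin n)}
    (h : Ok F ((a, b) :: T)) : F a < 0 ∧ 0 ≤ F b := ⟨h.1, h.2.1⟩

/-- Only the order of the positions and their sides of the bar matter, so arbitrary integers can
serve as positions. -/
lemma ok_congr {n : ℕ} {F G : Fin n → ℤ} (h0 : ∀ c, F c < 0 ↔ G c < 0)
    (h : ∀ c d, F c < F d ↔ G c < G d) (T : List (Fin n × Fin n)) : Ok F T ↔ Ok G T := by
  induction T generalizing F G with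
  | nil => rfl
  | cons p T ih =>
    obtain ⟨a, b⟩ := p
    rw [Ok, Ok, ih (F := F ∘ swap a b) (G := G ∘ swap a b) (fun c => h0 _) (fun c d => h _ _),
      h0 a, ← not_lt, h0 b, not_lt]
    simp only [h]

/-! ### The exponents -/

/-- A factor `q_{ij}` contains `q_{l+1}` exactly when the indicator function of the positions beyond
`l` jumps from position `i` to position `j`. -/
lemma expo_eq_wsum {n : ℕ} {k : ℕ} {T : List (Fin n × Fin n)} {w : Perm (Fin n)}
    (h : Ok (place k w) T) (l : Fin (n - 1)) :
    (expo T w l : ℤ) = wsum (fun c => if (l : ℕ) < (w⁻¹ c : ℕ) then 1 else 0) T := by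
  induction T generalizing w with
  | nil => simp [expo, wsum]
  | cons p T ih =>
    obtain ⟨a, b⟩ := p
    have h1 := h.sides
    rw [Ok, ← place_swap] at h
    have hw : (fun c => if (l : ℕ) < ((swap a b * w)⁻¹ c : ℕ) then (1 : ℤ) else 0) =
        (fun c => if (l : ℕ) < (w⁻¹ c : ℕ) then (1 : ℤ) else 0) ∘ swap a b := by
      funext c
      simp [mul_inv_rev]
    rw [expo, wsum, Pi.add_apply, Nat.cast_add, ih h.2.2.2, hw]
    congr 1
    simp only [place] at h1
    split_ifs <;> (simp_all [qExp]; try omega)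

lemma sum_qExp_mul {n : ℕ} {i j : Fin n} (hij : i ≤ j) (ψ : ℕ → ℤ) :
    ∑ l : Fin (n - 1), (qExp i j l : ℤ) * (ψ (l + 1) - ψ l) = ψ j - ψ i := by
  have h : ∑ l : Fin (n - 1), (qExp i j l : ℤ) * (ψ (l + 1) - ψ l) =
      ∑ l ∈ Finset.range (n - 1), if (i : ℕ) ≤ l ∧ l < j then ψ (l + 1) - ψ l else 0 := by
    rw [Finset.sum_range]
    refine Finset.sum_congr rfl fun l _ => ?_
    simp [qExp]
  have h2 : (Finset.range (n - 1)).filter (fun l => (i : ℕ) ≤ l ∧ l < j) =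
      Finset.Ico (i : ℕ) j := by
    ext l
    simp only [Finset.mem_filter, Finset.mem_range, Finset.mem_Ico]
    have := j.2
    omega
  rw [h, ← Finset.sum_filter, h2, Finset.sum_Ico_sub ψ hij]

/-- Telescoping: an increment of `ψ` is the sum of its unit steps, and the exponent counts how often
each step is used. Hence the exponent determines `wsum` for all functions. -/
lemma wsum_eq_sum_expo {n : ℕ} {k : ℕ} {T : List (Fin n × Fin n)} {w : Perm (Fin n)}
    (h : Ok (place k w) T) (ψ : ℕ → ℤ) :
    wsum (fun c => ψ (w⁻¹ c)) T = ∑ l, (expo T w l : ℤ) * (ψ (l + 1) - ψ l) := by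
  induction T generalizing w with
  | nil => simp [expo, wsum]
  | cons p T ih =>
    obtain ⟨a, b⟩ := p
    have h1 := h.sides
    rw [Ok, ← place_swap] at h
    have hw : (fun c => ψ ((swap a b * w)⁻¹ c)) = (fun c => ψ (w⁻¹ c)) ∘ swap a b := by
      funext c
      simp [mul_inv_rev]
    rw [wsum, ← hw, ih h.2.2.2]
    simp only [expo, Pi.add_apply, Nat.cast_add, add_mul, Finset.sum_add_distrib]
    congr 1
    have hle : w⁻¹ a ≤ w⁻¹ b := by
      simp only [place] at h1
      rw [Fin.le_def]; omega
    split_ifs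
    · rw [sum_qExp_mul hle]
    · simp

/-! ### A criterion for equivalence -/

theorem equivalent_of_forall {n : ℕ} {T T' : List (Fin n × Fin n)} (h : ∀ F, Ok F T ↔ Ok F T')
    (hp : permOf T = permOf T') (hw : ∀ φ, wsum φ T = wsum φ T') :
    Equivalent (word T) (word T') := by
  intro k _ _ x
  by_cases hT : Ok (place k x.2) T
  · rw [(act_word k T x _).2 ⟨hT, rfl⟩, (act_word k T' x _).2 ⟨(h _).1 hT, rfl⟩, hp]
    have : expo T x.2 = expo T' x.2 := by
      funext l
      have := expo_eq_wsum hT l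
      rw [hw, ← expo_eq_wsum ((h _).1 hT) l] at this
      exact_mod_cast this
    rw [this]
  · rw [(act_word_eq_none k T x).2 hT, (act_word_eq_none k T' x).2 (mt (h _).2 hT)]

theorem equivalent_zero_of_forall {n : ℕ} {T : List (Fin n × Fin n)} (h : ∀ F, ¬ Ok F T) :
    Equivalent (word T) 0 :=
  fun k _ _ x => (act_word_eq_none k T x).2 (h _)

/-- Sorting the values by `F` gives the permutation, and `k` is the number of negative positions.
The values `a` and `b` ensure that neither side of the bar is empty, so that `1 ≤ k < n`. -/
lemma exists_place {n : ℕ} {F : Fin n → ℤ} (hF : Function.Injective F) {a b : Fin n} (ha : F a < 0)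
    (hb : 0 ≤ F b) : ∃ k, 1 ≤ k ∧ k < n ∧ ∃ w : Perm (Fin n), (∀ c, place k w c < 0 ↔ F c < 0) ∧
      ∀ c d, place k w c < place k w d ↔ F c < F d := by
  set w : Perm (Fin n) := Tuple.sort F with hw
  have hm : StrictMono (F ∘ w) := (Tuple.monotone_sort F).strictMono_of_injective
    (hF.comp w.injective)
  have hlt : ∀ c d, w⁻¹ c < w⁻¹ d ↔ F c < F d := by
    intro c d
    rw [← hm.lt_iff_lt]
    simp
  set s := Finset.univ.filter fun c => F c < 0 with hs
  have hk : ∀ c, (w⁻¹ c : ℕ) < s.card ↔ F c < 0 := by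
    intro c
    have e : ∀ c, (w⁻¹ c : ℕ) = (Finset.univ.filter fun d => F d < F c).card := by
      intro c
      rw [← Fin.card_Iio (w⁻¹ c)]
      refine (Finset.card_bij (fun d _ => w⁻¹ d) ?_ ?_ ?_).symm
      · intro d hd
        simp only [Finset.mem_filter, Finset.mem_univ, true_and] at hd
        exact Finset.mem_Iio.2 ((hlt _ _).2 hd)
      · intro d _ d' _ e
        exact w⁻¹.injective e
      · intro i hi
        refine ⟨w i, ?_, by simp⟩
        have : w⁻¹ (w i) < w⁻¹ c := by rw [perm_inv_apply_self]; exact Finset.mem_Iio.1 hi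
        simpa using (hlt _ _).1 this
    rw [e c]
    constructor
    · intro h
      by_contra hc
      refine absurd (Finset.card_le_card ?_) (not_le.2 h)
      intro d hd
      simp only [hs, Finset.mem_filter, Finset.mem_univ, true_and] at hd ⊢
      omega
    · intro h
      refine Finset.card_lt_card ⟨fun d hd => ?_, fun hsub => ?_⟩
      · simp only [hs, Finset.mem_filter, Finset.mem_univ, true_and] at hd ⊢
        omega
      · have : c ∈ s := by simp [hs, h]
        simpa using hsub this
  refine ⟨s.card, ?_, ?_, w, ?_, ?_⟩
  · have := (hk a).2 ha
    omega
  · have := mt (hk b).1 (not_lt.2 hb)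
    have := (w⁻¹ b).2
    omega
  · intro c
    rw [← hk c, place]
    omega
  · intro c d
    rw [← hlt c d, place, place, Fin.lt_def]
    omega

/-- One position function on which `T` acts suffices: there the two results agree in permutation,
exponent and length. -/
theorem ok_of_equivalent {n : ℕ} {T T' : List (Fin n × Fin n)} (h : Equivalent (word T) (word T'))
    (hT : T ≠ []) {F : Fin n → ℤ} (hF : Function.Injective F) (hok : Ok F T) :
    Ok F T' ∧ permOf T = permOf T' ∧ (∀ φ, wsum φ T = wsum φ T') ∧ T.length = T'.length := by
  obtain ⟨a, b, ha, hb⟩ : ∃ a b, F a < 0 ∧ 0 ≤ F b := by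
    cases T with
    | nil => exact absurd rfl hT
    | cons p T => exact ⟨_, _, hok.sides⟩
  obtain ⟨k, hk, hk', w, h0, hlt⟩ := exists_place hF ha hb
  have hok1 : Ok (place k w) T := (ok_congr h0 hlt T).2 hok
  have e := (act_word k T (0, w) _).2 ⟨hok1, rfl⟩
  have e' := e
  rw [h k hk hk'] at e'
  obtain ⟨hok2, heq⟩ := (act_word k T' (0, w) _).1 e'
  simp only [zero_add, Prod.mk.injEq, mul_left_inj] at heq
  refine ⟨(ok_congr h0 hlt T').1 hok2, heq.2, fun φ => ?_, ?_⟩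
  -- A function of the values is a function of the positions after composition with `w`; the value
  -- `0` outside the range is never used.
  · have : φ = fun c => (fun i : ℕ => if hi : i < n then φ (w ⟨i, hi⟩) else 0) (w⁻¹ c : ℕ) := by
      funext c
      simp
    rw [this, wsum_eq_sum_expo hok1 (fun i : ℕ => if hi : i < n then φ (w ⟨i, hi⟩) else 0),
      wsum_eq_sum_expo hok2 (fun i : ℕ => if hi : i < n then φ (w ⟨i, hi⟩) else 0), heq.1]
  · have := qLength_of_act_word e
    have := qLength_of_act_word e'
    omega

theorem not_equivalent_zero {n : ℕ} {T : List (Fin n × Fin n)} (hT : T ≠ []) {F : Fin n → ℤ}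
    (hF : Function.Injective F) (hok : Ok F T) : ¬ Equivalent (word T) 0 := by
  intro h
  obtain ⟨a, b, ha, hb⟩ : ∃ a b, F a < 0 ∧ 0 ≤ F b := by
    cases T with
    | nil => exact absurd rfl hT
    | cons p T => exact ⟨_, _, hok.sides⟩
  obtain ⟨k, hk, hk', w, h0, hlt⟩ := exists_place hF ha hb
  have e := h k hk hk' (0, w)
  rw [act_zero, act_word_eq_none] at e
  exact e ((ok_congr h0 hlt T).2 hok)

theorem exists_ok_of_not_equivalent_zero {n : ℕ} {T : List (Fin n × Fin n)}
    (h : ¬ Equivalent (word T) 0) : ∃ F : Fin n → ℤ, Function.Injective F ∧ Ok F T := by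
  by_contra hcon
  push Not at hcon
  refine h fun k _ _ x => (act_word_eq_none k T x).2 (hcon _ fun c d hcd => ?_)
  simp only [place, sub_left_inj, Nat.cast_inj] at hcd
  exact (x.2⁻¹).injective (Fin.ext hcd)

/-! ### Equivalences of low degree -/

lemma comp_swap_apply {n : ℕ} {α : Type*} (F : Fin n → α) (a b c : Fin n) :
    (F ∘ swap a b) c = if c = a then F b else if c = b then F a else F c := by
  simp only [Function.comp, swap_apply_def]; split_ifs <;> rfl

/-- The operators `p`, `q`, applied in this order, annihilate everything. -/
def ZeroPair {α : Type*} [LT α] (p q : α × α) : Prop :=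
  q.1 = p.1 ∨ q.2 = p.2 ∨ (q.1 = p.2 ∧ Cyc p.1 q.2 p.2) ∨ (q.2 = p.1 ∧ Cyc p.1 q.1 p.2) ∨
    (q.1 ≠ p.2 ∧ q.2 ≠ p.1 ∧ ((Cyc p.1 q.1 p.2 ∧ ¬ Cyc p.1 q.2 p.2) ∨
      (¬ Cyc p.1 q.1 p.2 ∧ Cyc p.1 q.2 p.2) ∨ (Cyc p.1 q.1 p.2 ∧ Cyc q.1 p.1 q.2)))

/-- The operators `p` and `q` have no index in common. -/
def DisjointOps {α : Type*} (p q : α × α) : Prop :=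
  q.1 ≠ p.1 ∧ q.1 ≠ p.2 ∧ q.2 ≠ p.1 ∧ q.2 ≠ p.2

/-- After `p = (a, b)` the value `a` is right of the bar and `b` is left of it, which excludes a
repeated source or target. Otherwise, an index of `q` on the arc from `a` to `b` has to stand
outside the interval of positions that `p` used; the interval of `q` then encloses an endpoint of
`p` lying on the arc of `q`. -/
lemma not_ok_of_zeroPair {n : ℕ} {F : Fin n → ℤ} {p q : Fin n × Fin n} (h : ZeroPair p q) :
    ¬ Ok F [p, q] := by
  obtain ⟨a, b⟩ := p
  obtain ⟨c, d⟩ := q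
  simp only [ZeroPair, Ok, comp_swap_apply, Cyc, Fin.lt_def, Fin.ext_iff, ne_eq] at h ⊢
  rintro ⟨h1, h2, h3, h4, h5, h6, -⟩
  have e1 := h3 c
  have e2 := h3 d
  have e3 := h6 a
  have e4 := h6 b
  clear h3 h6
  rcases h with h | h | h | h | ⟨h, h', h'' | h'' | h''⟩ <;> grind

/-- Once `ZeroPair` is excluded, the arcs of two operators without a common index are disjoint or
nested, and neither operator obstructs the other. -/
lemma ok_swap_pair {n : ℕ} {F : Fin n → ℤ} {p q : Fin n × Fin n} (hd : DisjointOps p q)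
    (hok : Ok F [p, q]) : Ok F [q, p] := by
  have h : ¬ ZeroPair p q := fun h => not_ok_of_zeroPair h hok
  obtain ⟨a, b⟩ := p
  obtain ⟨c, d⟩ := q
  simp only [ZeroPair, DisjointOps, Ok, comp_swap_apply, Cyc, Fin.lt_def, Fin.ext_iff, ne_eq]
    at h hd hok ⊢
  obtain ⟨h1, h2, h3, h4, h5, h6, -⟩ := hok
  have e1 := h3 c
  have e2 := h3 d
  have e3 := h6 a
  have e4 := h6 b
  refine ⟨?_, ?_, ?_, ?_, ?_, ?_, trivial⟩
  · grind
  · grind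
  · intro e; have := h3 e; have := h6 e; clear h3 h6; grind
  · grind
  · grind
  · intro e; have := h3 e; have := h6 e; clear h3 h6; grind

theorem equivalent_swap {n : ℕ} {p q : Fin n × Fin n} (hd : DisjointOps p q) :
    Equivalent (word [p, q]) (word [q, p]) := by
  have hd' : DisjointOps q p := ⟨hd.1.symm, hd.2.2.1.symm, hd.2.1.symm, hd.2.2.2.symm⟩
  refine equivalent_of_forall (fun F => ⟨ok_swap_pair hd, ok_swap_pair hd'⟩) ?_ ?_
  · obtain ⟨a, b⟩ := p
    obtain ⟨c, d⟩ := q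
    simp only [permOf, one_mul]
    refine (Equiv.Perm.Disjoint.commute ?_).eq
    intro x
    simp only [DisjointOps, ne_eq] at hd
    by_cases hx : x = c ∨ x = d
    · right
      rcases hx with rfl | rfl <;> exact swap_apply_of_ne_of_ne (by tauto) (by tauto)
    · left
      exact swap_apply_of_ne_of_ne (by tauto) (by tauto)
  · intro φ
    obtain ⟨a, b⟩ := p
    obtain ⟨c, d⟩ := q
    simp only [DisjointOps, ne_eq] at hd
    simp only [wsum, comp_swap_apply]
    grind

/-! ### Zero words of degree three -/

lemma cyc_cases {n : ℕ} {a b c d : Fin n} (h : Cyc a b c) (h' : Cyc c d a) :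
    (a < b ∧ b < c ∧ c < d) ∨ (b < c ∧ c < d ∧ d < a) ∨ (c < d ∧ d < a ∧ a < b) ∨
      (d < a ∧ a < b ∧ b < c) := by
  simp only [Cyc, Fin.lt_def] at *
  omega

lemma cyc_ne {n : ℕ} {a b c : Fin n} (h : Cyc a b c) :
    (a ≠ b ∧ b ≠ a) ∧ (b ≠ c ∧ c ≠ b) ∧ (a ≠ c ∧ c ≠ a) := by
  simp only [Cyc, Fin.lt_def, ne_eq, Fin.ext_iff] at *
  omega

/-- After the first operator `a` is right of the bar, and the second does not move it back. -/
lemma not_ok_braid_up {n : ℕ} {F : Fin n → ℤ} {a b c : Fin n} (h : Cyc a b c) :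
    ¬ Ok F [(a, b), (b, c), (a, b)] := by
  have hne := cyc_ne h
  simp only [ne_eq] at hne
  simp only [Ok, comp_swap_apply, hne, if_true, if_false]
  rintro ⟨h1, h2, h3, h4, h5, h6, h7, h8, h9, -⟩
  have e0 := h3 c
  have e1 := h6 a
  have e2 := h9 c
  simp only [hne, if_true, if_false] at *
  clear h3 h6 h9
  simp only [Cyc, Fin.lt_def] at *
  rcases h with h | h | h <;> omega

/-- After the first operator `c` is left of the bar, and the second does not move it back. -/
lemma not_ok_braid_down {n : ℕ} {F : Fin n → ℤ} {a b c : Fin n} (h : Cyc a b c) :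
    ¬ Ok F [(b, c), (a, b), (b, c)] := by
  have hne := cyc_ne h
  simp only [ne_eq] at hne
  simp only [Ok, comp_swap_apply, hne, if_true, if_false]
  rintro ⟨h1, h2, h3, h4, h5, h6, h7, h8, h9, -⟩
  have e0 := h3 a
  have e1 := h6 c
  have e2 := h9 a
  simp only [hne, if_true, if_false] at *
  clear h3 h6 h9
  simp only [Cyc, Fin.lt_def] at *
  rcases h with h | h | h <;> omega

/-- The first operator forces `b` to stand beyond the initial position of `c`. That position is then
taken by `a`, which lies on the arc from `d` to `b` and blocks the last operator. -/
lemma not_ok_chain_up {n : ℕ} {F : Fin n → ℤ} {a b c d : Fin n} (h : Cyc a b c) (h' : Cyc c d a) :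
    ¬ Ok F [(a, c), (c, d), (d, b)] := by
  have hne := cyc_ne h
  have hne' := cyc_ne h'
  have hlin := cyc_cases h h'
  have hbd : b ≠ d ∧ d ≠ b := by
    simp only [Fin.lt_def, ne_eq, Fin.ext_iff] at *
    omega
  simp only [ne_eq] at hne hne' hbd
  simp only [Ok, comp_swap_apply, hne, hne', hbd, if_true, if_false]
  rintro ⟨h1, h2, h3, h4, h5, h6, h7, h8, h9, -⟩
  have e0 := h3 b
  have e1 := h3 d
  have e2 := h6 a
  have e3 := h6 b
  have e4 := h9 a
  have e5 := h9 c
  simp only [hne, hne', hbd, if_true, if_false] at *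
  clear h3 h6 h9
  simp only [Cyc, Fin.lt_def] at *
  rcases hlin with h | h | h | h <;> omega

/-- The first operator forces `a` to stand left of the initial position of `d`. That position is
then taken by `b`, which lies on the arc from `a` to `c` and blocks the last operator. -/
lemma not_ok_chain_down {n : ℕ} {F : Fin n → ℤ} {a b c d : Fin n} (h : Cyc a b c) (h' : Cyc c d a) :
    ¬ Ok F [(d, b), (c, d), (a, c)] := by
  have hne := cyc_ne h
  have hne' := cyc_ne h'
  have hlin := cyc_cases h h'
  have hbd : b ≠ d ∧ d ≠ b := by
    simp only [Fin.lt_def, ne_eq, Fin.ext_iff] at *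
    omega
  simp only [ne_eq] at hne hne' hbd
  simp only [Ok, comp_swap_apply, hne, hne', hbd, if_true, if_false]
  rintro ⟨h1, h2, h3, h4, h5, h6, h7, h8, h9, -⟩
  have e0 := h3 a
  have e1 := h3 c
  have e2 := h6 a
  have e3 := h6 b
  have e4 := h9 b
  have e5 := h9 d
  simp only [hne, hne', hbd, if_true, if_false] at *
  clear h3 h6 h9
  simp only [Cyc, Fin.lt_def] at *
  rcases hlin with h | h | h | h <;> omega

/-! ### The cubic and quartic relations -/

section Relations

set_option linter.unusedSimpArgs false
set_option linter.unusedTactic false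
set_option linter.unreachableTactic false

lemma not_cyc_left {n : ℕ} (a b : Fin n) : ¬ Cyc a a b := by
  simp only [Cyc, Fin.lt_def]; omega

lemma not_cyc_right {n : ℕ} (a b : Fin n) : ¬ Cyc a b b := by
  simp only [Cyc, Fin.lt_def]; omega

lemma cyc_relations_three {n : ℕ} {a b c : Fin n} (h : Cyc a b c) :
    ¬ a = b ∧ ¬ b = a ∧ ¬ b = c ∧ ¬ c = b ∧ ¬ a = c ∧ ¬ c = a ∧ Cyc a b c ∧ ¬ Cyc a c b ∧
    ¬ Cyc b a c ∧ Cyc b c a ∧ Cyc c a b ∧ ¬ Cyc c b a := by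
  have hlin := h
  clear h
  simp only [Cyc, Fin.lt_def, Fin.ext_iff] at *
  rcases hlin with h | h | h <;> (and_intros <;> omega)

lemma cyc_gaps_three {n : ℕ} {a b c : Fin n} (h : Cyc a b c) {x : Fin n}
    (xa : ¬ x = a) (xb : ¬ x = b) (xc : ¬ x = c) :
    (Cyc a x b ∧ Cyc a x c ∧ ¬ Cyc b x a ∧ ¬ Cyc b x c ∧ ¬ Cyc c x a ∧ Cyc c x b) ∨
    (¬ Cyc a x b ∧ Cyc a x c ∧ Cyc b x a ∧ Cyc b x c ∧ ¬ Cyc c x a ∧ ¬ Cyc c x b) ∨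
    (¬ Cyc a x b ∧ ¬ Cyc a x c ∧ Cyc b x a ∧ ¬ Cyc b x c ∧ Cyc c x a ∧ Cyc c x b) := by
  have hlin := h
  clear h
  have hex : Cyc a x b ∨ Cyc b x c ∨ Cyc c x a := by
    simp only [Cyc, Fin.lt_def, Fin.ext_iff] at *
    rcases hlin with h | h | h <;> omega
  simp only [Cyc, Fin.lt_def, Fin.ext_iff] at hlin hex ⊢
  rcases hex with hx | hx | hx
  · refine Or.inl ?_
    rcases hlin with h | h | h <;> rcases hx with hx | hx | hx <;>
      first | omega | (and_intros <;> omega)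
  · refine Or.inr (Or.inl ?_)
    rcases hlin with h | h | h <;> rcases hx with hx | hx | hx <;>
      first | omega | (and_intros <;> omega)
  · refine Or.inr (Or.inr ?_)
    rcases hlin with h | h | h <;> rcases hx with hx | hx | hx <;>
      first | omega | (and_intros <;> omega)

lemma cyc_relations_four {n : ℕ} {a b c d : Fin n} (h : Cyc a b c) (h' : Cyc c d a) :
    ¬ a = b ∧ ¬ b = a ∧ ¬ b = c ∧ ¬ c = b ∧ ¬ a = c ∧ ¬ c = a ∧ ¬ c = d ∧ ¬ d = c ∧ ¬ d = a ∧
    ¬ a = d ∧ ¬ b = d ∧ ¬ d = b ∧ Cyc a b c ∧ Cyc a b d ∧ ¬ Cyc a c b ∧ Cyc a c d ∧ ¬ Cyc a d b ∧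
    ¬ Cyc a d c ∧ ¬ Cyc b a c ∧ ¬ Cyc b a d ∧ Cyc b c a ∧ Cyc b c d ∧ Cyc b d a ∧ ¬ Cyc b d c ∧
    Cyc c a b ∧ ¬ Cyc c a d ∧ ¬ Cyc c b a ∧ ¬ Cyc c b d ∧ Cyc c d a ∧ Cyc c d b ∧ Cyc d a b ∧
    Cyc d a c ∧ ¬ Cyc d b a ∧ Cyc d b c ∧ ¬ Cyc d c a ∧ ¬ Cyc d c b := by
  have hlin := cyc_cases h h'
  clear h h'
  simp only [Cyc, Fin.lt_def, Fin.ext_iff] at *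
  rcases hlin with h | h | h | h <;> (and_intros <;> omega)

/-- Four points cut the circle into four arcs, and the arc that contains `x` decides all betweenness
relations. A further index thus needs only four cases in the proofs below. -/
lemma cyc_gaps_four {n : ℕ} {a b c d : Fin n} (h : Cyc a b c) (h' : Cyc c d a) {x : Fin n}
    (xa : ¬ x = a) (xb : ¬ x = b) (xc : ¬ x = c) (xd : ¬ x = d) :
    (Cyc a x b ∧ Cyc a x c ∧ Cyc a x d ∧ ¬ Cyc b x a ∧ ¬ Cyc b x c ∧ ¬ Cyc b x d ∧ ¬ Cyc c x a ∧
      Cyc c x b ∧ ¬ Cyc c x d ∧ ¬ Cyc d x a ∧ Cyc d x b ∧ Cyc d x c) ∨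
    (¬ Cyc a x b ∧ Cyc a x c ∧ Cyc a x d ∧ Cyc b x a ∧ Cyc b x c ∧ Cyc b x d ∧ ¬ Cyc c x a ∧
      ¬ Cyc c x b ∧ ¬ Cyc c x d ∧ ¬ Cyc d x a ∧ ¬ Cyc d x b ∧ Cyc d x c) ∨
    (¬ Cyc a x b ∧ ¬ Cyc a x c ∧ Cyc a x d ∧ Cyc b x a ∧ ¬ Cyc b x c ∧ Cyc b x d ∧ Cyc c x a ∧
      Cyc c x b ∧ Cyc c x d ∧ ¬ Cyc d x a ∧ ¬ Cyc d x b ∧ ¬ Cyc d x c) ∨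
    (¬ Cyc a x b ∧ ¬ Cyc a x c ∧ ¬ Cyc a x d ∧ Cyc b x a ∧ ¬ Cyc b x c ∧ ¬ Cyc b x d ∧
      Cyc c x a ∧ Cyc c x b ∧ ¬ Cyc c x d ∧ Cyc d x a ∧ Cyc d x b ∧ Cyc d x c) := by
  have hlin := cyc_cases h h'
  clear h h'
  have hex : Cyc a x b ∨ Cyc b x c ∨ Cyc c x d ∨ Cyc d x a := by
    simp only [Cyc, Fin.lt_def, Fin.ext_iff] at *
    rcases hlin with h | h | h | h <;> omega
  simp only [Cyc, Fin.lt_def, Fin.ext_iff] at hlin hex ⊢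
  rcases hex with hx | hx | hx | hx
  · refine Or.inl ?_
    rcases hlin with h | h | h | h <;> rcases hx with hx | hx | hx <;>
      first | omega | (and_intros <;> omega)
  · refine Or.inr (Or.inl ?_)
    rcases hlin with h | h | h | h <;> rcases hx with hx | hx | hx <;>
      first | omega | (and_intros <;> omega)
  · refine Or.inr (Or.inr (Or.inl ?_))
    rcases hlin with h | h | h | h <;> rcases hx with hx | hx | hx <;>
      first | omega | (and_intros <;> omega)
  · refine Or.inr (Or.inr (Or.inr ?_))
    rcases hlin with h | h | h | h <;> rcases hx with hx | hx | hx <;>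
      first | omega | (and_intros <;> omega)

/-- Both words force `c` to stand between the bar and `b`, and they move the four indices to the
same places. For the remaining indices the two sets of forbidden intervals are compared arc by arc.
-/
lemma ok_long_up {n : ℕ} {F : Fin n → ℤ} {a b c d : Fin n} (h : Cyc a b c) (h' : Cyc c d a)
    (hok : Ok F [(a, b), (b, c), (d, b)]) :
    Ok F [(a, c), (d, a), (a, b)] := by
  have hne := cyc_relations_four h h'
  simp only [Ok, comp_swap_apply, hne, if_true, if_false] at hok ⊢
  obtain ⟨h1, h2, h3, h4, h5, h6, h7, h8, h9, -⟩ := hok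
  -- At the last operator `a` stands where `b` started and lies on the arc from `d` to `b`; not
  -- being in the way means `F c < F b`.
  have e0 := h9 a
  simp only [hne, if_true, if_false, true_imp_iff] at e0
  refine ⟨by omega, by omega, fun x hx => ?_, by omega, by omega, fun x hx => ?_, by omega,
    by omega, fun x hx => ?_, trivial⟩
  all_goals
    by_cases xa : x = a
    · subst xa
      simp only [hne, not_cyc_left, not_cyc_right, if_true, if_false] at hx ⊢ <;> omega
    by_cases xb : x = b
    · subst xb
      simp only [hne, not_cyc_left, not_cyc_right, if_true, if_false] at hx ⊢ <;> omega
    by_cases xc : x = c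
    · subst xc
      simp only [hne, not_cyc_left, not_cyc_right, if_true, if_false] at hx ⊢ <;> omega
    by_cases xd : x = d
    · subst xd
      simp only [hne, not_cyc_left, not_cyc_right, if_true, if_false] at hx ⊢ <;> omega
    have f0 := h3 x
    have f1 := h6 x
    have f2 := h9 x
    simp only [xa, xb, xc, xd, if_false] at f0 f1 f2 ⊢
    clear h3 h6 h9
    rcases cyc_gaps_four h h' xa xb xc xd with g | g | g | g <;>
    simp only [g, true_imp_iff, false_imp_iff] at f0 f1 f2 hx <;> omega

lemma ok_long_up_symm {n : ℕ} {F : Fin n → ℤ} {a b c d : Fin n} (h : Cyc a b c) (h' : Cyc c d a)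
    (hok : Ok F [(a, c), (d, a), (a, b)]) :
    Ok F [(a, b), (b, c), (d, b)] := by
  have hne := cyc_relations_four h h'
  simp only [Ok, comp_swap_apply, hne, if_true, if_false] at hok ⊢
  obtain ⟨h1, h2, h3, h4, h5, h6, h7, h8, h9, -⟩ := hok
  have e0 := h3 b
  simp only [hne, if_true, if_false, true_imp_iff] at e0
  refine ⟨by omega, by omega, fun x hx => ?_, by omega, by omega, fun x hx => ?_, by omega,
    by omega, fun x hx => ?_, trivial⟩
  all_goals
    by_cases xa : x = a
    · subst xa
      simp only [hne, not_cyc_left, not_cyc_right, if_true, if_false] at hx ⊢ <;> omega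
    by_cases xb : x = b
    · subst xb
      simp only [hne, not_cyc_left, not_cyc_right, if_true, if_false] at hx ⊢ <;> omega
    by_cases xc : x = c
    · subst xc
      simp only [hne, not_cyc_left, not_cyc_right, if_true, if_false] at hx ⊢ <;> omega
    by_cases xd : x = d
    · subst xd
      simp only [hne, not_cyc_left, not_cyc_right, if_true, if_false] at hx ⊢ <;> omega
    have f0 := h3 x
    have f1 := h6 x
    have f2 := h9 x
    simp only [xa, xb, xc, xd, if_false] at f0 f1 f2 ⊢
    clear h3 h6 h9
    rcases cyc_gaps_four h h' xa xb xc xd with g | g | g | g <;>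
    simp only [g, true_imp_iff, false_imp_iff] at f0 f1 f2 hx <;> omega

theorem equivalent_long_up {n : ℕ} {a b c d : Fin n} (h : Cyc a b c) (h' : Cyc c d a) :
    Equivalent (word [(a, b), (b, c), (d, b)])
      (word [(a, c), (d, a), (a, b)]) := by
  have hne := cyc_relations_four h h'
  refine equivalent_of_forall (fun F => ⟨ok_long_up h h', ok_long_up_symm h h'⟩)
    (Equiv.ext fun x => ?_) fun φ => ?_
  · simp only [permOf, one_mul, Perm.mul_apply, swap_apply_def]
    by_cases xa : x = a
    · simp only [xa, hne, if_true, if_false]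
    by_cases xb : x = b
    · simp only [xb, hne, if_true, if_false]
    by_cases xc : x = c
    · simp only [xc, hne, if_true, if_false]
    by_cases xd : x = d
    · simp only [xd, hne, if_true, if_false]
    simp only [xa, xb, xc, xd, if_false]
  -- Which operators are quantum depends on the rotation of the cyclic order; in each rotation the
  -- increments have the same sum.
  · simp only [wsum, comp_swap_apply, hne, if_true, if_false]
    clear hne
    have hlin := cyc_cases h h'
    clear h h'
    simp only [Fin.lt_def] at *
    rcases hlin with h | h | h | h <;> split_ifs <;> omega

/-- The reversed relation. Here both words force `F a < F d`. -/
lemma ok_long_down {n : ℕ} {F : Fin n → ℤ} {a b c d : Fin n} (h : Cyc a b c) (h' : Cyc c d a)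
    (hok : Ok F [(d, b), (b, c), (a, b)]) :
    Ok F [(a, b), (d, a), (a, c)] := by
  have hne := cyc_relations_four h h'
  simp only [Ok, comp_swap_apply, hne, if_true, if_false] at hok ⊢
  obtain ⟨h1, h2, h3, h4, h5, h6, h7, h8, h9, -⟩ := hok
  have e0 := h3 a
  simp only [hne, if_true, if_false, true_imp_iff] at e0
  refine ⟨by omega, by omega, fun x hx => ?_, by omega, by omega, fun x hx => ?_, by omega,
    by omega, fun x hx => ?_, trivial⟩
  all_goals
    by_cases xa : x = a
    · subst xa
      simp only [hne, not_cyc_left, not_cyc_right, if_true, if_false] at hx ⊢ <;> omega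
    by_cases xb : x = b
    · subst xb
      simp only [hne, not_cyc_left, not_cyc_right, if_true, if_false] at hx ⊢ <;> omega
    by_cases xc : x = c
    · subst xc
      simp only [hne, not_cyc_left, not_cyc_right, if_true, if_false] at hx ⊢ <;> omega
    by_cases xd : x = d
    · subst xd
      simp only [hne, not_cyc_left, not_cyc_right, if_true, if_false] at hx ⊢ <;> omega
    have f0 := h3 x
    have f1 := h6 x
    have f2 := h9 x
    simp only [xa, xb, xc, xd, if_false] at f0 f1 f2 ⊢
    clear h3 h6 h9
    rcases cyc_gaps_four h h' xa xb xc xd with g | g | g | g <;>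
    simp only [g, true_imp_iff, false_imp_iff] at f0 f1 f2 hx <;> omega

lemma ok_long_down_symm {n : ℕ} {F : Fin n → ℤ} {a b c d : Fin n} (h : Cyc a b c) (h' : Cyc c d a)
    (hok : Ok F [(a, b), (d, a), (a, c)]) :
    Ok F [(d, b), (b, c), (a, b)] := by
  have hne := cyc_relations_four h h'
  simp only [Ok, comp_swap_apply, hne, if_true, if_false] at hok ⊢
  obtain ⟨h1, h2, h3, h4, h5, h6, h7, h8, h9, -⟩ := hok
  have e0 := h9 b
  simp only [hne, if_true, if_false, true_imp_iff] at e0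
  refine ⟨by omega, by omega, fun x hx => ?_, by omega, by omega, fun x hx => ?_, by omega,
    by omega, fun x hx => ?_, trivial⟩
  all_goals
    by_cases xa : x = a
    · subst xa
      simp only [hne, not_cyc_left, not_cyc_right, if_true, if_false] at hx ⊢ <;> omega
    by_cases xb : x = b
    · subst xb
      simp only [hne, not_cyc_left, not_cyc_right, if_true, if_false] at hx ⊢ <;> omega
    by_cases xc : x = c
    · subst xc
      simp only [hne, not_cyc_left, not_cyc_right, if_true, if_false] at hx ⊢ <;> omega
    by_cases xd : x = d
    · subst xd
      simp only [hne, not_cyc_left, not_cyc_right, if_true, if_false] at hx ⊢ <;> omega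
    have f0 := h3 x
    have f1 := h6 x
    have f2 := h9 x
    simp only [xa, xb, xc, xd, if_false] at f0 f1 f2 ⊢
    clear h3 h6 h9
    rcases cyc_gaps_four h h' xa xb xc xd with g | g | g | g <;>
    simp only [g, true_imp_iff, false_imp_iff] at f0 f1 f2 hx <;> omega

theorem equivalent_long_down {n : ℕ} {a b c d : Fin n} (h : Cyc a b c) (h' : Cyc c d a) :
    Equivalent (word [(d, b), (b, c), (a, b)])
      (word [(a, b), (d, a), (a, c)]) := by
  have hne := cyc_relations_four h h'
  refine equivalent_of_forall (fun F => ⟨ok_long_down h h', ok_long_down_symm h h'⟩)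
    (Equiv.ext fun x => ?_) fun φ => ?_
  · simp only [permOf, one_mul, Perm.mul_apply, swap_apply_def]
    by_cases xa : x = a
    · simp only [xa, hne, if_true, if_false]
    by_cases xb : x = b
    · simp only [xb, hne, if_true, if_false]
    by_cases xc : x = c
    · simp only [xc, hne, if_true, if_false]
    by_cases xd : x = d
    · simp only [xd, hne, if_true, if_false]
    simp only [xa, xb, xc, xd, if_false]
  · simp only [wsum, comp_swap_apply, hne, if_true, if_false]
    clear hne
    have hlin := cyc_cases h h'
    clear h h'
    simp only [Fin.lt_def] at *
    rcases hlin with h | h | h | h <;> split_ifs <;> omega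

/-- The degenerate case `d = c` of `ok_long_up`, again with `F c < F b` as the common constraint. -/
lemma ok_short_up {n : ℕ} {F : Fin n → ℤ} {a b c : Fin n} (h : Cyc a b c)
    (hok : Ok F [(a, b), (b, c), (c, b)]) :
    Ok F [(a, c), (c, a), (a, b)] := by
  have hne := cyc_relations_three h
  simp only [Ok, comp_swap_apply, hne, if_true, if_false] at hok ⊢
  obtain ⟨h1, h2, h3, h4, h5, h6, h7, h8, h9, -⟩ := hok
  have e0 := h9 a
  simp only [hne, if_true, if_false, true_imp_iff] at e0
  refine ⟨by omega, by omega, fun x hx => ?_, by omega, by omega, fun x hx => ?_, by omega,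
    by omega, fun x hx => ?_, trivial⟩
  all_goals
    by_cases xa : x = a
    · subst xa
      simp only [hne, not_cyc_left, not_cyc_right, if_true, if_false] at hx ⊢ <;> omega
    by_cases xb : x = b
    · subst xb
      simp only [hne, not_cyc_left, not_cyc_right, if_true, if_false] at hx ⊢ <;> omega
    by_cases xc : x = c
    · subst xc
      simp only [hne, not_cyc_left, not_cyc_right, if_true, if_false] at hx ⊢ <;> omega
    have f0 := h3 x
    have f1 := h6 x
    have f2 := h9 x
    simp only [xa, xb, xc, if_false] at f0 f1 f2 ⊢
    clear h3 h6 h9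
    rcases cyc_gaps_three h xa xb xc with g | g | g <;>
    simp only [g, true_imp_iff, false_imp_iff] at f0 f1 f2 hx <;> omega

lemma ok_short_up_symm {n : ℕ} {F : Fin n → ℤ} {a b c : Fin n} (h : Cyc a b c)
    (hok : Ok F [(a, c), (c, a), (a, b)]) :
    Ok F [(a, b), (b, c), (c, b)] := by
  have hne := cyc_relations_three h
  simp only [Ok, comp_swap_apply, hne, if_true, if_false] at hok ⊢
  obtain ⟨h1, h2, h3, h4, h5, h6, h7, h8, h9, -⟩ := hok
  have e0 := h3 b
  simp only [hne, if_true, if_false, true_imp_iff] at e0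
  refine ⟨by omega, by omega, fun x hx => ?_, by omega, by omega, fun x hx => ?_, by omega,
    by omega, fun x hx => ?_, trivial⟩
  all_goals
    by_cases xa : x = a
    · subst xa
      simp only [hne, not_cyc_left, not_cyc_right, if_true, if_false] at hx ⊢ <;> omega
    by_cases xb : x = b
    · subst xb
      simp only [hne, not_cyc_left, not_cyc_right, if_true, if_false] at hx ⊢ <;> omega
    by_cases xc : x = c
    · subst xc
      simp only [hne, not_cyc_left, not_cyc_right, if_true, if_false] at hx ⊢ <;> omega
    have f0 := h3 x
    have f1 := h6 x
    have f2 := h9 x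
    simp only [xa, xb, xc, if_false] at f0 f1 f2 ⊢
    clear h3 h6 h9
    rcases cyc_gaps_three h xa xb xc with g | g | g <;>
    simp only [g, true_imp_iff, false_imp_iff] at f0 f1 f2 hx <;> omega

theorem equivalent_short_up {n : ℕ} {a b c : Fin n} (h : Cyc a b c) :
    Equivalent (word [(a, b), (b, c), (c, b)])
      (word [(a, c), (c, a), (a, b)]) := by
  have hne := cyc_relations_three h
  refine equivalent_of_forall (fun F => ⟨ok_short_up h, ok_short_up_symm h⟩)
    (Equiv.ext fun x => ?_) fun φ => ?_
  · simp only [permOf, one_mul, Perm.mul_apply, swap_apply_def]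
    by_cases xa : x = a
    · simp only [xa, hne, if_true, if_false]
    by_cases xb : x = b
    · simp only [xb, hne, if_true, if_false]
    by_cases xc : x = c
    · simp only [xc, hne, if_true, if_false]
    simp only [xa, xb, xc, if_false]
  · simp only [wsum, comp_swap_apply, hne, if_true, if_false]
    clear hne
    simp only [Cyc, Fin.lt_def] at *
    rcases h with h | h | h <;> split_ifs <;> omega

lemma ok_short_down {n : ℕ} {F : Fin n → ℤ} {a b c : Fin n} (h : Cyc a b c)
    (hok : Ok F [(c, b), (b, c), (a, b)]) :
    Ok F [(a, b), (c, a), (a, c)] := by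
  have hne := cyc_relations_three h
  simp only [Ok, comp_swap_apply, hne, if_true, if_false] at hok ⊢
  obtain ⟨h1, h2, h3, h4, h5, h6, h7, h8, h9, -⟩ := hok
  have e0 := h3 a
  simp only [hne, if_true, if_false, true_imp_iff] at e0
  refine ⟨by omega, by omega, fun x hx => ?_, by omega, by omega, fun x hx => ?_, by omega,
    by omega, fun x hx => ?_, trivial⟩
  all_goals
    by_cases xa : x = a
    · subst xa
      simp only [hne, not_cyc_left, not_cyc_right, if_true, if_false] at hx ⊢ <;> omega
    by_cases xb : x = b
    · subst xb
      simp only [hne, not_cyc_left, not_cyc_right, if_true, if_false] at hx ⊢ <;> omega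
    by_cases xc : x = c
    · subst xc
      simp only [hne, not_cyc_left, not_cyc_right, if_true, if_false] at hx ⊢ <;> omega
    have f0 := h3 x
    have f1 := h6 x
    have f2 := h9 x
    simp only [xa, xb, xc, if_false] at f0 f1 f2 ⊢
    clear h3 h6 h9
    rcases cyc_gaps_three h xa xb xc with g | g | g <;>
    simp only [g, true_imp_iff, false_imp_iff] at f0 f1 f2 hx <;> omega

lemma ok_short_down_symm {n : ℕ} {F : Fin n → ℤ} {a b c : Fin n} (h : Cyc a b c)
    (hok : Ok F [(a, b), (c, a), (a, c)]) :
    Ok F [(c, b), (b, c), (a, b)] := by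
  have hne := cyc_relations_three h
  simp only [Ok, comp_swap_apply, hne, if_true, if_false] at hok ⊢
  obtain ⟨h1, h2, h3, h4, h5, h6, h7, h8, h9, -⟩ := hok
  have e0 := h9 b
  simp only [hne, if_true, if_false, true_imp_iff] at e0
  refine ⟨by omega, by omega, fun x hx => ?_, by omega, by omega, fun x hx => ?_, by omega,
    by omega, fun x hx => ?_, trivial⟩
  all_goals
    by_cases xa : x = a
    · subst xa
      simp only [hne, not_cyc_left, not_cyc_right, if_true, if_false] at hx ⊢ <;> omega
    by_cases xb : x = b
    · subst xb
      simp only [hne, not_cyc_left, not_cyc_right, if_true, if_false] at hx ⊢ <;> omega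
    by_cases xc : x = c
    · subst xc
      simp only [hne, not_cyc_left, not_cyc_right, if_true, if_false] at hx ⊢ <;> omega
    have f0 := h3 x
    have f1 := h6 x
    have f2 := h9 x
    simp only [xa, xb, xc, if_false] at f0 f1 f2 ⊢
    clear h3 h6 h9
    rcases cyc_gaps_three h xa xb xc with g | g | g <;>
    simp only [g, true_imp_iff, false_imp_iff] at f0 f1 f2 hx <;> omega

theorem equivalent_short_down {n : ℕ} {a b c : Fin n} (h : Cyc a b c) :
    Equivalent (word [(c, b), (b, c), (a, b)])
      (word [(a, b), (c, a), (a, c)]) := by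
  have hne := cyc_relations_three h
  refine equivalent_of_forall (fun F => ⟨ok_short_down h, ok_short_down_symm h⟩)
    (Equiv.ext fun x => ?_) fun φ => ?_
  · simp only [permOf, one_mul, Perm.mul_apply, swap_apply_def]
    by_cases xa : x = a
    · simp only [xa, hne, if_true, if_false]
    by_cases xb : x = b
    · simp only [xb, hne, if_true, if_false]
    by_cases xc : x = c
    · simp only [xc, hne, if_true, if_false]
    simp only [xa, xb, xc, if_false]
  · simp only [wsum, comp_swap_apply, hne, if_true, if_false]
    clear hne
    simp only [Cyc, Fin.lt_def] at *
    rcases h with h | h | h <;> split_ifs <;> omega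

/-- This is the short cubic relation with the way back, from `c` to `b` on one side and from `c` to
`a` on the other, routed through `d`. As there, both words force `F c < F b`. -/
lemma ok_quartic_up {n : ℕ} {F : Fin n → ℤ} {a b c d : Fin n} (h : Cyc a b c) (h' : Cyc c d a)
    (hok : Ok F [(a, b), (b, c), (c, d), (d, b)]) :
    Ok F [(a, c), (c, d), (d, a), (a, b)] := by
  have hne := cyc_relations_four h h'
  simp only [Ok, comp_swap_apply, hne, if_true, if_false] at hok ⊢
  obtain ⟨h1, h2, h3, h4, h5, h6, h7, h8, h9, h10, h11, h12, -⟩ := hok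
  have e0 := h12 a
  simp only [hne, if_true, if_false, true_imp_iff] at e0
  refine ⟨by omega, by omega, fun x hx => ?_, by omega, by omega, fun x hx => ?_, by omega,
    by omega, fun x hx => ?_, by omega, by omega, fun x hx => ?_, trivial⟩
  all_goals
    by_cases xa : x = a
    · subst xa
      simp only [hne, not_cyc_left, not_cyc_right, if_true, if_false] at hx ⊢ <;> omega
    by_cases xb : x = b
    · subst xb
      simp only [hne, not_cyc_left, not_cyc_right, if_true, if_false] at hx ⊢ <;> omega
    by_cases xc : x = c
    · subst xc
      simp only [hne, not_cyc_left, not_cyc_right, if_true, if_false] at hx ⊢ <;> omega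
    by_cases xd : x = d
    · subst xd
      simp only [hne, not_cyc_left, not_cyc_right, if_true, if_false] at hx ⊢ <;> omega
    have f0 := h3 x
    have f1 := h6 x
    have f2 := h9 x
    have f3 := h12 x
    simp only [xa, xb, xc, xd, if_false] at f0 f1 f2 f3 ⊢
    clear h3 h6 h9 h12
    rcases cyc_gaps_four h h' xa xb xc xd with g | g | g | g <;>
    simp only [g, true_imp_iff, false_imp_iff] at f0 f1 f2 f3 hx <;> omega

lemma ok_quartic_up_symm {n : ℕ} {F : Fin n → ℤ} {a b c d : Fin n} (h : Cyc a b c) (h' : Cyc c d a)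
    (hok : Ok F [(a, c), (c, d), (d, a), (a, b)]) :
    Ok F [(a, b), (b, c), (c, d), (d, b)] := by
  have hne := cyc_relations_four h h'
  simp only [Ok, comp_swap_apply, hne, if_true, if_false] at hok ⊢
  obtain ⟨h1, h2, h3, h4, h5, h6, h7, h8, h9, h10, h11, h12, -⟩ := hok
  have e0 := h3 b
  simp only [hne, if_true, if_false, true_imp_iff] at e0
  refine ⟨by omega, by omega, fun x hx => ?_, by omega, by omega, fun x hx => ?_, by omega,
    by omega, fun x hx => ?_, by omega, by omega, fun x hx => ?_, trivial⟩
  all_goals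
    by_cases xa : x = a
    · subst xa
      simp only [hne, not_cyc_left, not_cyc_right, if_true, if_false] at hx ⊢ <;> omega
    by_cases xb : x = b
    · subst xb
      simp only [hne, not_cyc_left, not_cyc_right, if_true, if_false] at hx ⊢ <;> omega
    by_cases xc : x = c
    · subst xc
      simp only [hne, not_cyc_left, not_cyc_right, if_true, if_false] at hx ⊢ <;> omega
    by_cases xd : x = d
    · subst xd
      simp only [hne, not_cyc_left, not_cyc_right, if_true, if_false] at hx ⊢ <;> omega
    have f0 := h3 x
    have f1 := h6 x
    have f2 := h9 x
    have f3 := h12 x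
    simp only [xa, xb, xc, xd, if_false] at f0 f1 f2 f3 ⊢
    clear h3 h6 h9 h12
    rcases cyc_gaps_four h h' xa xb xc xd with g | g | g | g <;>
    simp only [g, true_imp_iff, false_imp_iff] at f0 f1 f2 f3 hx <;> omega

theorem equivalent_quartic_up {n : ℕ} {a b c d : Fin n} (h : Cyc a b c) (h' : Cyc c d a) :
    Equivalent (word [(a, b), (b, c), (c, d), (d, b)])
      (word [(a, c), (c, d), (d, a), (a, b)]) := by
  have hne := cyc_relations_four h h'
  refine equivalent_of_forall (fun F => ⟨ok_quartic_up h h', ok_quartic_up_symm h h'⟩)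
    (Equiv.ext fun x => ?_) fun φ => ?_
  · simp only [permOf, one_mul, Perm.mul_apply, swap_apply_def]
    by_cases xa : x = a
    · simp only [xa, hne, if_true, if_false]
    by_cases xb : x = b
    · simp only [xb, hne, if_true, if_false]
    by_cases xc : x = c
    · simp only [xc, hne, if_true, if_false]
    by_cases xd : x = d
    · simp only [xd, hne, if_true, if_false]
    simp only [xa, xb, xc, xd, if_false]
  · simp only [wsum, comp_swap_apply, hne, if_true, if_false]
    clear hne
    have hlin := cyc_cases h h'
    clear h h'
    simp only [Fin.lt_def] at *
    rcases hlin with h | h | h | h <;> split_ifs <;> omega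

/-- The reversed quartic relation; the common constraint is `F a < F d`. -/
lemma ok_quartic_down {n : ℕ} {F : Fin n → ℤ} {a b c d : Fin n} (h : Cyc a b c) (h' : Cyc c d a)
    (hok : Ok F [(d, b), (c, d), (b, c), (a, b)]) :
    Ok F [(a, b), (d, a), (c, d), (a, c)] := by
  have hne := cyc_relations_four h h'
  simp only [Ok, comp_swap_apply, hne, if_true, if_false] at hok ⊢
  obtain ⟨h1, h2, h3, h4, h5, h6, h7, h8, h9, h10, h11, h12, -⟩ := hok
  have e0 := h3 a
  simp only [hne, if_true, if_false, true_imp_iff] at e0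
  refine ⟨by omega, by omega, fun x hx => ?_, by omega, by omega, fun x hx => ?_, by omega,
    by omega, fun x hx => ?_, by omega, by omega, fun x hx => ?_, trivial⟩
  all_goals
    by_cases xa : x = a
    · subst xa
      simp only [hne, not_cyc_left, not_cyc_right, if_true, if_false] at hx ⊢ <;> omega
    by_cases xb : x = b
    · subst xb
      simp only [hne, not_cyc_left, not_cyc_right, if_true, if_false] at hx ⊢ <;> omega
    by_cases xc : x = c
    · subst xc
      simp only [hne, not_cyc_left, not_cyc_right, if_true, if_false] at hx ⊢ <;> omega
    by_cases xd : x = d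
    · subst xd
      simp only [hne, not_cyc_left, not_cyc_right, if_true, if_false] at hx ⊢ <;> omega
    have f0 := h3 x
    have f1 := h6 x
    have f2 := h9 x
    have f3 := h12 x
    simp only [xa, xb, xc, xd, if_false] at f0 f1 f2 f3 ⊢
    clear h3 h6 h9 h12
    rcases cyc_gaps_four h h' xa xb xc xd with g | g | g | g <;>
    simp only [g, true_imp_iff, false_imp_iff] at f0 f1 f2 f3 hx <;> omega

lemma ok_quartic_down_symm {n : ℕ} {F : Fin n → ℤ} {a b c d : Fin n}
    (h : Cyc a b c) (h' : Cyc c d a)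
    (hok : Ok F [(a, b), (d, a), (c, d), (a, c)]) :
    Ok F [(d, b), (c, d), (b, c), (a, b)] := by
  have hne := cyc_relations_four h h'
  simp only [Ok, comp_swap_apply, hne, if_true, if_false] at hok ⊢
  obtain ⟨h1, h2, h3, h4, h5, h6, h7, h8, h9, h10, h11, h12, -⟩ := hok
  have e0 := h12 b
  simp only [hne, if_true, if_false, true_imp_iff] at e0
  refine ⟨by omega, by omega, fun x hx => ?_, by omega, by omega, fun x hx => ?_, by omega,
    by omega, fun x hx => ?_, by omega, by omega, fun x hx => ?_, trivial⟩
  all_goals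
    by_cases xa : x = a
    · subst xa
      simp only [hne, not_cyc_left, not_cyc_right, if_true, if_false] at hx ⊢ <;> omega
    by_cases xb : x = b
    · subst xb
      simp only [hne, not_cyc_left, not_cyc_right, if_true, if_false] at hx ⊢ <;> omega
    by_cases xc : x = c
    · subst xc
      simp only [hne, not_cyc_left, not_cyc_right, if_true, if_false] at hx ⊢ <;> omega
    by_cases xd : x = d
    · subst xd
      simp only [hne, not_cyc_left, not_cyc_right, if_true, if_false] at hx ⊢ <;> omega
    have f0 := h3 x
    have f1 := h6 x
    have f2 := h9 x
    have f3 := h12 x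
    simp only [xa, xb, xc, xd, if_false] at f0 f1 f2 f3 ⊢
    clear h3 h6 h9 h12
    rcases cyc_gaps_four h h' xa xb xc xd with g | g | g | g <;>
    simp only [g, true_imp_iff, false_imp_iff] at f0 f1 f2 f3 hx <;> omega

theorem equivalent_quartic_down {n : ℕ} {a b c d : Fin n} (h : Cyc a b c) (h' : Cyc c d a) :
    Equivalent (word [(d, b), (c, d), (b, c), (a, b)])
      (word [(a, b), (d, a), (c, d), (a, c)]) := by
  have hne := cyc_relations_four h h'
  refine equivalent_of_forall (fun F => ⟨ok_quartic_down h h', ok_quartic_down_symm h h'⟩)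
    (Equiv.ext fun x => ?_) fun φ => ?_
  · simp only [permOf, one_mul, Perm.mul_apply, swap_apply_def]
    by_cases xa : x = a
    · simp only [xa, hne, if_true, if_false]
    by_cases xb : x = b
    · simp only [xb, hne, if_true, if_false]
    by_cases xc : x = c
    · simp only [xc, hne, if_true, if_false]
    by_cases xd : x = d
    · simp only [xd, hne, if_true, if_false]
    simp only [xa, xb, xc, xd, if_false]
  · simp only [wsum, comp_swap_apply, hne, if_true, if_false]
    clear hne
    have hlin := cyc_cases h h'
    clear h h'
    simp only [Fin.lt_def] at *
    rcases hlin with h | h | h | h <;> split_ifs <;> omega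

end Relations

/-! ### A decision procedure for words in the indices `0, …, m - 1` -/

/-- Boolean version of `Cyc`. -/
def cycB (a c b : ℕ) : Bool :=
  (Nat.blt a c && Nat.blt c b) || (Nat.blt c b && Nat.blt b a) || (Nat.blt b a && Nat.blt a c)

/-- Boolean version of `DisjointOps`. -/
def disjB (p q : ℕ × ℕ) : Bool :=
  !Nat.beq q.1 p.1 && !Nat.beq q.1 p.2 && !Nat.beq q.2 p.1 && !Nat.beq q.2 p.2

/-- Boolean version of `ZeroPair`. -/
def zeroPairB (p q : ℕ × ℕ) : Bool :=
  Nat.beq q.1 p.1 || Nat.beq q.2 p.2 || (Nat.beq q.1 p.2 && cycB p.1 q.2 p.2) ||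
    (Nat.beq q.2 p.1 && cycB p.1 q.1 p.2) ||
    (!Nat.beq q.1 p.2 && !Nat.beq q.2 p.1 &&
      ((cycB p.1 q.1 p.2 && !cycB p.1 q.2 p.2) || (!cycB p.1 q.1 p.2 && cycB p.1 q.2 p.2) ||
        (cycB p.1 q.1 p.2 && cycB q.1 p.1 q.2)))

/-- The words of degree three that are zero because of `not_ok_braid_up`, `not_ok_braid_down`,
`not_ok_chain_up` or `not_ok_chain_down`. -/
def zeroTripleB (p q r : ℕ × ℕ) : Bool :=
  (Nat.beq p.1 r.1 && Nat.beq p.2 r.2 &&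
    ((Nat.beq q.1 p.2 && cycB p.1 p.2 q.2) || (Nat.beq q.2 p.1 && cycB q.1 p.1 p.2))) ||
  (Nat.beq q.1 p.2 && Nat.beq r.1 q.2 && cycB p.1 r.2 p.2 && cycB p.2 q.2 p.1) ||
  (Nat.beq q.2 p.1 && Nat.beq r.2 q.1 && cycB r.1 p.2 q.1 && cycB q.1 p.1 r.1)

/-- `a, b, c, d` are in cyclic order, and `c = d` is admitted. -/
def cycFourB (a b c d : ℕ) : Bool := cycB a b c && (Nat.beq d c || cycB c d a)

/-- The rewritings of a word of degree three. -/
def rewriteTriple (p q r : ℕ × ℕ) : List (List (ℕ × ℕ)) :=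
  (bif Nat.beq q.1 p.2 && Nat.beq r.2 p.2 then
    (bif cycFourB p.1 p.2 q.2 r.1 then [[(p.1, q.2), (r.1, p.1), (p.1, p.2)]] else []) ++
    (bif cycFourB r.1 p.2 q.2 p.1 then [[(r.1, p.2), (p.1, r.1), (r.1, q.2)]] else [])
  else []) ++
  (bif Nat.beq q.2 p.1 && Nat.beq r.1 p.1 then
    (bif cycFourB p.1 r.2 p.2 q.1 then [[(p.1, r.2), (r.2, p.2), (q.1, r.2)]] else []) ++
    (bif cycFourB p.1 p.2 r.2 q.1 then [[(q.1, p.2), (p.2, r.2), (p.1, p.2)]] else [])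
  else [])

/-- The words that arise from a word by one application of a relation of degree two or three. -/
def neighbors : List (ℕ × ℕ) → List (List (ℕ × ℕ))
  | [] => []
  | p :: T =>
    (match T with
      | [] => []
      | q :: T' => (bif disjB p q then [q :: p :: T'] else []) ++
        (match T' with
          | [] => []
          | r :: T'' => (rewriteTriple p q r).map (· ++ T''))) ++
    (neighbors T).map (p :: ·)

/-- The word has a factor of degree two or three that is visibly zero. -/
def hasZero : List (ℕ × ℕ) → Bool
  | [] => false
  | p :: T =>
    (match T with
      | [] => false
      | q :: T' => zeroPairB p q ||
        (match T' with
          | [] => false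
          | r :: _ => zeroTripleB p q r)) || hasZero T

/-- Equality of words. -/
def eqW : List (ℕ × ℕ) → List (ℕ × ℕ) → Bool
  | [], [] => true
  | p :: S, q :: T => Nat.beq p.1 q.1 && Nat.beq p.2 q.2 && eqW S T
  | _, _ => false

/-- A word with a zero factor can be reached in `k` steps. -/
def canZero : ℕ → List (ℕ × ℕ) → Bool
  | 0, w => hasZero w
  | k + 1, w => hasZero w || (neighbors w).any (canZero k)

/-- Adds the neighbors of the words in the first list to the second list. -/
def addNeighbors : List (List (ℕ × ℕ)) → List (List (ℕ × ℕ)) → List (List (ℕ × ℕ))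
  | [], S => S
  | w :: L, S => addNeighbors L
      ((neighbors w).foldl (fun S v => bif S.any (eqW v) then S else v :: S) S)

/-- The word `w` can be reached from one of the words in a list in `k` steps. -/
def canReach (w : List (ℕ × ℕ)) : ℕ → List (List (ℕ × ℕ)) → Bool
  | 0, S => S.any (eqW w)
  | k + 1, S => S.any (eqW w) || canReach w k (addNeighbors S S)

/-- The transposition of `a` and `b`. -/
def sw (a b c : ℕ) : ℕ := bif Nat.beq c a then b else bif Nat.beq c b then a else c

/-- `f c` holds for all `c < m`. -/
def allBelow : ℕ → (ℕ → Bool) → Bool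
  | 0, _ => true
  | m + 1, f => f m && allBelow m f

/-- Boolean version of `Ok`; the bar is at `128`. -/
def okB (m : ℕ) : (ℕ → ℕ) → List (ℕ × ℕ) → Bool
  | _, [] => true
  | F, p :: T => Nat.blt (F p.1) 128 && Nat.ble 128 (F p.2) &&
      allBelow m (fun c => !cycB p.1 c p.2 || Nat.blt (F c) (F p.1) || Nat.blt (F p.2) (F c)) &&
      okB m (fun c => F (sw p.1 p.2 c)) T

/-- The index `c` starts right of the bar if the word acts. -/
def startsRight : List (ℕ × ℕ) → ℕ → Bool
  | [], _ => false
  | p :: T, c => bif Nat.beq p.1 c then false else bif Nat.beq p.2 c then true else startsRight T c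

/-- The number of operators in the word that pass the slot whose value is initially `c`. -/
def passes : List (ℕ × ℕ) → ℕ → ℕ
  | [], _ => 0
  | p :: T, c => bif cycB p.1 c p.2 then passes T (sw p.1 p.2 c) + 1 else passes T (sw p.1 p.2 c)

/-- Evaluates `n` before it is passed to `f`. -/
def force {α : Type*} (n : ℕ) (f : ℕ → α) : α := Nat.rec (f 0) (fun k _ => f (k + 1)) n

/-- A number that encodes positions on which a word can be expected to act. -/
def posCode : ℕ → List (ℕ × ℕ) → ℕ
  | 0, _ => 0
  | m + 1, w => posCode m w +
      -- Five bits per index. A slot that is passed more often is put farther from the bar; since `8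
      -- * 16 = 128`, the digits from `16` on are those right of the bar.
      (bif startsRight w m then 16 + passes w m else 15 - passes w m) <<< (5 * m)

/-- The positions with a given code. -/
def posFun (N i : ℕ) : ℕ := 8 * ((N >>> (5 * i)) % 32) + i

/-- The initial slot of the value that ends up at `c`. -/
def slotB : List (ℕ × ℕ) → ℕ → ℕ
  | [], c => c
  | p :: T, c => sw p.1 p.2 (slotB T c)

/-- A number that encodes the permutation of a word. -/
def permCode : ℕ → List (ℕ × ℕ) → ℕ
  | 0, _ => 0
  | m + 1, w => 8 * permCode m w + slotB w m

/-- Version of `wsum` for natural numbers: the pair of the positive and the negative part. -/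
def wsumB : (ℕ → ℕ) → List (ℕ × ℕ) → ℕ × ℕ
  | _, [] => (0, 0)
  | φ, p :: T =>
    let s := wsumB (fun c => φ (sw p.1 p.2 c)) T
    bif Nat.blt p.2 p.1 then (s.1 + φ p.2, s.2 + φ p.1) else s

/-- The two words have the same `wsum`. -/
def sameWsum (u w : List (ℕ × ℕ)) : Bool :=
  -- The powers of eight are a single test function; equality of the two sums serves only as a
  -- necessary condition for equivalence.
  Nat.beq ((wsumB (8 ^ ·) u).1 + (wsumB (8 ^ ·) w).2) ((wsumB (8 ^ ·) w).1 + (wsumB (8 ^ ·) u).2)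

/-- Cyclic shift of the indices. -/
def shiftW (m : ℕ) (w : List (ℕ × ℕ)) : List (ℕ × ℕ) :=
  w.map fun p => ((p.1 + 1) % m, (p.2 + 1) % m)

/-- The exceptional zero words with indices `0, …, 4`. -/
def zeroOrbit : List (List (ℕ × ℕ)) :=
  (List.range 5).flatMap fun i =>
    [(shiftW 5)^[i] [(3, 0), (0, 1), (1, 2), (2, 4)],
     (shiftW 5)^[i] [(2, 4), (1, 2), (0, 1), (3, 0)]]

/-- The exceptional pairs with indices `0, …, 3`. -/
def pairOrbit : List (List (ℕ × ℕ) × List (ℕ × ℕ)) :=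
  (List.range 4).flatMap fun i =>
    let a := (shiftW 4)^[i] [(3, 0), (0, 1), (1, 2), (2, 0)]
    let b := (shiftW 4)^[i] [(3, 1), (1, 2), (2, 3), (3, 0)]
    [(a, b), (b, a), (a.reverse, b.reverse), (b.reverse, a.reverse)]

/-- All operators with indices less than `m`. -/
def allOps (m : ℕ) : List (ℕ × ℕ) :=
  (List.range m).flatMap fun a => (List.range m).filterMap fun b =>
    bif Nat.beq a b then none else some (a, b)

/-- The lexicographic order of operators. -/
def ltOp (p q : ℕ × ℕ) : Bool := Nat.blt p.1 q.1 || (Nat.beq p.1 q.1 && Nat.blt p.2 q.2)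

/-- `q` may follow `p` in a reduced word. -/
def follows (p q : ℕ × ℕ) : Bool := !zeroPairB p q && !(disjB p q && ltOp q p)

/-- The set of indices of an operator, as a binary number. -/
def maskOf (p : ℕ × ℕ) : ℕ := 1 <<< p.1 ||| 1 <<< p.2

/-- `1` if `c` does not belong to the set with binary number `M`, and `0` otherwise. -/
def newBit (M c : ℕ) : ℕ := 1 - (M >>> c) % 2

/-- The number of indices of `p` that do not belong to the set with binary number `M`. -/
def newBits (M : ℕ) (p : ℕ × ℕ) : ℕ := newBit M p.1 + newBit M p.2

/-- The operators that may follow `p` in a reduced word. -/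
def nextOps (m : ℕ) (p : ℕ × ℕ) : List (ℕ × ℕ) := (allOps m).filter (follows p)

/-- The reduced words of degree four in which all indices less than `m` occur. -/
def reducedWords (m : ℕ) : List (List (ℕ × ℕ)) :=
  (allOps m).flatMap fun x => force (maskOf x) fun X =>
  -- The two operators still to come add at most four indices, so a prefix with too few indices is
  -- discarded; likewise below.
  (nextOps m x).flatMap fun y => force (2 + newBits X y) fun i => bif Nat.blt (i + 4) m then [] else
    force (X ||| maskOf y) fun Y =>
  (nextOps m y).flatMap fun z => force (i + newBits Y z) fun j => bif Nat.blt (j + 2) m then [] else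
    bif zeroTripleB x y z then [] else
    force (Y ||| maskOf z) fun Z =>
  (nextOps m z).filterMap fun t => bif Nat.blt (j + newBits Z t) m then none else
    bif zeroTripleB y z t then none else some [x, y, z, t]

/-- The word acts on some element. -/
def isNonzero (m : ℕ) (w : List (ℕ × ℕ)) : Bool := force (posCode m w) fun N => okB m (posFun N) w

/-- Every word is nonzero, exceptional or can be shown to be zero. -/
def checkZero (m : ℕ) : Bool :=
  (reducedWords m).all fun w => isNonzero m w || canZero 3 w || zeroOrbit.any (eqW w)

/-- The nonzero reduced words, together with their permutations. -/
def nonzeroWords (m : ℕ) : List (ℕ × List (ℕ × ℕ)) :=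
  (reducedWords m).filterMap fun w =>
    bif isNonzero m w then force (permCode m w) fun c => some (c, w) else none

/-- The words `u` and `w` are connected by relations, exceptional or not equivalent. -/
def checkPair (m : ℕ) (u w : ℕ × List (ℕ × ℕ)) : Bool :=
  bif Nat.beq u.1 w.1 then
    -- The positions built for the first word are tried on the second; failure to act there shows
    -- that the words are inequivalent.
    !sameWsum u.2 w.2 || !okB m (posFun (posCode m u.2)) w.2 ||
      canReach w.2 5 [u.2] || pairOrbit.any fun q => eqW u.2 q.1 && eqW w.2 q.2
  else true

/-- Any two words in the list pass the check. -/
def checkPairs (m : ℕ) : List (ℕ × List (ℕ × ℕ)) → Bool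
  | [] => true
  | u :: L => L.all (checkPair m u) && checkPairs m L

/-! ### Consequences -/

lemma degreeLT_opWord {n : ℕ} (p : Fin n × Fin n) : DegreeLT 2 (opWord p) := by
  intro v hv
  rw [opWord] at hv
  split_ifs at hv with h
  · rw [← WithZero.coe_inj.1 hv]
    simp
  · cases hv

lemma degreeLT_word {n : ℕ} (T : List (Fin n × Fin n)) : DegreeLT (T.length + 1) (word T) := by
  induction T with
  | nil =>
    intro v hv
    have : (1 : Comp n) = v := WithZero.coe_inj.1 hv
    simp [← this]
  | cons p T ih =>
    intro v hv
    rw [word] at hv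
    cases hT : word T with
    | zero => rw [hT, zero_mul] at hv; cases hv
    | coe u =>
      cases hp : opWord p with
      | zero => rw [hp, mul_zero] at hv; cases hv
      | coe o =>
        rw [hT, hp, ← WithZero.coe_mul] at hv
        rw [← WithZero.coe_inj.1 hv, FreeMonoid.length_mul]
        have h1 := ih u hT
        have h2 := degreeLT_opWord p o hp
        simp only [List.length_cons]
        omega

lemma degreeLT_zero {n : ℕ} (d : ℕ) : DegreeLT d (0 : WithZero (Comp n)) := by
  intro v hv
  cases hv

lemma IsConsequence.refl {n d : ℕ} (u : WithZero (Comp n)) : IsConsequence d u u :=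
  (conGen (LowerEquivalence d)).refl u

lemma IsConsequence.symm {n d : ℕ} {u v : WithZero (Comp n)} (h : IsConsequence d u v) :
    IsConsequence d v u := (conGen (LowerEquivalence d)).symm h

lemma IsConsequence.trans {n d : ℕ} {u v w : WithZero (Comp n)} (h : IsConsequence d u v)
    (h' : IsConsequence d v w) : IsConsequence d u w := (conGen (LowerEquivalence d)).trans h h'

lemma IsConsequence.mul {n d : ℕ} {u v u' v' : WithZero (Comp n)} (h : IsConsequence d u v)
    (h' : IsConsequence d u' v') : IsConsequence d (u * u') (v * v') :=
  (conGen (LowerEquivalence d)).mul h h'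

lemma isConsequence_of_equivalent {n d : ℕ} {S S' : List (Fin n × Fin n)}
    (h : Equivalent (word S) (word S')) (hS : S.length < d) (hS' : S'.length < d) :
    IsConsequence d (word S) (word S') := by
  refine ConGen.Rel.of _ _ ⟨h, fun v hv => ?_, fun v hv => ?_⟩
  · have := degreeLT_word S v hv
    omega
  · have := degreeLT_word S' v hv
    omega

lemma isConsequence_zero {n d : ℕ} {S : List (Fin n × Fin n)} (h : Equivalent (word S) 0)
    (hS : S.length < d) (T : List (Fin n × Fin n)) : IsConsequence d (word (S ++ T)) 0 := by
  have h1 : IsConsequence d (word S) 0 := by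
    refine ConGen.Rel.of _ _ ⟨h, fun v hv => ?_, degreeLT_zero d⟩
    have := degreeLT_word S v hv
    omega
  have := (IsConsequence.refl (d := d) (word T)).mul h1
  rwa [mul_zero, ← word_append] at this

lemma IsConsequence.cons {n d : ℕ} {S S' : List (Fin n × Fin n)}
    (h : IsConsequence d (word S) (word S')) (p : Fin n × Fin n) :
    IsConsequence d (word (p :: S)) (word (p :: S')) := h.mul (IsConsequence.refl _)

lemma IsConsequence.append {n d : ℕ} {S S' : List (Fin n × Fin n)}
    (h : IsConsequence d (word S) (word S')) (T : List (Fin n × Fin n)) :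
    IsConsequence d (word (S ++ T)) (word (S' ++ T)) := by
  rw [word_append, word_append]
  exact (IsConsequence.refl _).mul h

lemma IsConsequence.equivalent {n d : ℕ} {u v : WithZero (Comp n)} (h : IsConsequence d u v) :
    Equivalent u v := by
  induction h with
  | of u v h => exact h.1
  | refl u => exact Equivalent.refl u
  | symm _ ih => exact ih.symm
  | trans _ _ ih ih' => exact ih.trans ih'
  | mul _ _ ih ih' => exact equivalent_mul ih ih'

/-! ### Soundness of the relations -/

lemma cycB_iff {a c b : ℕ} : cycB a c b = true ↔ Cyc a c b := by
  simp [cycB, Cyc, or_assoc]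

lemma nat_beq_iff {a b : ℕ} : Nat.beq a b = true ↔ a = b := by simp

lemma nat_beq_eq_false_iff {a b : ℕ} : Nat.beq a b = false ↔ ¬ a = b := by
  rw [← nat_beq_iff, Bool.not_eq_true]

/-- All indices in the word are less than `m`. -/
def Valid (m : ℕ) (w : List (ℕ × ℕ)) : Prop := ∀ p ∈ w, p.1 < m ∧ p.2 < m

/-- The word with index `i` replaced by `g i`. -/
def liftW {n : ℕ} (g : ℕ → Fin n) (w : List (ℕ × ℕ)) : List (Fin n × Fin n) :=
  w.map (Prod.map g g)

/-- Increasing relabellings preserve the cyclic order, which transfers the checks on `0, …, m - 1`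
to arbitrary indices. -/
lemma cyc_lift {n m : ℕ} {g : ℕ → Fin n} (hg : StrictMonoOn g (Set.Iio m)) {a c b : ℕ} (ha : a < m)
    (hc : c < m) (hb : b < m) : Cyc (g a) (g c) (g b) ↔ Cyc a c b := by
  simp only [Cyc, hg.lt_iff_lt (Set.mem_Iio.2 ha) (Set.mem_Iio.2 hc),
    hg.lt_iff_lt (Set.mem_Iio.2 hc) (Set.mem_Iio.2 hb),
    hg.lt_iff_lt (Set.mem_Iio.2 hb) (Set.mem_Iio.2 ha)]

lemma eq_lift {n m : ℕ} {g : ℕ → Fin n} (hg : StrictMonoOn g (Set.Iio m)) {a b : ℕ} (ha : a < m)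
    (hb : b < m) : g a = g b ↔ a = b := hg.injOn.eq_iff (Set.mem_Iio.2 ha) (Set.mem_Iio.2 hb)

lemma disjB_sound {n m : ℕ} {g : ℕ → Fin n} (hg : StrictMonoOn g (Set.Iio m)) {p q : ℕ × ℕ}
    (hp : p.1 < m ∧ p.2 < m) (hq : q.1 < m ∧ q.2 < m) (h : disjB p q = true) :
    DisjointOps (Prod.map g g p) (Prod.map g g q) := by
  simp only [disjB, Bool.and_eq_true, Bool.not_eq_true', nat_beq_eq_false_iff] at h
  simp only [DisjointOps, Prod.map_fst, Prod.map_snd, ne_eq, eq_lift hg hq.1 hp.1,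
    eq_lift hg hq.1 hp.2, eq_lift hg hq.2 hp.1, eq_lift hg hq.2 hp.2]
  tauto

lemma zeroPairB_sound {n m : ℕ} {g : ℕ → Fin n} (hg : StrictMonoOn g (Set.Iio m)) {p q : ℕ × ℕ}
    (hp : p.1 < m ∧ p.2 < m) (hq : q.1 < m ∧ q.2 < m) (h : zeroPairB p q = true) :
    ZeroPair (Prod.map g g p) (Prod.map g g q) := by
  have c1 : cycB p.1 q.2 p.2 = true ↔ Cyc (g p.1) (g q.2) (g p.2) := by
    rw [cyc_lift hg hp.1 hq.2 hp.2, cycB_iff]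
  have c2 : cycB p.1 q.1 p.2 = true ↔ Cyc (g p.1) (g q.1) (g p.2) := by
    rw [cyc_lift hg hp.1 hq.1 hp.2, cycB_iff]
  have c3 : cycB q.1 p.1 q.2 = true ↔ Cyc (g q.1) (g p.1) (g q.2) := by
    rw [cyc_lift hg hq.1 hp.1 hq.2, cycB_iff]
  simp only [zeroPairB, Bool.or_eq_true, Bool.and_eq_true, Bool.not_eq_true', nat_beq_iff,
    ← Bool.not_eq_true, c1, c2, c3] at h
  simp only [ZeroPair, Prod.map_fst, Prod.map_snd, ne_eq, eq_lift hg hq.1 hp.1,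
    eq_lift hg hq.1 hp.2, eq_lift hg hq.2 hp.1, eq_lift hg hq.2 hp.2]
  tauto

lemma zeroTripleB_sound {n m : ℕ} {g : ℕ → Fin n} (hg : StrictMonoOn g (Set.Iio m)) {p q r : ℕ × ℕ}
    (hp : p.1 < m ∧ p.2 < m) (hq : q.1 < m ∧ q.2 < m) (hr : r.1 < m ∧ r.2 < m)
    (h : zeroTripleB p q r = true) : Equivalent (word (liftW g [p, q, r])) 0 := by
  obtain ⟨a, b⟩ := p
  obtain ⟨c, d⟩ := q
  obtain ⟨e, f⟩ := r
  simp only at hp hq hr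
  simp only [zeroTripleB, Bool.or_eq_true, Bool.and_eq_true, nat_beq_iff, cycB_iff] at h
  refine equivalent_zero_of_forall fun F => ?_
  rcases h with (⟨⟨rfl, rfl⟩, ⟨rfl, h⟩ | ⟨rfl, h⟩⟩ | ⟨⟨⟨rfl, rfl⟩, h⟩, h'⟩) |
    ⟨⟨⟨rfl, rfl⟩, h⟩, h'⟩
  · exact not_ok_braid_up ((cyc_lift hg hp.1 hp.2 hq.2).2 h)
  · exact not_ok_braid_down ((cyc_lift hg hq.1 hp.1 hp.2).2 h)
  · exact not_ok_chain_up ((cyc_lift hg hp.1 hr.2 hp.2).2 h) ((cyc_lift hg hp.2 hq.2 hp.1).2 h')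
  · exact not_ok_chain_down ((cyc_lift hg hr.1 hp.2 hq.1).2 h) ((cyc_lift hg hq.1 hp.1 hr.1).2 h')

lemma equivalent_up {n m : ℕ} {g : ℕ → Fin n} (hg : StrictMonoOn g (Set.Iio m)) {a b c d : ℕ}
    (ha : a < m) (hb : b < m) (hc : c < m) (hd : d < m) (h : cycFourB a b c d = true) :
    Equivalent (word (liftW g [(a, b), (b, c), (d, b)]))
      (word (liftW g [(a, c), (d, a), (a, b)])) := by
  simp only [cycFourB, Bool.and_eq_true, Bool.or_eq_true, nat_beq_iff, cycB_iff] at h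
  obtain ⟨h, rfl | h'⟩ := h
  · exact equivalent_short_up ((cyc_lift hg ha hb hc).2 h)
  · exact equivalent_long_up ((cyc_lift hg ha hb hc).2 h) ((cyc_lift hg hc hd ha).2 h')

lemma equivalent_down {n m : ℕ} {g : ℕ → Fin n} (hg : StrictMonoOn g (Set.Iio m)) {a b c d : ℕ}
    (ha : a < m) (hb : b < m) (hc : c < m) (hd : d < m) (h : cycFourB a b c d = true) :
    Equivalent (word (liftW g [(d, b), (b, c), (a, b)]))
      (word (liftW g [(a, b), (d, a), (a, c)])) := by
  simp only [cycFourB, Bool.and_eq_true, Bool.or_eq_true, nat_beq_iff, cycB_iff] at h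
  obtain ⟨h, rfl | h'⟩ := h
  · exact equivalent_short_down ((cyc_lift hg ha hb hc).2 h)
  · exact equivalent_long_down ((cyc_lift hg ha hb hc).2 h) ((cyc_lift hg hc hd ha).2 h')

lemma rewriteTriple_sound {n m : ℕ} {g : ℕ → Fin n} (hg : StrictMonoOn g (Set.Iio m))
    {p q r : ℕ × ℕ} (hp : p.1 < m ∧ p.2 < m) (hq : q.1 < m ∧ q.2 < m) (hr : r.1 < m ∧ r.2 < m)
    {v : List (ℕ × ℕ)} (hv : v ∈ rewriteTriple p q r) :
    Valid m v ∧ v.length = 3 ∧ Equivalent (word (liftW g [p, q, r])) (word (liftW g v)) := by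
  obtain ⟨a, b⟩ := p
  obtain ⟨c, d⟩ := q
  obtain ⟨e, f⟩ := r
  simp only at hp hq hr
  simp only [rewriteTriple, List.mem_append, Bool.cond_eq_ite, Bool.and_eq_true, nat_beq_iff] at hv
  rcases hv with hv | hv <;> split_ifs at hv with h h1 h2 h2 <;>
    simp only [List.mem_append, List.mem_cons, List.not_mem_nil, or_false, false_or, or_self] at hv
  · obtain ⟨rfl, rfl⟩ := h
    rcases hv with rfl | rfl
    · exact ⟨by simp [Valid, *], rfl, equivalent_up hg hp.1 hp.2 hq.2 hr.1 h1⟩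
    · exact ⟨by simp [Valid, *], rfl, equivalent_down hg hr.1 hp.2 hq.2 hp.1 h2⟩
  · obtain ⟨rfl, rfl⟩ := h
    subst hv
    exact ⟨by simp [Valid, *], rfl, equivalent_up hg hp.1 hp.2 hq.2 hr.1 h1⟩
  · obtain ⟨rfl, rfl⟩ := h
    subst hv
    exact ⟨by simp [Valid, *], rfl, equivalent_down hg hr.1 hp.2 hq.2 hp.1 h2⟩
  · obtain ⟨rfl, rfl⟩ := h
    rcases hv with rfl | rfl
    · exact ⟨by simp [Valid, *], rfl, (equivalent_up hg hp.1 hr.2 hp.2 hq.1 h1).symm⟩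
    · exact ⟨by simp [Valid, *], rfl, (equivalent_down hg hp.1 hp.2 hr.2 hq.1 h2).symm⟩
  · obtain ⟨rfl, rfl⟩ := h
    subst hv
    exact ⟨by simp [Valid, *], rfl, (equivalent_up hg hp.1 hr.2 hp.2 hq.1 h1).symm⟩
  · obtain ⟨rfl, rfl⟩ := h
    subst hv
    exact ⟨by simp [Valid, *], rfl, (equivalent_down hg hp.1 hp.2 hr.2 hq.1 h2).symm⟩

lemma Valid.tail {m : ℕ} {p : ℕ × ℕ} {T : List (ℕ × ℕ)} (h : Valid m (p :: T)) : Valid m T :=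
  fun q hq => h q (List.mem_cons_of_mem _ hq)

lemma Valid.head {m : ℕ} {p : ℕ × ℕ} {T : List (ℕ × ℕ)} (h : Valid m (p :: T)) :
    p.1 < m ∧ p.2 < m := h p List.mem_cons_self

lemma Valid.cons {m : ℕ} {p : ℕ × ℕ} {T : List (ℕ × ℕ)} (hp : p.1 < m ∧ p.2 < m)
    (h : Valid m T) : Valid m (p :: T) := by
  intro q hq
  rcases List.mem_cons.1 hq with rfl | hq
  · exact hp
  · exact h q hq

lemma Valid.append {m : ℕ} {S T : List (ℕ × ℕ)} (hS : Valid m S) (hT : Valid m T) :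
    Valid m (S ++ T) :=
  fun q hq => (List.mem_append.1 hq).elim (hS q) (hT q)

lemma liftW_append {n : ℕ} (g : ℕ → Fin n) (S T : List (ℕ × ℕ)) :
    liftW g (S ++ T) = liftW g S ++ liftW g T := List.map_append

/-- A neighbor arises by replacing a factor of degree two or three, hence from an equivalence of
degree less than four. -/
lemma neighbors_sound {n m : ℕ} {g : ℕ → Fin n} (hg : StrictMonoOn g (Set.Iio m))
    {w v : List (ℕ × ℕ)} (hw : Valid m w) (hv : v ∈ neighbors w) :
    Valid m v ∧ IsConsequence 4 (word (liftW g w)) (word (liftW g v)) := by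
  induction w generalizing v with
  | nil => simp [neighbors] at hv
  | cons p T ih =>
    rw [neighbors.eq_def] at hv
    rw [List.mem_append] at hv
    rcases hv with hv | hv
    · rcases T with _ | ⟨q, T'⟩
      · simp at hv
      · simp only [List.mem_append, Bool.cond_eq_ite] at hv
        have hp := hw.head
        have hq := hw.tail.head
        rcases hv with hv | hv
        · split_ifs at hv with h
          · rw [List.mem_singleton.1 hv]
            refine ⟨(hw.tail.tail.cons hp).cons hq, ?_⟩
            exact (isConsequence_of_equivalent (d := 4)
              (equivalent_swap (disjB_sound hg hp hq h)) (by simp) (by simp)).append (liftW g T')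
          · simp at hv
        · rcases T' with _ | ⟨r, T''⟩
          · simp at hv
          · have hr := hw.tail.tail.head
            obtain ⟨s, hs, rfl⟩ := List.mem_map.1 hv
            obtain ⟨h1, h2, h3⟩ := rewriteTriple_sound hg hp hq hr hs
            refine ⟨h1.append hw.tail.tail.tail, ?_⟩
            rw [liftW_append]
            exact (isConsequence_of_equivalent (d := 4) h3 (by simp [liftW])
              (by simp [liftW, h2])).append (liftW g T'')
    · obtain ⟨s, hs, rfl⟩ := List.mem_map.1 hv
      obtain ⟨h1, h2⟩ := ih hw.tail hs
      exact ⟨h1.cons hw.head, h2.cons _⟩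

lemma hasZero_sound {n m : ℕ} {g : ℕ → Fin n} (hg : StrictMonoOn g (Set.Iio m))
    {w : List (ℕ × ℕ)} (hw : Valid m w) (h : hasZero w = true) :
    IsConsequence 4 (word (liftW g w)) 0 := by
  induction w with
  | nil => simp [hasZero] at h
  | cons p T ih =>
    rw [hasZero.eq_def] at h
    rw [Bool.or_eq_true] at h
    rcases h with h | h
    · rcases T with _ | ⟨q, T'⟩
      · simp at h
      · rw [Bool.or_eq_true] at h
        have hp := hw.head
        have hq := hw.tail.head
        rcases h with h | h
        · have := zeroPairB_sound hg hp hq h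
          exact isConsequence_zero (S := [Prod.map g g p, Prod.map g g q])
            (equivalent_zero_of_forall fun F => not_ok_of_zeroPair this) (by simp) (liftW g T')
        · rcases T' with _ | ⟨r, T''⟩
          · simp at h
          · exact isConsequence_zero (S := liftW g [p, q, r])
              (zeroTripleB_sound hg hp hq hw.tail.tail.head h) (by simp [liftW]) (liftW g T'')
    · have := (ih hw.tail h).mul (IsConsequence.refl (opWord (Prod.map g g p)))
      rwa [zero_mul] at this

lemma canZero_sound {n m : ℕ} {g : ℕ → Fin n} (hg : StrictMonoOn g (Set.Iio m)) (k : ℕ)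
    {w : List (ℕ × ℕ)} (hw : Valid m w) (h : canZero k w = true) :
    IsConsequence 4 (word (liftW g w)) 0 := by
  induction k generalizing w with
  | zero => exact hasZero_sound hg hw h
  | succ k ih =>
    rw [canZero, Bool.or_eq_true, List.any_eq_true] at h
    rcases h with h | ⟨v, hv, h⟩
    · exact hasZero_sound hg hw h
    · obtain ⟨h1, h2⟩ := neighbors_sound hg hw hv
      exact h2.trans (ih h1 h)

lemma eqW_iff {u w : List (ℕ × ℕ)} : eqW u w = true ↔ u = w := by
  induction u generalizing w with
  | nil => cases w <;> simp [eqW]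
  | cons p S ih =>
    cases w with
    | nil => simp [eqW]
    | cons q T =>
      simp only [eqW, Bool.and_eq_true, nat_beq_iff, ih, List.cons.injEq, Prod.ext_iff]

lemma addNeighbors_sound {P : List (ℕ × ℕ) → Prop}
    (hP : ∀ w, P w → ∀ v ∈ neighbors w, P v) (L S : List (List (ℕ × ℕ)))
    (hL : ∀ w ∈ L, P w) (hS : ∀ w ∈ S, P w) : ∀ w ∈ addNeighbors L S, P w := by
  induction L generalizing S with
  | nil => exact hS
  | cons u L ih =>
    refine ih _ (fun w hw => hL w (List.mem_cons_of_mem _ hw)) ?_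
    have hu : ∀ v ∈ neighbors u, P v := hP u (hL u List.mem_cons_self)
    generalize neighbors u = N at hu
    induction N generalizing S with
    | nil => exact hS
    | cons v N ihN =>
      rw [List.foldl_cons]
      refine ihN _ ?_ fun w hw => hu w (List.mem_cons_of_mem _ hw)
      rw [Bool.cond_eq_ite]
      split_ifs
      · exact hS
      · intro w hw
        rcases List.mem_cons.1 hw with rfl | hw
        · exact hu w List.mem_cons_self
        · exact hS w hw

lemma canReach_sound {P : List (ℕ × ℕ) → Prop}
    (hP : ∀ w, P w → ∀ v ∈ neighbors w, P v) {w : List (ℕ × ℕ)} (k : ℕ)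
    {S : List (List (ℕ × ℕ))} (hS : ∀ v ∈ S, P v) (h : canReach w k S = true) : P w := by
  have key : ∀ S : List (List (ℕ × ℕ)), (∀ v ∈ S, P v) → S.any (eqW w) = true → P w := by
    intro S hS h
    obtain ⟨v, hv, h⟩ := List.any_eq_true.1 h
    rw [eqW_iff.1 h]
    exact hS v hv
  induction k generalizing S with
  | zero => exact key S hS h
  | succ k ih =>
    rw [canReach, Bool.or_eq_true] at h
    rcases h with h | h
    · exact key S hS h
    · exact ih (addNeighbors_sound hP S S hS hS) h

/-! ### Soundness of the invariants -/

lemma allBelow_iff {m : ℕ} {f : ℕ → Bool} : allBelow m f = true ↔ ∀ c < m, f c = true := by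
  induction m with
  | zero => simp [allBelow]
  | succ m ih =>
    rw [allBelow, Bool.and_eq_true, ih]
    refine ⟨fun h c hc => ?_, fun h => ⟨h m (by omega), fun c hc => h c (by omega)⟩⟩
    rcases Nat.lt_succ_iff_lt_or_eq.1 hc with hc | rfl
    · exact h.2 c hc
    · exact h.1

lemma force_eq {α : Type*} (n : ℕ) (f : ℕ → α) : force n f = f n := by
  cases n <;> rfl

lemma sw_lt {m a b c : ℕ} (ha : a < m) (hb : b < m) (hc : c < m) : sw a b c < m := by
  simp only [sw, Bool.cond_eq_ite]
  split_ifs <;> assumption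

lemma swap_lift {n m : ℕ} {g : ℕ → Fin n} (hg : StrictMonoOn g (Set.Iio m)) {a b c : ℕ}
    (ha : a < m) (hb : b < m) (hc : c < m) : swap (g a) (g b) (g c) = g (sw a b c) := by
  simp only [swap_apply_def, eq_lift hg hc ha, eq_lift hg hc hb, sw, Bool.cond_eq_ite, nat_beq_iff]
  split_ifs <;> rfl

/-- The positions `G` extend the positions `F`, with the bar moved from `128` to `0`, and all
further values are to the left. -/
def Extends {n : ℕ} (m : ℕ) (g : ℕ → Fin n) (F : ℕ → ℕ) (G : Fin n → ℤ) : Prop :=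
  (∀ i < m, G (g i) = F i - 128) ∧ ∀ c, (∀ i < m, g i ≠ c) → ∀ i < m, G c < G (g i)

lemma Extends.swap {n m : ℕ} {g : ℕ → Fin n} (hg : StrictMonoOn g (Set.Iio m)) {F : ℕ → ℕ}
    {G : Fin n → ℤ} (h : Extends m g F G) {a b : ℕ} (ha : a < m) (hb : b < m) :
    Extends m g (fun c => F (sw a b c)) (G ∘ swap (g a) (g b)) := by
  refine ⟨fun i hi => ?_, fun c hc i hi => ?_⟩
  · rw [Function.comp, swap_lift hg ha hb hi, h.1 _ (sw_lt ha hb hi)]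
  · rw [Function.comp, Function.comp, swap_lift hg ha hb hi,
      swap_apply_of_ne_of_ne (hc a ha).symm (hc b hb).symm]
    exact h.2 c hc _ (sw_lt ha hb hi)

/-- Values outside the range of the indices stand to the left of all others and never block, so
testing the indices below `m` is enough. -/
lemma okB_iff {n m : ℕ} {g : ℕ → Fin n} (hg : StrictMonoOn g (Set.Iio m)) {F : ℕ → ℕ}
    {G : Fin n → ℤ} (h : Extends m g F G) {w : List (ℕ × ℕ)} (hw : Valid m w) :
    okB m F w = true ↔ Ok G (liftW g w) := by
  induction w generalizing F G with
  | nil => simp [okB, liftW, Ok]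
  | cons p T ih =>
    obtain ⟨a, b⟩ := p
    obtain ⟨ha, hb⟩ := hw.head
    simp only at ha hb
    have hrec := ih (h.swap hg ha hb) hw.tail
    change _ ↔ Ok G ((g a, g b) :: liftW g T)
    rw [Ok, ← hrec, okB]
    simp only [Bool.and_eq_true, and_assoc]
    refine and_congr ?_ (and_congr ?_ (and_congr ?_ Iff.rfl))
    · rw [h.1 a ha, Nat.blt_eq]; omega
    · rw [h.1 b hb, Nat.ble_eq]; omega
    · rw [allBelow_iff]
      constructor
      · intro H c hc
        by_cases hcg : ∀ i < m, g i ≠ c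
        · exact Or.inl (h.2 c hcg a ha)
        · push Not at hcg
          obtain ⟨i, hi, rfl⟩ := hcg
          have := H i hi
          rw [cyc_lift hg ha hi hb, ← cycB_iff] at hc
          simp only [hc, Bool.not_true, Bool.false_or, Bool.or_eq_true, Nat.blt_eq] at this
          rw [h.1 a ha, h.1 b hb, h.1 i hi]
          omega
      · intro H c hc
        by_cases hcyc : cycB a c b = true
        · have := H (g c) ((cyc_lift hg ha hc hb).2 (cycB_iff.1 hcyc))
          rw [h.1 a ha, h.1 b hb, h.1 c hc] at this
          simp only [hcyc, Bool.not_true, Bool.false_or, Bool.or_eq_true, Nat.blt_eq]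
          omega
        · simp [Bool.not_eq_true _ ▸ hcyc]

lemma exists_extends {n m : ℕ} {g : ℕ → Fin n} (hg : StrictMonoOn g (Set.Iio m)) {F : ℕ → ℕ}
    (hF : Set.InjOn F (Set.Iio m)) :
    ∃ G : Fin n → ℤ, Function.Injective G ∧ Extends m g F G := by
  classical
  -- The listed values have positions at least `-128`, so `-129 - c` is left of all of them and
  -- injective in `c`.
  have hex : ∀ c : Fin n, ∃ x : ℤ, (∀ i < m, g i = c → x = F i - 128) ∧
      ((∀ i < m, g i ≠ c) → x = -129 - c) := by
    intro c
    by_cases h : ∃ i < m, g i = c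
    · obtain ⟨i, hi, rfl⟩ := h
      refine ⟨F i - 128, fun j hj e => ?_, fun h => absurd rfl (h i hi)⟩
      rw [(eq_lift hg hj hi).1 e]
    · push Not at h
      exact ⟨-129 - c, fun i hi e => absurd e (h i hi), fun _ => rfl⟩
  choose G hG hG' using hex
  have h1 : ∀ i < m, G (g i) = F i - 128 := fun i hi => hG _ i hi rfl
  refine ⟨G, fun c d hcd => ?_, h1, fun c hc i hi => ?_⟩
  · by_cases hc : ∃ i < m, g i = c <;> by_cases hd : ∃ i < m, g i = d
    · obtain ⟨i, hi, rfl⟩ := hc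
      obtain ⟨j, hj, rfl⟩ := hd
      rw [h1 i hi, h1 j hj] at hcd
      rw [hF (Set.mem_Iio.2 hi) (Set.mem_Iio.2 hj) (by omega)]
    · obtain ⟨i, hi, rfl⟩ := hc
      push Not at hd
      rw [h1 i hi, hG' d hd] at hcd
      omega
    · obtain ⟨j, hj, rfl⟩ := hd
      push Not at hc
      rw [h1 j hj, hG' c hc] at hcd
      omega
    · push Not at hc hd
      rw [hG' c hc, hG' d hd] at hcd
      exact Fin.ext (by omega)
  · rw [hG' c hc, h1 i hi]
    omega

/-- The residue modulo `8` recovers the index. -/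
lemma posFun_injOn {m : ℕ} (hm : m ≤ 8) (N : ℕ) : Set.InjOn (posFun N) (Set.Iio m) := by
  intro i hi j hj h
  simp only [Set.mem_Iio, posFun] at hi hj h
  generalize N >>> (5 * i) % 32 = x at h
  generalize N >>> (5 * j) % 32 = y at h
  omega

lemma liftW_ne_nil {n : ℕ} {g : ℕ → Fin n} {w : List (ℕ × ℕ)} (h : w ≠ []) : liftW g w ≠ [] := by
  simpa [liftW] using h

lemma not_equivalent_zero_of_okB {n m : ℕ} {g : ℕ → Fin n} (hg : StrictMonoOn g (Set.Iio m))
    (hm : m ≤ 8) {N : ℕ} {w : List (ℕ × ℕ)} (hw : Valid m w) (hne : w ≠ [])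
    (h : okB m (posFun N) w = true) : ¬ Equivalent (word (liftW g w)) 0 := by
  obtain ⟨G, hinj, hG⟩ := exists_extends hg (posFun_injOn hm N)
  exact not_equivalent_zero (liftW_ne_nil hne) hinj ((okB_iff hg hG hw).1 h)

lemma slotB_lt {m : ℕ} {w : List (ℕ × ℕ)} (hw : Valid m w) {c : ℕ} (hc : c < m) :
    slotB w c < m := by
  induction w with
  | nil => exact hc
  | cons p T ih => exact sw_lt hw.head.1 hw.head.2 (ih hw.tail)

lemma permOf_inv_lift {n m : ℕ} {g : ℕ → Fin n} (hg : StrictMonoOn g (Set.Iio m))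
    {w : List (ℕ × ℕ)} (hw : Valid m w) {c : ℕ} (hc : c < m) :
    (permOf (liftW g w))⁻¹ (g c) = g (slotB w c) := by
  induction w with
  | nil => rfl
  | cons p T ih =>
    change (permOf (liftW g T) * swap (g p.1) (g p.2))⁻¹ (g c) = g (sw p.1 p.2 (slotB T c))
    rw [mul_inv_rev, Perm.mul_apply, ih hw.tail, swap_inv,
      swap_lift hg hw.head.1 hw.head.2 (slotB_lt hw.tail hc)]

lemma permCode_congr {m : ℕ} {u w : List (ℕ × ℕ)} (h : ∀ c < m, slotB u c = slotB w c) :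
    permCode m u = permCode m w := by
  induction m with
  | zero => rfl
  | succ m ih => rw [permCode, permCode, h m (by omega), ih fun c hc => h c (by omega)]

lemma wsum_lift {n m : ℕ} {g : ℕ → Fin n} (hg : StrictMonoOn g (Set.Iio m)) {φ : ℕ → ℕ}
    {Φ : Fin n → ℤ} (h : ∀ i < m, Φ (g i) = φ i) {w : List (ℕ × ℕ)} (hw : Valid m w) :
    wsum Φ (liftW g w) = (wsumB φ w).1 - (wsumB φ w).2 := by
  induction w generalizing φ Φ with
  | nil => rfl
  | cons p T ih =>
    obtain ⟨a, b⟩ := p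
    obtain ⟨ha, hb⟩ := hw.head
    simp only at ha hb
    change wsum Φ ((g a, g b) :: liftW g T) = _
    rw [wsum, ih (φ := fun c => φ (sw a b c)) (Φ := Φ ∘ swap (g a) (g b)) _ hw.tail, wsumB]
    · simp only [Bool.cond_eq_ite, Nat.blt_eq, hg.lt_iff_lt (Set.mem_Iio.2 hb) (Set.mem_Iio.2 ha)]
      rw [h a ha, h b hb]
      split_ifs
      · push_cast; ring
      · ring
    · intro i hi
      rw [Function.comp, swap_lift hg ha hb hi, h _ (sw_lt ha hb hi)]

theorem invariants_eq_of_equivalent {n m : ℕ} {g : ℕ → Fin n} (hg : StrictMonoOn g (Set.Iio m))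
    (hm : m ≤ 8) {N : ℕ} {u w : List (ℕ × ℕ)} (hu : Valid m u) (hw : Valid m w) (hne : u ≠ [])
    (h : okB m (posFun N) u = true) (he : Equivalent (word (liftW g u)) (word (liftW g w))) :
    okB m (posFun N) w = true ∧ permCode m u = permCode m w ∧ sameWsum u w = true ∧
      u.length = w.length := by
  obtain ⟨G, hinj, hG⟩ := exists_extends hg (posFun_injOn hm N)
  obtain ⟨h1, h2, h3, h4⟩ := ok_of_equivalent he (liftW_ne_nil hne) hinj ((okB_iff hg hG hu).1 h)
  refine ⟨(okB_iff hg hG hw).2 h1, permCode_congr fun c hc => ?_, ?_, by simpa [liftW] using h4⟩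
  · rw [← eq_lift hg (slotB_lt hu hc) (slotB_lt hw hc), ← permOf_inv_lift hg hu hc, h2,
      permOf_inv_lift hg hw hc]
  -- The test function `8 ^ i` is transported to `Fin n` along an inverse of `g`; its values off the
  -- range of `g` are irrelevant.
  · have := h3 fun c => ((8 ^ Function.invFunOn g (Set.Iio m) c : ℕ) : ℤ)
    have hΦ : ∀ i < m, ((8 ^ Function.invFunOn g (Set.Iio m) (g i) : ℕ) : ℤ) =
        ((8 ^ i : ℕ) : ℤ) := by
      intro i hi
      rw [hg.injOn.leftInvOn_invFunOn (Set.mem_Iio.2 hi)]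
    rw [wsum_lift hg (φ := (8 ^ ·)) hΦ hu, wsum_lift hg (φ := (8 ^ ·)) hΦ hw] at this
    rw [sameWsum, nat_beq_iff]
    omega

/-! ### The exceptional words -/

/-- The index `e` stands right of the bar and lies on the arc from `d` to `a`, so it starts beyond
`a`. The first operator puts `d` at the place of `a`, where it lies on the arc from `c` to `e` and
blocks the last operator. -/
lemma equivalent_zero_cascade_up {n m : ℕ} {g : ℕ → Fin n} (hg : StrictMonoOn g (Set.Iio m))
    {a b c d e : ℕ} (hm : Valid m [(d, a), (a, b), (b, c), (c, e)]) (hne : [a, b, c, d, e].Nodup)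
    (h : Cyc d e a) (h' : Cyc c d e) :
    Equivalent (word (liftW g [(d, a), (a, b), (b, c), (c, e)])) 0 := by
  simp only [Valid, List.mem_cons, List.not_mem_nil, or_false, forall_eq_or_imp, forall_eq] at hm
  obtain ⟨⟨hd, ha⟩, ⟨-, hb⟩, ⟨-, hc⟩, -, he⟩ := hm
  rw [← cyc_lift hg hd he ha] at h
  rw [← cyc_lift hg hc hd he] at h'
  simp only [List.nodup_cons, List.mem_cons, List.not_mem_nil, or_false, not_or] at hne
  refine equivalent_zero_of_forall fun F => ?_
  simp only [liftW, List.map_cons, List.map_nil, Prod.map, Ok, comp_swap_apply, eq_lift hg, ha, hb,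
    hc, hd, he, hne, if_true, if_false, eq_comm]
  rintro ⟨h1, h2, h3, h4, h5, h6, h7, h8, h9, h10, h11, h12, -⟩
  have h3 := h3 _ h
  have h12 := h12 _ h'
  simp [eq_lift hg, *, eq_comm] at h12
  omega

/-- The index `d` lies on the arc from `c` to `e` and so starts left of `c`. The first operator puts
`e` at the place of `c`, where it blocks the last operator, since it lies on the arc from `d` to
`a`. -/
lemma equivalent_zero_cascade_down {n m : ℕ} {g : ℕ → Fin n} (hg : StrictMonoOn g (Set.Iio m))
    {a b c d e : ℕ} (hm : Valid m [(c, e), (b, c), (a, b), (d, a)]) (hne : [a, b, c, d, e].Nodup)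
    (h : Cyc d e a) (h' : Cyc c d e) :
    Equivalent (word (liftW g [(c, e), (b, c), (a, b), (d, a)])) 0 := by
  simp only [Valid, List.mem_cons, List.not_mem_nil, or_false, forall_eq_or_imp, forall_eq] at hm
  obtain ⟨⟨hc, he⟩, ⟨hb, -⟩, ⟨ha, -⟩, hd, -⟩ := hm
  rw [← cyc_lift hg hd he ha] at h
  rw [← cyc_lift hg hc hd he] at h'
  simp only [List.nodup_cons, List.mem_cons, List.not_mem_nil, or_false, not_or] at hne
  refine equivalent_zero_of_forall fun F => ?_
  simp only [liftW, List.map_cons, List.map_nil, Prod.map, Ok, comp_swap_apply, eq_lift hg, ha, hb,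
    hc, hd, he, hne, if_true, if_false, eq_comm]
  rintro ⟨h1, h2, h3, h4, h5, h6, h7, h8, h9, h10, h11, h12, -⟩
  have h3 := h3 _ h'
  have h12 := h12 _ h
  simp [eq_lift hg, *, eq_comm] at h12
  omega

theorem equivalent_zero_of_mem_zeroOrbit {n : ℕ} {g : ℕ → Fin n} (hg : StrictMonoOn g (Set.Iio 5))
    {w : List (ℕ × ℕ)} (hw : w ∈ zeroOrbit) : Equivalent (word (liftW g w)) 0 := by
  have key : ∀ w ∈ zeroOrbit, ∃ i < 5,
      w = [((3 + i) % 5, i % 5), (i % 5, (1 + i) % 5), ((1 + i) % 5, (2 + i) % 5),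
        ((2 + i) % 5, (4 + i) % 5)] ∨
      w = [((2 + i) % 5, (4 + i) % 5), ((1 + i) % 5, (2 + i) % 5), (i % 5, (1 + i) % 5),
        ((3 + i) % 5, i % 5)] := by decide +kernel
  have hcyc : ∀ i < 5, [i % 5, (1 + i) % 5, (2 + i) % 5, (3 + i) % 5, (4 + i) % 5].Nodup ∧
      Cyc ((3 + i) % 5) ((4 + i) % 5) (i % 5) ∧ Cyc ((2 + i) % 5) ((3 + i) % 5) ((4 + i) % 5) := by
    decide +kernel
  obtain ⟨i, hi, rfl | rfl⟩ := key w hw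
  · obtain ⟨h1, h2, h3⟩ := hcyc i hi
    exact equivalent_zero_cascade_up hg (by simp [Valid, Nat.mod_lt]) h1 h2 h3
  · obtain ⟨h1, h2, h3⟩ := hcyc i hi
    exact equivalent_zero_cascade_down hg (by simp [Valid, Nat.mod_lt]) h1 h2 h3

theorem equivalent_of_mem_pairOrbit {n : ℕ} {g : ℕ → Fin n} (hg : StrictMonoOn g (Set.Iio 4))
    {q : List (ℕ × ℕ) × List (ℕ × ℕ)} (hq : q ∈ pairOrbit) :
    Equivalent (word (liftW g q.1)) (word (liftW g q.2)) := by
  have key : ∀ q ∈ pairOrbit, ∃ a < 4, ∃ b < 4, ∃ c < 4, ∃ d < 4, (Cyc a b c ∧ Cyc c d a) ∧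
      (q = ([(a, b), (b, c), (c, d), (d, b)], [(a, c), (c, d), (d, a), (a, b)]) ∨
      q = ([(a, c), (c, d), (d, a), (a, b)], [(a, b), (b, c), (c, d), (d, b)]) ∨
      q = ([(d, b), (c, d), (b, c), (a, b)], [(a, b), (d, a), (c, d), (a, c)]) ∨
      q = ([(a, b), (d, a), (c, d), (a, c)], [(d, b), (c, d), (b, c), (a, b)])) := by
    decide +kernel
  obtain ⟨a, ha, b, hb, c, hc, d, hd, ⟨h, h'⟩, hq⟩ := key q hq
  rw [← cyc_lift hg ha hb hc] at h
  rw [← cyc_lift hg hc hd ha] at h'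
  rcases hq with rfl | rfl | rfl | rfl
  · exact equivalent_quartic_up h h'
  · exact (equivalent_quartic_up h h').symm
  · exact equivalent_quartic_down h h'
  · exact (equivalent_quartic_down h h').symm

/-! ### Supports -/

/-- The index `c` occurs in the word. -/
def Occ {α : Type*} (c : α) (T : List (α × α)) : Prop := ∃ p ∈ T, c = p.1 ∨ c = p.2

lemma occ_cons {α : Type*} {c : α} {p : α × α} {T : List (α × α)} :
    Occ c (p :: T) ↔ (c = p.1 ∨ c = p.2) ∨ Occ c T := by
  simp [Occ]

/-- The first operator that contains `e` uses it at its initial position, as source on the left or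
as target on the right. -/
lemma sides_of_occ {n : ℕ} {e : Fin n} {T : List (Fin n × Fin n)} (h : Occ e T) :
    (∀ F, Ok F T → F e < 0) ∨ ∀ F, Ok F T → 0 ≤ F e := by
  induction T with
  | nil => simp [Occ] at h
  | cons p T ih =>
    obtain ⟨a, b⟩ := p
    by_cases ha : e = a
    · exact Or.inl fun F hF => ha ▸ hF.1
    by_cases hb : e = b
    · exact Or.inr fun F hF => hb ▸ hF.2.1
    have hs : ∀ F : Fin n → ℤ, (F ∘ swap a b) e = F e := fun F => by
      rw [Function.comp, swap_apply_of_ne_of_ne ha hb]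
    have hT : Occ e T := (occ_cons.1 h).resolve_left (by simp [ha, hb])
    refine (ih hT).imp (fun h F hF => ?_) fun h F hF => ?_
    · rw [← hs F]; exact h _ hF.2.2.2
    · rw [← hs F]; exact h _ hF.2.2.2

/-- An index that is never moved and stands at an end is never between two others. -/
lemma ok_of_extreme {n : ℕ} {e : Fin n} {T : List (Fin n × Fin n)} (h : ¬ Occ e T)
    {F F' : Fin n → ℤ} (hF : ∀ c, c ≠ e → F' c = F c)
    (he : (∀ c, c ≠ e → F' e < F' c) ∨ ∀ c, c ≠ e → F' c < F' e) (hok : Ok F T) : Ok F' T := by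
  induction T generalizing F F' with
  | nil => trivial
  | cons p T ih =>
    obtain ⟨a, b⟩ := p
    rw [occ_cons, not_or, not_or] at h
    obtain ⟨⟨ha, hb⟩, hT⟩ := h
    simp only at ha hb
    obtain ⟨h1, h2, h3, h4⟩ := hok
    have hs : ∀ c, c ≠ e → swap a b c ≠ e := by
      intro c hc
      rw [swap_apply_def]
      split_ifs
      · exact Ne.symm hb
      · exact Ne.symm ha
      · exact hc
    have hse : swap a b e = e := swap_apply_of_ne_of_ne ha hb
    refine ⟨by rwa [hF a (Ne.symm ha)], by rwa [hF b (Ne.symm hb)], fun c hc => ?_,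
      ih hT (F := F ∘ swap a b) (fun c hc => hF _ (hs c hc)) ?_ h4⟩
    · by_cases hce : c = e
      · subst hce
        rcases he with he | he
        · exact Or.inl (he a (Ne.symm ha))
        · exact Or.inr (he b (Ne.symm hb))
      · rw [hF a (Ne.symm ha), hF b (Ne.symm hb), hF c hce]
        exact h3 c hc
    · refine he.imp (fun he c hc => ?_) fun he c hc => ?_
      · simpa [hse] using he _ (hs c hc)
      · simpa [hse] using he _ (hs c hc)

theorem occ_of_equivalent {n : ℕ} {U V : List (Fin n × Fin n)}
    (h : Equivalent (word U) (word V)) (hU : U ≠ []) (h0 : ¬ Equivalent (word U) 0) {e : Fin n}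
    (he : Occ e V) : Occ e U := by
  by_contra hcon
  obtain ⟨F, hF, hok⟩ := exists_ok_of_not_equivalent_zero h0
  obtain ⟨B, hB⟩ : ∃ B : ℤ, ∀ c, |F c| < B := by
    refine ⟨∑ c, |F c| + 1, fun c => ?_⟩
    have := Finset.single_le_sum (f := fun c => |F c|) (fun c _ => abs_nonneg _) (Finset.mem_univ c)
    omega
  have hB' : ∀ c, -B < F c ∧ F c < B := fun c => abs_lt.1 (hB c)
  have hB0 : 0 < B := (abs_nonneg _).trans_lt (hB e)
  -- Since `e` does not occur in `U`, it can be moved to either end; then `V` acts with `e` on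
  -- either side of the bar, against `sides_of_occ`.
  have key : ∀ x : ℤ, (x = -B ∨ x = B) → Ok (Function.update F e x) V := by
    intro x hx
    have h1 : ∀ c, c ≠ e → Function.update F e x c = F c :=
      fun c hc => Function.update_of_ne hc _ _
    have hex : ∀ c, F c ≠ x := fun c => by have := hB' c; omega
    refine (ok_of_equivalent h hU (F := Function.update F e x) ?_ ?_).1
    · intro c d hcd
      by_cases hc : c = e <;> by_cases hd : d = e
      · rw [hc, hd]
      · rw [hc, Function.update_self, h1 d hd] at hcd
        exact absurd hcd.symm (hex d)
      · rw [hd, Function.update_self, h1 c hc] at hcd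
        exact absurd hcd (hex c)
      · rw [h1 c hc, h1 d hd] at hcd
        exact hF hcd
    · refine ok_of_extreme hcon h1 ?_ hok
      rcases hx with rfl | rfl
      · refine Or.inl fun c hc => ?_
        rw [Function.update_self, h1 c hc]
        exact (hB' c).1
      · refine Or.inr fun c hc => ?_
        rw [Function.update_self, h1 c hc]
        exact (hB' c).2
  rcases sides_of_occ he with hs | hs
  · have := hs _ (key B (Or.inr rfl))
    rw [Function.update_self] at this
    omega
  · have := hs _ (key (-B) (Or.inl rfl))
    rw [Function.update_self] at this
    omega

/-! ### Flattening of words -/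

/-- Every index less than `m` occurs in the word. -/
def Full (m : ℕ) (w : List (ℕ × ℕ)) : Prop := ∀ i < m, Occ i w

lemma Valid.lt_of_occ {m : ℕ} {w : List (ℕ × ℕ)} (h : Valid m w) {c : ℕ} (hc : Occ c w) :
    c < m := by
  obtain ⟨p, hp, rfl | rfl⟩ := hc
  · exact (h p hp).1
  · exact (h p hp).2

lemma Valid.eq_of_full {m m' : ℕ} {w : List (ℕ × ℕ)} (h : Valid m w) (hf : Full m w)
    (h' : Valid m' w) (hf' : Full m' w) : m = m' := by
  rcases lt_trichotomy m m' with hlt | heq | hlt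
  · exact absurd (h.lt_of_occ (hf' m hlt)) (lt_irrefl _)
  · exact heq
  · exact absurd (h'.lt_of_occ (hf m' hlt)) (lt_irrefl _)

lemma occ_lift {n : ℕ} {g : ℕ → Fin n} {c : Fin n} {w : List (ℕ × ℕ)} :
    Occ c (liftW g w) ↔ ∃ i, Occ i w ∧ g i = c := by
  constructor
  · rintro ⟨p, hp, h⟩
    obtain ⟨q, hq, rfl⟩ := List.mem_map.1 hp
    rcases h with rfl | rfl
    · exact ⟨q.1, ⟨q, hq, Or.inl rfl⟩, rfl⟩
    · exact ⟨q.2, ⟨q, hq, Or.inr rfl⟩, rfl⟩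
  · rintro ⟨i, ⟨q, hq, h⟩, rfl⟩
    refine ⟨Prod.map g g q, List.mem_map_of_mem hq, ?_⟩
    rcases h with rfl | rfl
    · exact Or.inl rfl
    · exact Or.inr rfl

lemma exists_enum {n : ℕ} (S : Finset (Fin n)) (hS : S.Nonempty) :
    ∃ g : ℕ → Fin n, StrictMonoOn g (Set.Iio S.card) ∧ ∀ c, c ∈ S ↔ ∃ i < S.card, g i = c := by
  obtain ⟨x, hx⟩ := hS
  refine ⟨fun i => if h : i < S.card then S.orderEmbOfFin rfl ⟨i, h⟩ else x, ?_, fun c => ?_⟩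
  · intro i hi j hj hij
    simp only [Set.mem_Iio] at hi hj
    simp only [hi, hj, dif_pos, OrderEmbedding.lt_iff_lt]
    exact hij
  · constructor
    · intro hc
      have : c ∈ Set.range (S.orderEmbOfFin rfl) := by simpa using hc
      obtain ⟨i, rfl⟩ := this
      exact ⟨i, i.2, by simp⟩
    · rintro ⟨i, hi, rfl⟩
      simp [hi]

lemma exists_valid_liftW {n m : ℕ} {g : ℕ → Fin n} {T : List (Fin n × Fin n)}
    (hT : ∀ c, Occ c T → ∃ i < m, g i = c) : ∃ w, Valid m w ∧ liftW g w = T := by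
  induction T with
  | nil => exact ⟨[], by simp [Valid], rfl⟩
  | cons p T ih =>
    obtain ⟨w, hw, rfl⟩ := ih fun c hc => hT c (occ_cons.2 (Or.inr hc))
    obtain ⟨i, hi, h1⟩ := hT p.1 (occ_cons.2 (Or.inl (Or.inl rfl)))
    obtain ⟨j, hj, h2⟩ := hT p.2 (occ_cons.2 (Or.inl (Or.inr rfl)))
    exact ⟨(i, j) :: w, hw.cons ⟨hi, hj⟩, by simp [liftW, h1, h2]⟩

lemma exists_liftW {n m : ℕ} {g : ℕ → Fin n} (hg : StrictMonoOn g (Set.Iio m))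
    {T : List (Fin n × Fin n)} (hT : ∀ c, Occ c T ↔ ∃ i < m, g i = c) :
    ∃ w, Valid m w ∧ Full m w ∧ liftW g w = T := by
  obtain ⟨w, hw, rfl⟩ := exists_valid_liftW fun c hc => (hT c).1 hc
  refine ⟨w, hw, fun i hi => ?_, rfl⟩
  obtain ⟨j, hj, hji⟩ := occ_lift.1 ((hT (g i)).2 ⟨i, hi, rfl⟩)
  rwa [← (eq_lift hg (hw.lt_of_occ hj) hi).1 hji]

lemma Full.le {m : ℕ} {w : List (ℕ × ℕ)} (h : Full m w) : m ≤ 2 * w.length := by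
  have h1 : Finset.range m ⊆ (w.map Prod.fst ++ w.map Prod.snd).toFinset := by
    intro i hi
    obtain ⟨p, hp, rfl | rfl⟩ := h i (Finset.mem_range.1 hi)
    · simp only [List.toFinset_append, Finset.mem_union, List.mem_toFinset]
      exact Or.inl (List.mem_map_of_mem hp)
    · simp only [List.toFinset_append, Finset.mem_union, List.mem_toFinset]
      exact Or.inr (List.mem_map_of_mem hp)
  have h2 := Finset.card_le_card h1
  have h3 := List.toFinset_card_le (w.map Prod.fst ++ w.map Prod.snd)
  simp only [Finset.card_range, List.length_append, List.length_map] at h2 h3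
  omega

lemma occ_opList {n : ℕ} {c : Fin n} {v : Comp n} : Occ c (opList v) ↔ c ∈ supp v := by
  simp [Occ, opList, supp]

lemma opList_ne {n : ℕ} (v : Comp n) : ∀ p ∈ opList v, p.1 ≠ p.2 := by
  intro p hp
  simp only [opList, List.mem_reverse, List.mem_map] at hp
  obtain ⟨o, -, rfl⟩ := hp
  exact o.2

lemma supp_nonempty {n : ℕ} {v : Comp n} (h : 0 < v.length) : (supp v).Nonempty := by
  rw [← opList_length] at h
  obtain ⟨p, hp⟩ := List.exists_mem_of_length_pos h
  exact ⟨p.1, occ_opList.1 ⟨p, hp, Or.inl rfl⟩⟩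

lemma ne_of_lift {n : ℕ} {g : ℕ → Fin n} {w : List (ℕ × ℕ)} (h : ∀ p ∈ liftW g w, p.1 ≠ p.2) :
    ∀ p ∈ w, p.1 ≠ p.2 :=
  fun p hp he => h (Prod.map g g p) (List.mem_map_of_mem hp) (congrArg g he)

/-! ### Completeness of the enumeration -/

lemma mem_allOps {m : ℕ} {p : ℕ × ℕ} (hp : p.1 < m ∧ p.2 < m) (hne : p.1 ≠ p.2) :
    p ∈ allOps m := by
  simp only [allOps, List.mem_flatMap, List.mem_range, List.mem_filterMap, Bool.cond_eq_ite]
  refine ⟨p.1, hp.1, p.2, hp.2, ?_⟩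
  rw [if_neg (by rwa [nat_beq_iff])]

/-- `M` is the binary number of the set `A`. -/
def Masks (M : ℕ) (A : Finset ℕ) : Prop := ∀ c, M.testBit c = decide (c ∈ A)

lemma masks_maskOf (p : ℕ × ℕ) : Masks (maskOf p) {p.1, p.2} := by
  intro c
  simp only [maskOf, Nat.testBit_or, Nat.one_shiftLeft, Nat.testBit_two_pow, Finset.mem_insert,
    Finset.mem_singleton, Bool.decide_or, eq_comm]

lemma Masks.or {M M' : ℕ} {A A' : Finset ℕ} (h : Masks M A) (h' : Masks M' A') :
    Masks (M ||| M') (A ∪ A') := by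
  intro c
  rw [Nat.testBit_or, h c, h' c]
  simp

lemma Masks.card_le {M : ℕ} {A : Finset ℕ} (h : Masks M A) (p : ℕ × ℕ) :
    (A ∪ {p.1, p.2}).card ≤ A.card + newBits M p := by
  have key : ∀ c, (({c} : Finset ℕ) \ A).card ≤ newBit M c := by
    intro c
    by_cases hc : c ∈ A
    · rw [Finset.sdiff_eq_empty_iff_subset.2 (by simpa using hc)]
      simp
    · have h1 := h c
      simp only [hc, decide_false, Nat.testBit, Nat.one_and_eq_mod_two, bne_eq_false_iff_eq] at h1
      rw [newBit, h1]
      exact (Finset.card_le_card Finset.sdiff_subset).trans (by simp)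
  have h2 : A ∪ {p.1, p.2} = A ∪ (({p.1} : Finset ℕ) \ A ∪ ({p.2} : Finset ℕ) \ A) := by
    ext c
    simp only [Finset.mem_union, Finset.mem_insert, Finset.mem_singleton, Finset.mem_sdiff]
    tauto
  rw [h2, newBits]
  refine (Finset.card_union_le _ _).trans (Nat.add_le_add_left ?_ _)
  exact (Finset.card_union_le _ _).trans (Nat.add_le_add (key _) (key _))

lemma newBits_le (M : ℕ) (p : ℕ × ℕ) : newBits M p ≤ 2 := by
  simp only [newBits, newBit]
  omega

/-- No two adjacent operators that commute are in the wrong order. -/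
def Sorted (w : List (ℕ × ℕ)) : Prop := w.IsChain fun p q => (disjB p q && ltOp q p) = false

/-- The pruning loses nothing: the counters bound the number of indices used so far from above, and
each further operator adds at most two. -/
lemma mem_reducedWords {m : ℕ} {x y z t : ℕ × ℕ} (hv : Valid m [x, y, z, t])
    (hne : ∀ p ∈ [x, y, z, t], p.1 ≠ p.2) (hf : Full m [x, y, z, t]) (hs : Sorted [x, y, z, t])
    (h0 : hasZero [x, y, z, t] = false) : [x, y, z, t] ∈ reducedWords m := by
  simp only [Valid, List.mem_cons, List.not_mem_nil, or_false, forall_eq_or_imp, forall_eq]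
    at hv hne
  obtain ⟨vx, vy, vz, vt⟩ := hv
  obtain ⟨nx, ny, nz, nt⟩ := hne
  simp only [hasZero, Bool.or_eq_false_iff] at h0
  simp only [Sorted, List.isChain_cons_cons] at hs
  have hX := masks_maskOf x
  have hY := hX.or (masks_maskOf y)
  have hZ := hY.or (masks_maskOf z)
  have b1 := hX.card_le y
  have b2 := hY.card_le z
  have b3 := hZ.card_le t
  have b0 : ({x.1, x.2} : Finset ℕ).card ≤ 2 := Finset.card_le_two
  have hm : m ≤ (({x.1, x.2} ∪ {y.1, y.2} ∪ {z.1, z.2} ∪ {t.1, t.2} : Finset ℕ)).card := by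
    rw [← Finset.card_range m]
    refine Finset.card_le_card fun i hi => ?_
    have := hf i (Finset.mem_range.1 hi)
    simp only [occ_cons] at this
    simp only [Finset.mem_union, Finset.mem_insert, Finset.mem_singleton]
    have hnil : ¬ Occ i ([] : List (ℕ × ℕ)) := by simp [Occ]
    tauto
  have l2 := newBits_le (maskOf x ||| maskOf y) z
  have l3 := newBits_le (maskOf x ||| maskOf y ||| maskOf z) t
  have fxy : follows x y = true := by simp [follows, h0, hs]
  have fyz : follows y z = true := by simp [follows, h0, hs]
  have fzt : follows z t = true := by simp [follows, h0, hs]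
  simp only [reducedWords, force_eq, nextOps, List.mem_flatMap, Bool.cond_eq_ite]
  refine ⟨x, mem_allOps vx nx, y, List.mem_filter.2 ⟨mem_allOps vy ny, fxy⟩, ?_⟩
  rw [if_neg (by rw [Nat.blt_eq]; omega)]
  refine List.mem_flatMap.2 ⟨z, List.mem_filter.2 ⟨mem_allOps vz nz, fyz⟩, ?_⟩
  rw [if_neg (by rw [Nat.blt_eq]; omega), if_neg (by simp [h0])]
  refine List.mem_filterMap.2 ⟨t, List.mem_filter.2 ⟨mem_allOps vt nt, fzt⟩, ?_⟩
  rw [if_neg (by rw [Nat.blt_eq]; omega), if_neg (by simp [h0])]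

/-! ### The verification -/

lemma check_le_four : ∀ m < 5, (checkZero m && checkPairs m (nonzeroWords m)) = true := by
  decide +kernel

lemma check_five : (checkZero 5 && checkPairs 5 (nonzeroWords 5)) = true := by decide +kernel

lemma check_six : (checkZero 6 && checkPairs 6 (nonzeroWords 6)) = true := by decide +kernel

lemma check_seven : (checkZero 7 && checkPairs 7 (nonzeroWords 7)) = true := by decide +kernel

lemma check_eight : (checkZero 8 && checkPairs 8 (nonzeroWords 8)) = true := by decide +kernel

theorem check_le_eight {m : ℕ} (hm : m ≤ 8) :
    checkZero m = true ∧ checkPairs m (nonzeroWords m) = true := by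
  rw [← Bool.and_eq_true]
  rcases Nat.lt_or_ge m 5 with h | h
  · exact check_le_four m h
  · interval_cases m
    · exact check_five
    · exact check_six
    · exact check_seven
    · exact check_eight

/-! ### Sorting -/

/-- The word has two adjacent operators that commute. -/
def hasDisj : List (ℕ × ℕ) → Bool
  | p :: q :: T => disjB p q || hasDisj (q :: T)
  | _ => false

lemma disjB_symm (p q : ℕ × ℕ) : disjB q p = disjB p q := by
  rw [Bool.eq_iff_iff]
  simp only [disjB, Bool.and_eq_true, Bool.not_eq_true', nat_beq_eq_false_iff]
  grind

lemma ltOp_code {m : ℕ} {p q : ℕ × ℕ} (hq : q.2 < m) (h : ltOp q p = true) :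
    q.1 * m + q.2 < p.1 * m + p.2 := by
  simp only [ltOp, Bool.or_eq_true, Bool.and_eq_true, Nat.blt_eq, nat_beq_iff] at h
  rcases h with h | ⟨h, h'⟩
  · nlinarith
  · rw [h]
    omega

/-- Bubble sort by commutations. A word that has been changed still contains a commuting pair; since
the exceptional words contain none, they can only be the sorted form of themselves. -/
lemma exists_sorted {n m : ℕ} {g : ℕ → Fin n} (hg : StrictMonoOn g (Set.Iio m)) {x y z t : ℕ × ℕ}
    (hv : Valid m [x, y, z, t]) : ∃ x' y' z' t', [x', y', z', t'].Perm [x, y, z, t] ∧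
      IsConsequence 4 (word (liftW g [x, y, z, t])) (word (liftW g [x', y', z', t'])) ∧
      Sorted [x', y', z', t'] ∧
      ([x', y', z', t'] = [x, y, z, t] ∨ hasDisj [x', y', z', t'] = true) := by
  -- The operators are numbered lexicographically and weighted by `3, 2, 1, 0`, so that moving a
  -- smaller one forward decreases the sum.
  generalize hN : 3 * (x.1 * m + x.2) + 2 * (y.1 * m + y.2) + (z.1 * m + z.2) = N
  induction N using Nat.strong_induction_on generalizing x y z t with
  | _ N ih =>
    subst hN
    have step : ∀ x₁ y₁ z₁ t₁ : ℕ × ℕ, [x₁, y₁, z₁, t₁].Perm [x, y, z, t] →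
        IsConsequence 4 (word (liftW g [x, y, z, t])) (word (liftW g [x₁, y₁, z₁, t₁])) →
        hasDisj [x₁, y₁, z₁, t₁] = true →
        3 * (x₁.1 * m + x₁.2) + 2 * (y₁.1 * m + y₁.2) + (z₁.1 * m + z₁.2) <
          3 * (x.1 * m + x.2) + 2 * (y.1 * m + y.2) + (z.1 * m + z.2) →
        ∃ x' y' z' t', [x', y', z', t'].Perm [x, y, z, t] ∧
          IsConsequence 4 (word (liftW g [x, y, z, t])) (word (liftW g [x', y', z', t'])) ∧
          Sorted [x', y', z', t'] ∧
          ([x', y', z', t'] = [x, y, z, t] ∨ hasDisj [x', y', z', t'] = true) := by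
      intro x₁ y₁ z₁ t₁ hp hc hd hlt
      obtain ⟨x', y', z', t', h1, h2, h3, h4⟩ :=
        ih _ hlt (fun p hp' => hv p (hp.mem_iff.1 hp')) rfl
      refine ⟨x', y', z', t', h1.trans hp, hc.trans h2, h3, Or.inr ?_⟩
      rcases h4 with h4 | h4
      · rw [h4]; exact hd
      · exact h4
    by_cases h1 : (disjB x y && ltOp y x) = true
    · rw [Bool.and_eq_true] at h1
      refine step y x z t (List.Perm.swap _ _ _) (neighbors_sound hg hv ?_).2 ?_ ?_
      · simp [neighbors, h1.1]
      · simp [hasDisj, disjB_symm x y, h1.1]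
      · have := ltOp_code hv.tail.head.2 h1.2
        omega
    by_cases h2 : (disjB y z && ltOp z y) = true
    · rw [Bool.and_eq_true] at h2
      refine step x z y t ((List.Perm.swap _ _ _).cons _) (neighbors_sound hg hv ?_).2 ?_ ?_
      · simp [neighbors, h2.1]
      · simp [hasDisj, disjB_symm y z, h2.1]
      · have := ltOp_code hv.tail.tail.head.2 h2.2
        omega
    by_cases h3 : (disjB z t && ltOp t z) = true
    · rw [Bool.and_eq_true] at h3
      refine step x y t z (((List.Perm.swap _ _ _).cons _).cons _)
        (neighbors_sound hg hv ?_).2 ?_ ?_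
      · simp [neighbors, h3.1]
      · simp [hasDisj, disjB_symm z t, h3.1]
      · have := ltOp_code hv.tail.tail.tail.head.2 h3.2
        omega
    refine ⟨x, y, z, t, List.Perm.refl _, IsConsequence.refl _, ?_, Or.inl rfl⟩
    simp only [Bool.not_eq_true] at h1 h2 h3
    simp only [Sorted, List.isChain_cons_cons, h1, h2, h3, true_and, List.isChain_singleton]

lemma occ_perm {S T : List (ℕ × ℕ)} (h : S.Perm T) {c : ℕ} (hc : Occ c T) : Occ c S := by
  obtain ⟨p, hp, hc⟩ := hc
  exact ⟨p, h.mem_iff.2 hp, hc⟩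

lemma exists_reduced {n m : ℕ} {g : ℕ → Fin n} (hg : StrictMonoOn g (Set.Iio m))
    {w : List (ℕ × ℕ)} (hw : Valid m w) (hf : Full m w) (hne : ∀ p ∈ w, p.1 ≠ p.2)
    (hl : w.length = 4) : ∃ w', Valid m w' ∧ Full m w' ∧ w'.length = 4 ∧
      IsConsequence 4 (word (liftW g w)) (word (liftW g w')) ∧
      (w' = w ∨ hasDisj w' = true) ∧ (hasZero w' = true ∨ w' ∈ reducedWords m) := by
  obtain ⟨x, y, z, t, rfl⟩ : ∃ x y z t, w = [x, y, z, t] := by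
    match w, hl with
    | [x, y, z, t], _ => exact ⟨x, y, z, t, rfl⟩
  obtain ⟨x', y', z', t', h1, h2, h3, h4⟩ := exists_sorted hg hw
  have hw' : Valid m [x', y', z', t'] := fun p hp => hw p (h1.mem_iff.1 hp)
  have hf' : Full m [x', y', z', t'] := fun i hi => occ_perm h1 (hf i hi)
  refine ⟨_, hw', hf', rfl, h2, h4, ?_⟩
  rcases h0 : hasZero [x', y', z', t'] with _ | _
  · exact Or.inr (mem_reducedWords hw' (fun p hp => hne p (h1.mem_iff.1 hp)) hf' h3 h0)
  · exact Or.inl rfl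

/-! ### Classification -/

lemma isNonzero_sound {n m : ℕ} {g : ℕ → Fin n} (hg : StrictMonoOn g (Set.Iio m)) (hm : m ≤ 8)
    {w : List (ℕ × ℕ)} (hw : Valid m w) (hne : w ≠ []) (h : isNonzero m w = true) :
    ¬ Equivalent (word (liftW g w)) 0 := by
  rw [isNonzero, force_eq] at h
  exact not_equivalent_zero_of_okB hg hm hw hne h

instance (m : ℕ) (w : List (ℕ × ℕ)) : Decidable (Valid m w) := by unfold Valid; infer_instance

instance (c : ℕ) (w : List (ℕ × ℕ)) : Decidable (Occ c w) := by unfold Occ; infer_instance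

instance (m : ℕ) (w : List (ℕ × ℕ)) : Decidable (Full m w) := by unfold Full; infer_instance

lemma zeroOrbit_spec : ∀ w ∈ zeroOrbit, Valid 5 w ∧ Full 5 w ∧ hasDisj w = false := by
  decide +kernel

lemma pairOrbit_spec : ∀ q ∈ pairOrbit, Valid 4 q.1 ∧ Full 4 q.1 ∧ Valid 4 q.2 ∧
    hasDisj q.1 = false ∧ hasDisj q.2 = false ∧ q.swap ∈ pairOrbit := by
  decide +kernel

lemma eq_of_not_hasDisj {w w' : List (ℕ × ℕ)} (h : w' = w ∨ hasDisj w' = true)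
    (h' : hasDisj w' = false) : w' = w :=
  h.resolve_right (by simp [h'])

lemma zero_cases {n m : ℕ} {g : ℕ → Fin n} (hg : StrictMonoOn g (Set.Iio m)) (hm : m ≤ 8)
    {w : List (ℕ × ℕ)} (hw : Valid m w) (hf : Full m w)
    (h : hasZero w = true ∨ w ∈ reducedWords m) :
    (w ∈ reducedWords m ∧ isNonzero m w = true) ∨ IsConsequence 4 (word (liftW g w)) 0 ∨
      (m = 5 ∧ w ∈ zeroOrbit) := by
  rcases h with h | h
  · exact Or.inr (Or.inl (hasZero_sound hg hw h))
  · have := List.all_eq_true.1 (check_le_eight hm).1 w h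
    simp only [Bool.or_eq_true, List.any_eq_true, eqW_iff] at this
    rcases this with (h1 | h1) | ⟨w', h1, rfl⟩
    · exact Or.inl ⟨h, h1⟩
    · exact Or.inr (Or.inl (canZero_sound hg 3 hw h1))
    · obtain ⟨v5, f5, -⟩ := zeroOrbit_spec w h1
      exact Or.inr (Or.inr ⟨hw.eq_of_full hf v5 f5, h1⟩)

/-- After flattening and sorting, nonzero words are excluded by `h0` and words that reduce to zero
by minimality. -/
theorem mem_zeroOrbit_of_isMinimalZero {n : ℕ} {v : Comp n} (h : IsMinimalZero 4 v) :
    ∃ g : ℕ → Fin n, StrictMonoOn g (Set.Iio 5) ∧ ∃ w ∈ zeroOrbit, opList v = liftW g w := by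
  obtain ⟨hl, h0, hmin⟩ := h
  obtain ⟨g, hg, hS⟩ := exists_enum (supp v) (supp_nonempty (by omega))
  obtain ⟨w, hw, hf, hlift⟩ := exists_liftW hg (T := opList v) fun c => by rw [occ_opList, hS]
  have hlw : w.length = 4 := by
    have := congrArg List.length hlift
    rw [opList_length] at this
    simpa [liftW, hl] using this
  have hm : (supp v).card ≤ 8 := by have := hf.le; omega
  rw [← word_opList, ← hlift] at h0 hmin
  obtain ⟨w', hw', hf', hl', hc, hd, hr⟩ :=
    exists_reduced hg hw hf (ne_of_lift (hlift ▸ opList_ne v)) hlw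
  rcases zero_cases hg hm hw' hf' hr with ⟨-, h1⟩ | h1 | ⟨h5, h1⟩
  · refine absurd (hc.equivalent.symm.trans h0) (isNonzero_sound hg hm hw' ?_ h1)
    rintro rfl
    simp at hl'
  · exact absurd (hc.trans h1) hmin
  · rw [h5] at hg
    refine ⟨g, hg, w', h1, ?_⟩
    rw [← hlift, eq_of_not_hasDisj hd (zeroOrbit_spec w' h1).2.2]

lemma checkPairs_pairwise {m : ℕ} {L : List (ℕ × List (ℕ × ℕ))} (h : checkPairs m L = true) :
    L.Pairwise fun u w => checkPair m u w = true := by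
  induction L with
  | nil => exact List.Pairwise.nil
  | cons u L ih =>
    rw [checkPairs, Bool.and_eq_true, List.all_eq_true] at h
    exact List.Pairwise.cons h.1 (ih h.2)

lemma checkPair_sound {n m : ℕ} {g : ℕ → Fin n} (hg : StrictMonoOn g (Set.Iio m)) (hm : m ≤ 8)
    {u w : List (ℕ × ℕ)} (hu : Valid m u) (hw : Valid m w) (hne : u ≠ [])
    (h0 : isNonzero m u = true) (he : Equivalent (word (liftW g u)) (word (liftW g w)))
    (h : checkPair m (permCode m u, u) (permCode m w, w) = true) :
    IsConsequence 4 (word (liftW g u)) (word (liftW g w)) ∨ (u, w) ∈ pairOrbit := by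
  rw [isNonzero, force_eq] at h0
  obtain ⟨h1, h2, h3, -⟩ := invariants_eq_of_equivalent hg hm hu hw hne h0 he
  simp only [checkPair, h1, h2, h3, Bool.cond_eq_ite, nat_beq_iff, if_true, Bool.not_true,
    Bool.false_or, Bool.or_eq_true, List.any_eq_true, Bool.and_eq_true, eqW_iff] at h
  rcases h with h | ⟨q, hq, rfl, rfl⟩
  · left
    refine (canReach_sound (P := fun v => Valid m v ∧
      IsConsequence 4 (word (liftW g u)) (word (liftW g v))) ?_ 5 ?_ h).2
    · rintro v ⟨hv, hc⟩ v' hv'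
      obtain ⟨h1, h2⟩ := neighbors_sound hg hv hv'
      exact ⟨h1, hc.trans h2⟩
    · intro v hv
      rw [List.mem_singleton.1 hv]
      exact ⟨hu, IsConsequence.refl _⟩
  · exact Or.inr hq

lemma pair_cases {n m : ℕ} {g : ℕ → Fin n} (hg : StrictMonoOn g (Set.Iio m)) (hm : m ≤ 8)
    {u w : List (ℕ × ℕ)} (hu : Valid m u) (hw : Valid m w) (hu' : u ≠ []) (hw' : w ≠ [])
    (ru : u ∈ reducedWords m) (rw' : w ∈ reducedWords m) (zu : isNonzero m u = true)
    (zw : isNonzero m w = true) (he : Equivalent (word (liftW g u)) (word (liftW g w))) :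
    IsConsequence 4 (word (liftW g u)) (word (liftW g w)) ∨ (u, w) ∈ pairOrbit := by
  have mem : ∀ v, v ∈ reducedWords m → isNonzero m v = true →
      (permCode m v, v) ∈ nonzeroWords m := by
    intro v hv hz
    exact List.mem_filterMap.2 ⟨v, hv, by rw [hz, cond_true, force_eq]⟩
  by_cases huw : u = w
  · subst huw
    exact Or.inl (IsConsequence.refl _)
  -- Each unordered pair is checked in only one order, so the check is symmetrized.
  have hp := (checkPairs_pairwise (check_le_eight hm).2).imp
    (S := fun a b => checkPair m a b = true ∨ checkPair m b a = true) fun h => Or.inl h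
  have : Std.Symm fun a b => checkPair m a b = true ∨ checkPair m b a = true :=
    ⟨fun _ _ h => h.symm⟩
  have := hp.forall (mem u ru zu) (mem w rw' zw) fun h => huw (Prod.ext_iff.1 h).2
  rcases this with h | h
  · exact checkPair_sound hg hm hu hw hu' zu he h
  · rcases checkPair_sound hg hm hw hu hw' zw he.symm h with h | h
    · exact Or.inl h.symm
    · exact Or.inr (pairOrbit_spec _ h).2.2.2.2.2

theorem mem_pairOrbit_of_isMinimalNonzero {n : ℕ} {u v : Comp n} (h : IsMinimalNonzero 4 u v) :
    ∃ g : ℕ → Fin n, StrictMonoOn g (Set.Iio 4) ∧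
      ∃ q ∈ pairOrbit, opList u = liftW g q.1 ∧ opList v = liftW g q.2 := by
  obtain ⟨hlu, hlv, he, h0, hmin⟩ := h
  have hv0 : ¬ Equivalent (v : WithZero (Comp n)) 0 := fun h => h0 (he.trans h)
  have hne : ∀ v : Comp n, v.length = 4 → opList v ≠ [] := by
    intro v hv h
    rw [← opList_length, h] at hv
    simp at hv
  have hsupp : ∀ c, Occ c (opList u) ↔ Occ c (opList v) := by
    rw [← word_opList, ← word_opList] at he
    rw [← word_opList] at h0 hv0
    exact fun c => ⟨occ_of_equivalent he.symm (hne v hlv) hv0, occ_of_equivalent he (hne u hlu) h0⟩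
  obtain ⟨g, hg, hS⟩ := exists_enum (supp u) (supp_nonempty (by omega))
  obtain ⟨w, hw, hf, hlift⟩ := exists_liftW hg (T := opList u) fun c => by rw [occ_opList, hS]
  obtain ⟨z, hz, hfz, hliftz⟩ := exists_liftW hg (T := opList v) fun c => by
    rw [← hsupp, occ_opList, hS]
  have hlw : w.length = 4 := by
    have := congrArg List.length hlift
    rw [opList_length] at this
    simpa [liftW, hlu] using this
  have hlz : z.length = 4 := by
    have := congrArg List.length hliftz
    rw [opList_length] at this
    simpa [liftW, hlv] using this
  have hm : (supp u).card ≤ 8 := by have := hf.le; omega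
  rw [← word_opList, ← word_opList, ← hlift, ← hliftz] at he hmin
  rw [← word_opList, ← hlift] at h0
  rw [← word_opList, ← hliftz] at hv0
  obtain ⟨w', hw', hf', hl', hc, hd, hr⟩ :=
    exists_reduced hg hw hf (ne_of_lift (hlift ▸ opList_ne u)) hlw
  obtain ⟨z', hz', hfz', hlz', hcz, hdz, hrz⟩ :=
    exists_reduced hg hz hfz (ne_of_lift (hliftz ▸ opList_ne v)) hlz
  -- Both sorted words are nonzero, which excludes reduction to zero and the exceptional zero words.
  have nonzero : ∀ w' : List (ℕ × ℕ), ¬ Equivalent (word (liftW g w')) 0 →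
      ((w' ∈ reducedWords (supp u).card ∧ isNonzero (supp u).card w' = true) ∨
        IsConsequence 4 (word (liftW g w')) 0 ∨ ((supp u).card = 5 ∧ w' ∈ zeroOrbit)) →
      w' ∈ reducedWords (supp u).card ∧ isNonzero (supp u).card w' = true := by
    rintro w' h0 (h | h | ⟨h5, h⟩)
    · exact h
    · exact absurd h.equivalent h0
    · rw [h5] at hg
      exact absurd (equivalent_zero_of_mem_zeroOrbit hg h) h0
  obtain ⟨ru, zu⟩ := nonzero w' (fun h => h0 (hc.equivalent.trans h))
    (zero_cases hg hm hw' hf' hr)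
  obtain ⟨rv, zv⟩ := nonzero z' (fun h => hv0 (hcz.equivalent.trans h))
    (zero_cases hg hm hz' hfz' hrz)
  have hne' : ∀ w : List (ℕ × ℕ), w.length = 4 → w ≠ [] := by
    rintro _ h rfl
    simp at h
  rcases pair_cases hg hm hw' hz' (hne' _ hl') (hne' _ hlz') ru rv zu zv
    ((hc.equivalent.symm.trans he).trans hcz.equivalent) with h | h
  · exact absurd ((hc.trans h).trans hcz.symm) hmin
  · obtain ⟨h1, h2, -, h4, h5, -⟩ := pairOrbit_spec _ h
    have h4m := hw'.eq_of_full hf' h1 h2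
    rw [h4m] at hg
    refine ⟨g, hg, _, h, ?_, ?_⟩
    · rw [← hlift, eq_of_not_hasDisj hd h4]
    · rw [← hliftz, eq_of_not_hasDisj hdz h5]

/-! ### The exceptional equivalences are minimal -/

/-- The words of degree `k` that act at the given positions. -/
def okWords (m : ℕ) : ℕ → (ℕ → ℕ) → List (List (ℕ × ℕ))
  | 0, _ => [[]]
  | k + 1, F => (allOps m).flatMap fun p =>
      bif okB m F [p] then (okWords m k fun c => F (sw p.1 p.2 c)).map (p :: ·) else []

/-- The word is nonzero and not equivalent to any other word in the same indices. -/
def isRigid (m : ℕ) (d : List (ℕ × ℕ)) : Bool :=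
  okB m (posFun (posCode m d)) d && (okWords m d.length (posFun (posCode m d))).all fun t =>
    eqW t d || !Nat.beq (permCode m d) (permCode m t) || !sameWsum d t

/-- Deleting the first or the last operator of the word yields a rigid word. -/
def hasRigidFactors (m : ℕ) (w : List (ℕ × ℕ)) : Bool := isRigid m w.tail && isRigid m w.dropLast

lemma mem_okWords {m : ℕ} {F : ℕ → ℕ} {w : List (ℕ × ℕ)} (hw : Valid m w)
    (hne : ∀ p ∈ w, p.1 ≠ p.2) (h : okB m F w = true) : w ∈ okWords m w.length F := by
  induction w generalizing F with
  | nil => exact List.mem_singleton.2 rfl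
  | cons p T ih =>
    simp only [okB, Bool.and_eq_true] at h
    refine List.mem_flatMap.2 ⟨p, mem_allOps hw.head (hne p List.mem_cons_self), ?_⟩
    rw [Bool.cond_eq_ite, if_pos (by simp only [okB, Bool.and_eq_true]; exact ⟨h.1, trivial⟩)]
    exact List.mem_map_of_mem (ih hw.tail (fun q hq => hne q (List.mem_cons_of_mem _ hq)) h.2)

/-- An equivalent word has its indices in the support of `d`, acts at the same test positions, and
has the same length, permutation and `wsum`. `okWords` lists all candidates, and only `d` survives.
-/
lemma isRigid_sound {n m : ℕ} {g : ℕ → Fin n} (hg : StrictMonoOn g (Set.Iio m)) (hm : m ≤ 8)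
    {d : List (ℕ × ℕ)} (hd : Valid m d) (hne : d ≠ []) (h : isRigid m d = true)
    {z : WithZero (Comp n)} (hz : Equivalent (word (liftW g d)) z) : z = word (liftW g d) := by
  rw [isRigid, Bool.and_eq_true] at h
  have h0 := not_equivalent_zero_of_okB hg hm hd hne h.1
  cases z with
  | zero => exact absurd hz h0
  | coe v =>
    rw [← word_opList] at hz ⊢
    have hocc : ∀ c, Occ c (opList v) → ∃ i < m, g i = c := by
      intro c hc
      obtain ⟨i, hi, rfl⟩ := occ_lift.1 (occ_of_equivalent hz (liftW_ne_nil hne) h0 hc)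
      exact ⟨i, hd.lt_of_occ hi, rfl⟩
    obtain ⟨t, ht, hlift⟩ := exists_valid_liftW hocc
    rw [← hlift] at hz ⊢
    obtain ⟨h1, h2, h3, h4⟩ := invariants_eq_of_equivalent hg hm hd ht hne h.1 hz
    have := mem_okWords ht (ne_of_lift (hlift ▸ opList_ne v)) h1
    rw [← h4] at this
    have := List.all_eq_true.1 h.2 t this
    simp only [h2, h3, Bool.or_eq_true, eqW_iff, Bool.not_eq_true', nat_beq_eq_false_iff,
      not_true_eq_false, or_false, Bool.true_eq_false] at this
    rw [this]

/-- The congruence that relates `u` and `v` if they can replace each other in factorizations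
of `W`. -/
def factorCon {n : ℕ} (W : WithZero (Comp n)) : Con (WithZero (Comp n)) where
  r u v := ∀ x y, x * u * y = W ↔ x * v * y = W
  iseqv := ⟨fun _ _ _ => Iff.rfl, fun h x y => (h x y).symm, fun h h' x y => (h x y).trans (h' x y)⟩
  mul' := by
    intro u v u' v' h h' x y
    rw [← mul_assoc, mul_assoc (x * u), h x, ← mul_assoc, h', mul_assoc x]

/-- A proper factor misses the first or the last operator. -/
lemma word_isSuffix_cases {n : ℕ} {X S Y D : List (Fin n × Fin n)} (h : Y ++ S ++ X = D)
    (hS : S.length < D.length) : (∃ p Y', Y = p :: Y' ∧ Y' ++ S ++ X = D.tail) ∨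
      ∃ p X', X = X' ++ [p] ∧ Y ++ S ++ X' = D.dropLast := by
  subst h
  cases Y with
  | cons p Y' => exact Or.inl ⟨p, Y', rfl, rfl⟩
  | nil =>
    rcases List.eq_nil_or_concat X with rfl | ⟨X', p, rfl⟩
    · simp at hS
    · rw [List.concat_eq_append]
      refine Or.inr ⟨p, X', rfl, ?_⟩
      rw [← List.append_assoc, List.dropLast_concat]

lemma opList_mul {n : ℕ} (u v : Comp n) : opList (u * v) = opList v ++ opList u := by
  simp [opList, FreeMonoid.toList_mul]

/-- A factor of degree less than four lies in one of the two rigid words of degree three, so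
replacing it by something equivalent gives back the same word. Hence every lower equivalence lies in
`factorCon W`, and so does the congruence that they generate. -/
lemma eq_of_isConsequence {n m : ℕ} {g : ℕ → Fin n} (hg : StrictMonoOn g (Set.Iio m)) (hm : m ≤ 8)
    {r : List (ℕ × ℕ)} (hr : Valid m r) (hl : r.length = 4) (hrig : hasRigidFactors m r = true)
    {W : Comp n} (hW : opList W = liftW g r) {z : WithZero (Comp n)}
    (h : IsConsequence 4 (W : WithZero (Comp n)) z) : z = W := by
  rw [hasRigidFactors, Bool.and_eq_true] at hrig
  have hle : conGen (LowerEquivalence 4) ≤ factorCon (W : WithZero (Comp n)) := by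
    refine Con.conGen_le.2 ?_
    have key : ∀ s t : WithZero (Comp n), Equivalent s t → DegreeLT 4 s → ∀ x y,
        x * s * y = W → x * t * y = W := by
      intro s t he hs x y hxy
      cases x with
      | zero => rw [zero_mul, zero_mul] at hxy; cases hxy
      | coe X =>
        cases y with
        | zero => rw [mul_zero] at hxy; cases hxy
        | coe Y =>
          cases s with
          | zero => rw [mul_zero, zero_mul] at hxy; cases hxy
          | coe S =>
            have hS := hs S rfl
            rw [← opList_length] at hS
            rw [← WithZero.coe_mul, ← WithZero.coe_mul, WithZero.coe_inj] at hxy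
            have hcat : opList Y ++ opList S ++ opList X = liftW g r := by
              rw [← hW, ← hxy, opList_mul, opList_mul, List.append_assoc]
            rcases word_isSuffix_cases hcat (by simpa [liftW, hl] using hS) with
              ⟨p, Y', hY, hD⟩ | ⟨p, X', hX, hD⟩
            · rw [liftW, ← List.map_tail] at hD
              change _ = liftW g r.tail at hD
              have hword : word (liftW g r.tail) = X * S * word Y' := by
                rw [← hD, word_append, word_append, word_opList, word_opList, mul_assoc]
              have := isRigid_sound hg hm (fun q hq => hr q (List.mem_of_mem_tail hq))
                (by rintro h0; have := congrArg List.length h0; simp [hl] at this) hrig.1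
                (hword ▸ equivalent_mul (equivalent_mul (Equivalent.refl _) he)
                  (Equivalent.refl _))
              rw [← word_opList Y, hY, word, ← mul_assoc, this, ← word, ← word_opList W, hW,
                ← hcat, hY, List.cons_append, List.cons_append, hD]
            · rw [liftW, ← List.map_dropLast] at hD
              change _ = liftW g r.dropLast at hD
              have hword : word (liftW g r.dropLast) = word X' * S * Y := by
                rw [← hD, word_append, word_append, word_opList, word_opList, mul_assoc]
              have := isRigid_sound hg hm (fun q hq => hr q (List.mem_of_mem_dropLast hq))
                (by rintro h0; have := congrArg List.length h0; simp [hl] at this) hrig.2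
                (hword ▸ equivalent_mul (equivalent_mul (Equivalent.refl _) he)
                  (Equivalent.refl _))
              rw [← word_opList X, hX, word_append, mul_assoc, mul_assoc, ← mul_assoc (word X'),
                this, ← word_append, ← word_opList W, hW, ← hcat, hX, ← List.append_assoc, hD]
    exact fun s t hst x y => ⟨key s t hst.1 hst.2.1 x y, key t s hst.1.symm hst.2.2 x y⟩
  -- The empty surroundings `x = y = 1` recover equality with `W`.
  have := (hle h 1 1).1 (by simp)
  simpa using this

lemma zeroOrbit_rigid : zeroOrbit.all (hasRigidFactors 5) = true := by decide +kernel

lemma pairOrbit_rigid :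
    (pairOrbit.all fun q => hasRigidFactors 4 q.1 && isNonzero 4 q.1) = true := by
  decide +kernel

lemma liftW_inj {n m : ℕ} {g : ℕ → Fin n} (hg : StrictMonoOn g (Set.Iio m)) {u w : List (ℕ × ℕ)}
    (hu : Valid m u) (hw : Valid m w) (h : liftW g u = liftW g w) : u = w := by
  induction u generalizing w with
  | nil =>
    cases w with
    | nil => rfl
    | cons q T' => simp [liftW] at h
  | cons p T ih =>
    cases w with
    | nil => simp [liftW] at h
    | cons q T' =>
      simp only [liftW, List.map_cons, List.cons.injEq, Prod.ext_iff, Prod.map_fst,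
        Prod.map_snd] at h
      rw [eq_lift hg hu.head.1 hw.head.1, eq_lift hg hu.head.2 hw.head.2] at h
      rw [ih hu.tail hw.tail h.2, Prod.ext h.1.1 h.1.2]

lemma orbit_length : (∀ w ∈ zeroOrbit, w.length = 4) ∧
    ∀ q ∈ pairOrbit, q.1.length = 4 ∧ q.2.length = 4 ∧ q.1 ≠ q.2 := by
  decide +kernel

lemma length_of_opList {n : ℕ} {g : ℕ → Fin n} {v : Comp n} {w : List (ℕ × ℕ)}
    (h : opList v = liftW g w) : v.length = w.length := by
  rw [← opList_length, h, liftW, List.length_map]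

theorem isMinimalZero_of_mem_zeroOrbit {n : ℕ} {g : ℕ → Fin n} (hg : StrictMonoOn g (Set.Iio 5))
    {w : List (ℕ × ℕ)} (hw : w ∈ zeroOrbit) {v : Comp n} (hv : opList v = liftW g w) :
    IsMinimalZero 4 v := by
  have hl := orbit_length.1 w hw
  refine ⟨(length_of_opList hv).trans hl, ?_, fun h => ?_⟩
  · rw [← word_opList, hv]
    exact equivalent_zero_of_mem_zeroOrbit hg hw
  · have := eq_of_isConsequence hg (by norm_num) (zeroOrbit_spec w hw).1 hl
      (List.all_eq_true.1 zeroOrbit_rigid w hw) hv h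
    cases this

theorem isMinimalNonzero_of_mem_pairOrbit {n : ℕ} {g : ℕ → Fin n}
    (hg : StrictMonoOn g (Set.Iio 4)) {q : List (ℕ × ℕ) × List (ℕ × ℕ)} (hq : q ∈ pairOrbit)
    {u v : Comp n} (hu : opList u = liftW g q.1) (hv : opList v = liftW g q.2) :
    IsMinimalNonzero 4 u v := by
  obtain ⟨hl, hl', hne⟩ := orbit_length.2 q hq
  obtain ⟨hv1, -, hv2, -⟩ := pairOrbit_spec q hq
  have hrig := List.all_eq_true.1 pairOrbit_rigid q hq
  rw [Bool.and_eq_true] at hrig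
  refine ⟨(length_of_opList hu).trans hl, (length_of_opList hv).trans hl', ?_, ?_, fun h => ?_⟩
  · rw [← word_opList, ← word_opList, hu, hv]
    exact equivalent_of_mem_pairOrbit hg hq
  · rw [← word_opList, hu]
    refine isNonzero_sound hg (by norm_num) hv1 ?_ hrig.2
    rintro h0
    simp [h0] at hl
  · have := eq_of_isConsequence hg (by norm_num) hv1 hl hrig.1 hu h
    rw [WithZero.coe_inj] at this
    subst this
    exact hne (liftW_inj hg hv1 hv2 (hu.symm.trans hv))

/-! ### The transformations on flattened words -/

/-- The horizontal flip of a word in the indices `0, …, m - 1`. -/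
def flipW (m : ℕ) (w : List (ℕ × ℕ)) : List (ℕ × ℕ) := w.map fun p => (m - 1 - p.2, m - 1 - p.1)

/-- The effect of the transformations on words in the indices `0, …, m - 1`. -/
inductive IsMove (m : ℕ) : (List (ℕ × ℕ) → List (ℕ × ℕ)) → Prop
  | id : IsMove m id
  | shift : IsMove m (shiftW m)
  | flip : IsMove m (flipW m)
  | reverse : IsMove m List.reverse

lemma valid_map {m : ℕ} {f : ℕ × ℕ → ℕ × ℕ}
    (hf : ∀ p, p.1 < m ∧ p.2 < m → (f p).1 < m ∧ (f p).2 < m)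
    {w : List (ℕ × ℕ)} (hw : Valid m w) : Valid m (w.map f) := by
  intro p hp
  obtain ⟨q, hq, rfl⟩ := List.mem_map.1 hp
  exact hf q (hw q hq)

lemma IsMove.valid {m : ℕ} {τ : List (ℕ × ℕ) → List (ℕ × ℕ)} (h : IsMove m τ) {w : List (ℕ × ℕ)}
    (hw : Valid m w) : Valid m (τ w) := by
  cases h with
  | id => exact hw
  | shift => exact valid_map (fun p hp => ⟨Nat.mod_lt _ (by omega), Nat.mod_lt _ (by omega)⟩) hw
  | flip => exact valid_map (fun p hp => ⟨by dsimp only; omega, by dsimp only; omega⟩) hw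
  | reverse => exact fun p hp => hw p (List.mem_reverse.1 hp)

lemma IsMove.full {m : ℕ} {τ : List (ℕ × ℕ) → List (ℕ × ℕ)} (h : IsMove m τ) {w : List (ℕ × ℕ)}
    (hw : Full m w) : Full m (τ w) := by
  cases h with
  | id => exact hw
  | shift =>
    intro i hi
    obtain ⟨p, hp, h⟩ := hw ((i + (m - 1)) % m) (Nat.mod_lt _ (by omega))
    have e : ((i + (m - 1)) % m + 1) % m = i := by
      rw [Nat.mod_add_mod, show i + (m - 1) + 1 = i + m by omega, Nat.add_mod_right,
        Nat.mod_eq_of_lt hi]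
    refine ⟨_, List.mem_map_of_mem hp, ?_⟩
    rcases h with h | h
    · exact Or.inl (by dsimp only; rw [← h, e])
    · exact Or.inr (by dsimp only; rw [← h, e])
  | flip =>
    intro i hi
    obtain ⟨p, hp, h⟩ := hw (m - 1 - i) (by omega)
    refine ⟨_, List.mem_map_of_mem hp, ?_⟩
    rcases h with h | h
    · exact Or.inr (by dsimp only; omega)
    · exact Or.inl (by dsimp only; omega)
  | reverse =>
    intro i hi
    obtain ⟨p, hp, h⟩ := hw i hi
    exact ⟨p, List.mem_reverse.2 hp, h⟩

lemma shiftW_iterate {m : ℕ} {w : List (ℕ × ℕ)} (hw : Valid m w) (k : ℕ) :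
    (shiftW m)^[k] w = w.map fun p => ((p.1 + k) % m, (p.2 + k) % m) := by
  induction k with
  | zero =>
    refine (List.map_id w).symm.trans (List.map_congr_left fun p hp => ?_)
    obtain ⟨h1, h2⟩ := hw p hp
    simp [Nat.mod_eq_of_lt h1, Nat.mod_eq_of_lt h2]
  | succ k ih =>
    rw [Function.iterate_succ_apply', ih, shiftW, List.map_map]
    refine List.map_congr_left fun p _ => ?_
    simp [Nat.mod_add_mod, add_assoc]

/-- Moves have finite order on valid words, so inverses of transformations need no separate
treatment. -/
lemma IsMove.exists_iterate {m : ℕ} {τ : List (ℕ × ℕ) → List (ℕ × ℕ)} (h : IsMove m τ) :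
    ∃ k, ∀ w, Valid m w → τ^[k] (τ w) = w := by
  cases h with
  | id => exact ⟨0, fun w _ => rfl⟩
  | shift =>
    rcases Nat.eq_zero_or_pos m with rfl | hm
    · refine ⟨0, fun w hw => ?_⟩
      cases w with
      | nil => rfl
      | cons p T => exact absurd hw.head.1 (by omega)
    · refine ⟨m - 1, fun w hw => ?_⟩
      rw [← Function.iterate_succ_apply, show (m - 1).succ = m by omega, shiftW_iterate hw]
      conv_rhs => rw [← List.map_id w]
      refine List.map_congr_left fun p hp => ?_
      obtain ⟨h1, h2⟩ := hw p hp
      simp [Nat.mod_eq_of_lt h1, Nat.mod_eq_of_lt h2]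
  | flip =>
    refine ⟨1, fun w hw => ?_⟩
    rw [Function.iterate_one, flipW, flipW, List.map_map]
    conv_rhs => rw [← List.map_id w]
    refine List.map_congr_left fun p hp => ?_
    obtain ⟨h1, h2⟩ := hw p hp
    exact Prod.ext (by dsimp; omega) (by dsimp; omega)
  | reverse => exact ⟨1, fun w _ => List.reverse_reverse w⟩

/-! ### Enumerations of the support -/

/-- The function `g` enumerates `S` in increasing order. -/
def Enumerates {n : ℕ} (m : ℕ) (g : ℕ → Fin n) (S : Finset (Fin n)) : Prop :=
  StrictMonoOn g (Set.Iio m) ∧ ∀ c, c ∈ S ↔ ∃ i < m, g i = c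

lemma Enumerates.card_eq {n m : ℕ} {g : ℕ → Fin n} {S : Finset (Fin n)} (h : Enumerates m g S) :
    S.card = m := by
  have : S = (Finset.range m).image g := by
    ext c
    simp [h.2 c]
  rw [this, Finset.card_image_of_injOn, Finset.card_range]
  intro i hi j hj hij
  exact h.1.injOn (by simpa using hi) (by simpa using hj) hij

lemma Enumerates.orderEmbOfFin_eq {n : ℕ} {g : ℕ → Fin n} {S : Finset (Fin n)}
    (h : Enumerates S.card g S) (i : Fin S.card) : S.orderEmbOfFin rfl i = g i := by
  have := Finset.orderEmbOfFin_unique (s := S) rfl (f := fun i : Fin S.card => g i)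
    (fun x => (h.2 _).2 ⟨x, x.2, rfl⟩) (fun x y hxy => h.1 x.2 y.2 hxy)
  exact (congrFun this i).symm

lemma Enumerates.flattenPerm_apply {n m : ℕ} {g : ℕ → Fin n} {S : Finset (Fin n)}
    (h : Enumerates m g S) {i : ℕ} (hi : i < m) : (flattenPerm S (g i) : ℕ) = i := by
  obtain rfl := h.card_eq
  have : (finSumEquivOfFinset (s := S) rfl rfl).symm (g i) = Sum.inl ⟨i, hi⟩ := by
    rw [Equiv.symm_apply_eq, finSumEquivOfFinset_inl, h.orderEmbOfFin_eq]
  simp [flattenPerm, this]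

lemma Enumerates.shiftPerm_apply {n m : ℕ} {g : ℕ → Fin n} {S : Finset (Fin n)}
    (h : Enumerates m g S) {i : ℕ} (hi : i < m) : shiftPerm S (g i) = g ((i + 1) % m) := by
  obtain rfl := h.card_eq
  have e : ∀ j : Fin S.card, ((S.orderIsoOfFin rfl).toEquiv j : Fin n) = g j :=
    fun j => h.orderEmbOfFin_eq j
  have := Perm.extendDomain_apply_image (finRotate S.card) (S.orderIsoOfFin rfl).toEquiv ⟨i, hi⟩
  rw [e, e] at this
  rw [shiftPerm, this]
  congr 1
  clear this e h
  generalize S.card = m at hi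
  obtain _ | m := m
  · omega
  · rw [finRotate_apply, Fin.val_add]
    simp [Nat.add_mod]

lemma Enumerates.flipPerm_apply {n m : ℕ} {g : ℕ → Fin n} {S : Finset (Fin n)}
    (h : Enumerates m g S) {i : ℕ} (hi : i < m) : flipPerm S (g i) = g (m - 1 - i) := by
  obtain rfl := h.card_eq
  have e : ∀ j : Fin S.card, ((S.orderIsoOfFin rfl).toEquiv j : Fin n) = g j :=
    fun j => h.orderEmbOfFin_eq j
  have := Perm.extendDomain_apply_image (Fin.revPerm (n := S.card)) (S.orderIsoOfFin rfl).toEquiv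
    ⟨i, hi⟩
  rw [e, e] at this
  rw [flipPerm, this]
  congr 1
  simp only [Fin.revPerm_apply, Fin.val_rev]
  omega

lemma opList_map_relabel {n : ℕ} (σ : Perm (Fin n)) (v : Comp n) :
    opList (FreeMonoid.map (relabel σ) v) = (opList v).map (Prod.map σ σ) := by
  simp only [opList, FreeMonoid.toList_map, List.map_map, List.map_reverse]
  rfl

lemma opList_map_relabelSwap {n : ℕ} (σ : Perm (Fin n)) (v : Comp n) :
    opList (FreeMonoid.map (relabelSwap σ) v) = (opList v).map fun p => (σ p.2, σ p.1) := by
  simp only [opList, FreeMonoid.toList_map, List.map_map, List.map_reverse]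
  rfl

lemma opList_verticalFlip {n : ℕ} (v : Comp n) : opList (verticalFlip v) = (opList v).reverse := by
  change (List.map Subtype.val v.toList.reverse).reverse = _
  rw [List.map_reverse]
  rfl

/-- The word of `v` is the flattened word `w`, with indices given by `g`. -/
structure Represents {n : ℕ} (m : ℕ) (g : ℕ → Fin n) (w : List (ℕ × ℕ)) (v : Comp n) : Prop where
  strictMonoOn : StrictMonoOn g (Set.Iio m)
  valid : Valid m w
  full : Full m w
  opList_eq : opList v = liftW g w

lemma Represents.enumerates {n m : ℕ} {g : ℕ → Fin n} {w : List (ℕ × ℕ)} {v : Comp n}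
    (h : Represents m g w v) : Enumerates m g (supp v) := by
  refine ⟨h.strictMonoOn, fun c => ?_⟩
  rw [← occ_opList, h.opList_eq, occ_lift]
  exact ⟨fun ⟨i, hi, hc⟩ => ⟨i, h.valid.lt_of_occ hi, hc⟩, fun ⟨i, hi, hc⟩ => ⟨i, h.full i hi, hc⟩⟩

/-- The increasing enumeration of the support is unique, and with it the flattened word. -/
lemma Represents.unique {n m m' : ℕ} {g g' : ℕ → Fin n} {w w' : List (ℕ × ℕ)} {v : Comp n}
    (h : Represents m g w v) (h' : Represents m' g' w' v) : m = m' ∧ w = w' := by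
  have e := h.enumerates
  have e' := h'.enumerates
  obtain rfl := e.card_eq
  obtain rfl := e'.card_eq
  refine ⟨rfl, ?_⟩
  have hgg : liftW g w = liftW g' w := by
    refine List.map_congr_left fun p hp => ?_
    obtain ⟨h1, h2⟩ := h.valid p hp
    refine Prod.ext ?_ ?_
    · exact (e.orderEmbOfFin_eq ⟨_, h1⟩).symm.trans (e'.orderEmbOfFin_eq ⟨_, h1⟩)
    · exact (e.orderEmbOfFin_eq ⟨_, h2⟩).symm.trans (e'.orderEmbOfFin_eq ⟨_, h2⟩)
  exact liftW_inj h'.strictMonoOn h.valid h'.valid (by rw [← hgg, ← h.opList_eq, h'.opList_eq])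

lemma Represents.cyclicShift {n m : ℕ} {g : ℕ → Fin n} {w : List (ℕ × ℕ)} {v : Comp n}
    (h : Represents m g w v) : Represents m g (shiftW m w) (cyclicShift v) := by
  refine ⟨h.strictMonoOn, IsMove.shift.valid h.valid, IsMove.shift.full h.full, ?_⟩
  rw [QuantumBruhat.cyclicShift, opList_map_relabel, h.opList_eq, liftW, liftW, shiftW,
    List.map_map, List.map_map]
  refine List.map_congr_left fun p hp => ?_
  obtain ⟨h1, h2⟩ := h.valid p hp
  exact Prod.ext (h.enumerates.shiftPerm_apply h1) (h.enumerates.shiftPerm_apply h2)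

lemma Represents.horizontalFlip {n m : ℕ} {g : ℕ → Fin n} {w : List (ℕ × ℕ)} {v : Comp n}
    (h : Represents m g w v) : Represents m g (flipW m w) (horizontalFlip v) := by
  refine ⟨h.strictMonoOn, IsMove.flip.valid h.valid, IsMove.flip.full h.full, ?_⟩
  rw [QuantumBruhat.horizontalFlip, opList_map_relabelSwap, h.opList_eq, liftW, liftW, flipW,
    List.map_map, List.map_map]
  refine List.map_congr_left fun p hp => ?_
  obtain ⟨h1, h2⟩ := h.valid p hp
  exact Prod.ext (h.enumerates.flipPerm_apply h2) (h.enumerates.flipPerm_apply h1)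

lemma Represents.verticalFlip {n m : ℕ} {g : ℕ → Fin n} {w : List (ℕ × ℕ)} {v : Comp n}
    (h : Represents m g w v) : Represents m g w.reverse (verticalFlip v) := by
  refine ⟨h.strictMonoOn, IsMove.reverse.valid h.valid, IsMove.reverse.full h.full, ?_⟩
  rw [opList_verticalFlip, h.opList_eq, liftW, liftW, List.map_reverse]

lemma Represents.flatten {n m : ℕ} {g : ℕ → Fin n} {w : List (ℕ × ℕ)} {v : Comp n}
    (h : Represents m g w v) :
    Represents m (fun i => flattenPerm (supp v) (g i)) w (flatten v) := by
  refine ⟨fun i hi j hj hij => ?_, h.valid, h.full, ?_⟩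
  · rw [Fin.lt_def, h.enumerates.flattenPerm_apply hi, h.enumerates.flattenPerm_apply hj]
    exact hij
  · rw [QuantumBruhat.flatten, opList_map_relabel, h.opList_eq, liftW, liftW, List.map_map]
    rfl

lemma Represents.flatten_eq {n m : ℕ} {g g' : ℕ → Fin n} {w : List (ℕ × ℕ)} {v v' : Comp n}
    (h : Represents m g w v) (h' : Represents m g' w v') :
    QuantumBruhat.flatten v = QuantumBruhat.flatten v' := by
  refine opList_injective ?_
  rw [h.flatten.opList_eq, h'.flatten.opList_eq]
  refine List.map_congr_left fun p hp => ?_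
  obtain ⟨h1, h2⟩ := h.valid p hp
  refine Prod.ext (Fin.ext ?_) (Fin.ext ?_)
  · exact (h.enumerates.flattenPerm_apply h1).trans (h'.enumerates.flattenPerm_apply h1).symm
  · exact (h.enumerates.flattenPerm_apply h2).trans (h'.enumerates.flattenPerm_apply h2).symm

/-- The new enumeration and the move depend only on the support, so they serve both members of a
pair simultaneously. -/
lemma exists_move {n m : ℕ} {T : Comp n → Comp n} (hT : IsTransformation T) {S : Finset (Fin n)}
    (g : ℕ → Fin n) : ∃ g' τ, IsMove m τ ∧ ∀ w v, supp v = S → Represents m g w v →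
      Represents m g' (τ w) (T v) := by
  cases hT with
  | flatten =>
    refine ⟨fun i => flattenPerm S (g i), _, IsMove.id, ?_⟩
    rintro w v rfl h
    exact h.flatten
  | cyclicShift => exact ⟨g, _, IsMove.shift, fun w v _ h => h.cyclicShift⟩
  | horizontalFlip => exact ⟨g, _, IsMove.flip, fun w v _ h => h.horizontalFlip⟩
  | verticalFlip => exact ⟨g, _, IsMove.reverse, fun w v _ h => h.verticalFlip⟩

lemma length_transformation {n : ℕ} {T : Comp n → Comp n} (hT : IsTransformation T) (v : Comp n) :
    (T v).length = v.length := by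
  rw [← opList_length, ← opList_length]
  cases hT with
  | flatten => rw [flatten, opList_map_relabel, List.length_map]
  | cyclicShift => rw [cyclicShift, opList_map_relabel, List.length_map]
  | horizontalFlip => rw [horizontalFlip, opList_map_relabelSwap, List.length_map]
  | verticalFlip => rw [opList_verticalFlip, List.length_reverse]

/-! ### The classes of related pairs -/

/-- The pair `q` of words can be reached from `q₀`. -/
def Reachable (m : ℕ) : List (ℕ × ℕ) × List (ℕ × ℕ) → List (ℕ × ℕ) × List (ℕ × ℕ) → Prop :=
  Relation.ReflTransGen fun q q' => ∃ τ, IsMove m τ ∧ q' = (τ q.1, τ q.2)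

lemma Reachable.iterate {m : ℕ} {q q' : List (ℕ × ℕ) × List (ℕ × ℕ)} (h : Reachable m q q')
    {τ : List (ℕ × ℕ) → List (ℕ × ℕ)} (hτ : IsMove m τ) (k : ℕ) :
    Reachable m q (τ^[k] q'.1, τ^[k] q'.2) := by
  induction k with
  | zero => exact h
  | succ k ih =>
    rw [Function.iterate_succ_apply', Function.iterate_succ_apply']
    exact ih.tail ⟨τ, hτ, rfl⟩

/-- The pair `p` is represented by a pair of words that can be reached from `q₀`. -/
def InClass {n : ℕ} (m : ℕ) (q₀ : List (ℕ × ℕ) × List (ℕ × ℕ)) (p : Comp n × Comp n) : Prop :=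
  ∃ g q, Reachable m q₀ q ∧ Represents m g q.1 p.1 ∧ Represents m g q.2 p.2

lemma inClass_transformation {n m : ℕ} (hm : 0 < m) {q₀ : List (ℕ × ℕ) × List (ℕ × ℕ)}
    {p : Comp n × Comp n} (hp : supp p.1 = supp p.2) {T : Comp n → Comp n}
    (hT : IsTransformation T) : InClass m q₀ p ↔ InClass m q₀ (T p.1, T p.2) := by
  constructor
  · rintro ⟨g, q, hq, h1, h2⟩
    obtain ⟨g', τ, hτ, h⟩ := exists_move (m := m) hT (S := supp p.1) g
    exact ⟨g', _, hq.tail ⟨τ, hτ, rfl⟩, h _ _ rfl h1, h _ _ hp.symm h2⟩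
  -- The pair `p` is flattened anew; by uniqueness its words are carried to `q` by a move, which
  -- iteration undoes.
  · rintro ⟨g, q, hq, h1, h2⟩
    have pos : ∀ (w : List (ℕ × ℕ)) (v : Comp n), Represents m g w (T v) → 0 < v.length := by
      intro w v h
      obtain ⟨p, hp, -⟩ := h.full 0 hm
      rw [← length_transformation hT, length_of_opList h.opList_eq]
      exact List.length_pos_of_mem hp
    obtain ⟨g₁, hg₁, hS⟩ := exists_enum (supp p.1) (supp_nonempty (pos _ _ h1))
    obtain ⟨w, hw, hf, hl⟩ := exists_liftW hg₁ (T := opList p.1) fun c => by rw [occ_opList, hS]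
    obtain ⟨z, hz, hfz, hlz⟩ := exists_liftW hg₁ (T := opList p.2) fun c => by
      rw [occ_opList, ← hp, hS]
    obtain ⟨g', τ, hτ, h⟩ := exists_move (m := (supp p.1).card) hT (S := supp p.1) g₁
    obtain ⟨hmm, e1⟩ := h1.unique (h w p.1 rfl ⟨hg₁, hw, hf, hl.symm⟩)
    obtain ⟨-, e2⟩ := h2.unique (h z p.2 hp.symm ⟨hg₁, hz, hfz, hlz.symm⟩)
    subst hmm
    obtain ⟨k, hk⟩ := hτ.exists_iterate
    have := hq.iterate hτ k
    rw [e1, e2, hk w hw, hk z hz] at this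
    exact ⟨g₁, _, this, ⟨hg₁, hw, hf, hl.symm⟩, ⟨hg₁, hz, hfz, hlz.symm⟩⟩

lemma inClass_of_pairRelated {n m : ℕ} (hm : 0 < m) {q₀ : List (ℕ × ℕ) × List (ℕ × ℕ)}
    {p p' : Comp n × Comp n} (h : PairRelated p p') : InClass m q₀ p ↔ InClass m q₀ p' := by
  induction h with
  | rel p p' h =>
    obtain ⟨hs, T, hT, rfl⟩ := h
    exact inClass_transformation hm hs hT
  | refl p => rfl
  | symm p p' _ ih => exact ih.symm
  | trans p p' p'' _ _ ih ih' => exact ih.trans ih'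

/-- Pairs with the same flattened words have the same flattening, through which they are connected.
-/
lemma pairRelated_of_represents {n m : ℕ} {g g' : ℕ → Fin n} {q : List (ℕ × ℕ) × List (ℕ × ℕ)}
    {p p' : Comp n × Comp n} (h1 : Represents m g q.1 p.1) (h2 : Represents m g q.2 p.2)
    (h1' : Represents m g' q.1 p'.1) (h2' : Represents m g' q.2 p'.2) : PairRelated p p' := by
  have hs : ∀ {g : ℕ → Fin n} {p : Comp n × Comp n}, Represents m g q.1 p.1 →
      Represents m g q.2 p.2 → supp p.1 = supp p.2 := fun h1 h2 => by
    ext c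
    rw [h1.enumerates.2, h2.enumerates.2]
  have hf : ∀ {g : ℕ → Fin n} {p : Comp n × Comp n}, Represents m g q.1 p.1 →
      Represents m g q.2 p.2 → PairRelated p (flatten p.1, flatten p.2) := fun h1 h2 =>
    Relation.EqvGen.rel _ _ ⟨hs h1 h2, _, IsTransformation.flatten, rfl⟩
  have e := hf h1' h2'
  rw [← h1.flatten_eq h1', ← h2.flatten_eq h2'] at e
  exact (hf h1 h2).trans _ _ _ (e.symm _ _)

lemma exists_pairRelated_of_reachable {n m : ℕ} {g : ℕ → Fin n}
    {q₀ q : List (ℕ × ℕ) × List (ℕ × ℕ)} {p₀ : Comp n × Comp n} (h1 : Represents m g q₀.1 p₀.1)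
    (h2 : Represents m g q₀.2 p₀.2) (hq : Reachable m q₀ q) :
    ∃ p, Represents m g q.1 p.1 ∧ Represents m g q.2 p.2 ∧ PairRelated p₀ p := by
  induction hq with
  | refl => exact ⟨p₀, h1, h2, Relation.EqvGen.refl _⟩
  | tail _ h ih =>
    obtain ⟨p, r1, r2, hp⟩ := ih
    obtain ⟨τ, hτ, rfl⟩ := h
    have hs : supp p.1 = supp p.2 := by
      ext c
      rw [r1.enumerates.2, r2.enumerates.2]
    have hrel : ∀ {T : Comp n → Comp n}, IsTransformation T → PairRelated p₀ (T p.1, T p.2) :=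
      fun hT => hp.trans _ _ _ (Relation.EqvGen.rel _ _ ⟨hs, _, hT, rfl⟩)
    cases hτ with
    | id => exact ⟨p, r1, r2, hp⟩
    | shift => exact ⟨_, r1.cyclicShift, r2.cyclicShift, hrel IsTransformation.cyclicShift⟩
    | flip => exact ⟨_, r1.horizontalFlip, r2.horizontalFlip, hrel IsTransformation.horizontalFlip⟩
    | reverse => exact ⟨_, r1.verticalFlip, r2.verticalFlip, hrel IsTransformation.verticalFlip⟩

theorem pairRelated_iff {n m : ℕ} (hm : 0 < m) {g : ℕ → Fin n} {q₀ : List (ℕ × ℕ) × List (ℕ × ℕ)}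
    {p₀ p : Comp n × Comp n} (h1 : Represents m g q₀.1 p₀.1) (h2 : Represents m g q₀.2 p₀.2) :
    PairRelated p₀ p ↔ InClass m q₀ p := by
  constructor
  · intro h
    exact (inClass_of_pairRelated hm h).1 ⟨g, q₀, Relation.ReflTransGen.refl, h1, h2⟩
  · rintro ⟨g', q, hq, h1', h2'⟩
    obtain ⟨p', r1, r2, hp⟩ := exists_pairRelated_of_reachable h1 h2 hq
    exact hp.trans _ _ _ (pairRelated_of_represents r1 r2 h1' h2')

/-- Reduces single compositions to diagonal pairs, whose members trivially have the same support. -/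
lemma pairRelated_diag {n : ℕ} {v w : Comp n} : PairRelated (v, v) (w, w) ↔ Related v w := by
  constructor
  · have : ∀ p q : Comp n × Comp n, PairRelated p q → Related p.1 q.1 := by
      intro p q h
      induction h with
      | rel p q h =>
        obtain ⟨-, T, hT, rfl⟩ := h
        exact Relation.EqvGen.rel _ _ ⟨T, hT, rfl⟩
      | refl p => exact Relation.EqvGen.refl _
      | symm p q _ ih => exact ih.symm _ _
      | trans p q r _ _ ih ih' => exact ih.trans _ _ _ ih'
    exact this _ _
  · intro h
    induction h with
    | rel p q h =>
      obtain ⟨T, hT, rfl⟩ := h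
      exact Relation.EqvGen.rel _ _ ⟨rfl, T, hT, rfl⟩
    | refl p => exact Relation.EqvGen.refl _
    | symm p q _ ih => exact ih.symm _ _
    | trans p q r _ _ ih ih' => exact ih.trans _ _ _ ih'

/-! ### The exceptional classes -/

/-- The flattened word of `zeroWord`. -/
def zeroRank : List (ℕ × ℕ) := [(3, 0), (0, 1), (1, 2), (2, 4)]

/-- The flattened words of `leftWord` and `rightWord`. -/
def pairRank : List (ℕ × ℕ) × List (ℕ × ℕ) :=
  ([(3, 0), (0, 1), (1, 2), (2, 0)], [(3, 1), (1, 2), (2, 3), (3, 0)])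

lemma zeroOrbit_closed : ∀ w ∈ zeroOrbit,
    shiftW 5 w ∈ zeroOrbit ∧ flipW 5 w ∈ zeroOrbit ∧ w.reverse ∈ zeroOrbit := by
  decide +kernel

lemma pairOrbit_closed : ∀ q ∈ pairOrbit, (shiftW 4 q.1, shiftW 4 q.2) ∈ pairOrbit ∧
    (flipW 4 q.1, flipW 4 q.2) ∈ pairOrbit ∧ (q.1.reverse, q.2.reverse) ∈ pairOrbit := by
  decide +kernel

lemma rank_mem_orbit : zeroRank ∈ zeroOrbit ∧ pairRank ∈ pairOrbit := by decide +kernel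

lemma reachable_zeroRank_iff {q : List (ℕ × ℕ) × List (ℕ × ℕ)} :
    Reachable 5 (zeroRank, zeroRank) q ↔ ∃ w ∈ zeroOrbit, q = (w, w) := by
  constructor
  · intro h
    induction h with
    | refl => exact ⟨_, rank_mem_orbit.1, rfl⟩
    | tail _ h ih =>
      obtain ⟨w, hw, rfl⟩ := ih
      obtain ⟨τ, hτ, rfl⟩ := h
      obtain ⟨h1, h2, h3⟩ := zeroOrbit_closed w hw
      cases hτ with
      | id => exact ⟨w, hw, rfl⟩
      | shift => exact ⟨_, h1, rfl⟩
      | flip => exact ⟨_, h2, rfl⟩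
      | reverse => exact ⟨_, h3, rfl⟩
  · rintro ⟨w, hw, rfl⟩
    simp only [zeroOrbit, List.mem_flatMap, List.mem_cons, List.not_mem_nil, or_false] at hw
    obtain ⟨i, -, rfl | rfl⟩ := hw
    · exact Reachable.iterate Relation.ReflTransGen.refl IsMove.shift i
    · exact Reachable.iterate (q := (zeroRank, zeroRank))
        (q' := (zeroRank.reverse, zeroRank.reverse))
        (Relation.ReflTransGen.single ⟨_, IsMove.reverse, rfl⟩) IsMove.shift i

lemma reachable_pairRank_iff {q : List (ℕ × ℕ) × List (ℕ × ℕ)} :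
    Reachable 4 pairRank q ↔ q ∈ pairOrbit := by
  constructor
  · intro h
    induction h with
    | refl => exact rank_mem_orbit.2
    | tail _ h ih =>
      obtain ⟨τ, hτ, rfl⟩ := h
      obtain ⟨h1, h2, h3⟩ := pairOrbit_closed _ ih
      cases hτ with
      | id => exact ih
      | shift => exact h1
      | flip => exact h2
      | reverse => exact h3
  · intro hq
    -- The horizontal flip followed by the vertical flip exchanges the two words of the pair.
    have hswap : Reachable 4 pairRank pairRank.swap :=
      (Relation.ReflTransGen.single ⟨_, IsMove.flip, rfl⟩).tail ⟨_, IsMove.reverse, rfl⟩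
    simp only [pairOrbit, List.mem_flatMap, List.mem_cons, List.not_mem_nil, or_false] at hq
    obtain ⟨i, -, rfl | rfl | rfl | rfl⟩ := hq
    · exact Reachable.iterate Relation.ReflTransGen.refl IsMove.shift i
    · exact hswap.iterate IsMove.shift i
    · exact (Reachable.iterate (q := pairRank) Relation.ReflTransGen.refl IsMove.shift i).tail
        ⟨_, IsMove.reverse, rfl⟩
    · exact (hswap.iterate IsMove.shift i).tail ⟨_, IsMove.reverse, rfl⟩

/-- A strictly increasing family, extended to the natural numbers. -/
def extendEmb {m n : ℕ} (a : Fin (m + 1) ↪o Fin n) (i : ℕ) : Fin n := a (Fin.ofNat (m + 1) i)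

lemma strictMonoOn_extendEmb {m n : ℕ} (a : Fin (m + 1) ↪o Fin n) :
    StrictMonoOn (extendEmb a) (Set.Iio (m + 1)) := by
  intro i hi j hj hij
  rw [Set.mem_Iio] at hi hj
  rw [extendEmb, extendEmb, a.lt_iff_lt, Fin.lt_def, Fin.val_ofNat, Fin.val_ofNat,
    Nat.mod_eq_of_lt hi, Nat.mod_eq_of_lt hj]
  exact hij

lemma represents_zeroWord {n : ℕ} (a : Fin 5 ↪o Fin n) :
    Represents 5 (extendEmb a) zeroRank (zeroWord a) := by
  obtain ⟨h1, h2, -⟩ := zeroOrbit_spec _ rank_mem_orbit.1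
  exact ⟨strictMonoOn_extendEmb a, h1, h2, rfl⟩

lemma represents_leftWord {n : ℕ} (a : Fin 4 ↪o Fin n) :
    Represents 4 (extendEmb a) pairRank.1 (leftWord a) := by
  obtain ⟨h1, h2, -⟩ := pairOrbit_spec _ rank_mem_orbit.2
  exact ⟨strictMonoOn_extendEmb a, h1, h2, rfl⟩

lemma represents_rightWord {n : ℕ} (a : Fin 4 ↪o Fin n) :
    Represents 4 (extendEmb a) pairRank.2 (rightWord a) := by
  obtain ⟨h1, h2, -⟩ := pairOrbit_spec _ (pairOrbit_spec _ rank_mem_orbit.2).2.2.2.2.2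
  exact ⟨strictMonoOn_extendEmb a, h1, h2, rfl⟩

lemma exists_orderEmb {n m : ℕ} {g : ℕ → Fin n} (hg : StrictMonoOn g (Set.Iio m)) :
    Nonempty (Fin m ↪o Fin n) :=
  ⟨OrderEmbedding.ofStrictMono (fun i : Fin m => g i) fun i j hij => hg i.2 j.2 hij⟩

lemma related_zeroWord_iff {n : ℕ} (a : Fin 5 ↪o Fin n) {v : Comp n} :
    Related (zeroWord a) v ↔ IsMinimalZero 4 v := by
  rw [← pairRelated_diag, pairRelated_iff (q₀ := (zeroRank, zeroRank)) (by norm_num)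
    (represents_zeroWord a) (represents_zeroWord a)]
  constructor
  · rintro ⟨g, q, hq, h, -⟩
    obtain ⟨w, hw, rfl⟩ := reachable_zeroRank_iff.1 hq
    exact isMinimalZero_of_mem_zeroOrbit h.strictMonoOn hw h.opList_eq
  · intro h
    obtain ⟨g, hg, w, hw, hv⟩ := mem_zeroOrbit_of_isMinimalZero h
    obtain ⟨h1, h2, -⟩ := zeroOrbit_spec w hw
    exact ⟨g, (w, w), reachable_zeroRank_iff.2 ⟨w, hw, rfl⟩, ⟨hg, h1, h2, hv⟩, ⟨hg, h1, h2, hv⟩⟩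

lemma pairRelated_words_iff {n : ℕ} (a : Fin 4 ↪o Fin n) {u v : Comp n} :
    PairRelated (leftWord a, rightWord a) (u, v) ↔ IsMinimalNonzero 4 u v := by
  rw [pairRelated_iff (q₀ := pairRank) (by norm_num) (represents_leftWord a)
    (represents_rightWord a)]
  constructor
  · rintro ⟨g, q, hq, h, h'⟩
    exact isMinimalNonzero_of_mem_pairOrbit h.strictMonoOn (reachable_pairRank_iff.1 hq)
      h.opList_eq h'.opList_eq
  · intro h
    obtain ⟨g, hg, q, hq, hu, hv⟩ := mem_pairOrbit_of_isMinimalNonzero h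
    obtain ⟨h1, h2, h1', -, -, hs⟩ := pairOrbit_spec q hq
    obtain ⟨-, h2', -⟩ := pairOrbit_spec _ hs
    exact ⟨g, q, reachable_pairRank_iff.2 hq, ⟨hg, h1, h2, hu⟩, ⟨hg, h1', h2', hv⟩⟩

end QuantumBruhat

theorem mainTheorem10 (n : ℕ) :
    ((∀ w : QuantumBruhat.Comp n,
        QuantumBruhat.IsMinimalZero 4 w ↔
          ∃ a : Fin 5 ↪o Fin n, QuantumBruhat.Related (QuantumBruhat.zeroWord a) w) ∧
      (∀ a b : Fin 5 ↪o Fin n,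
        QuantumBruhat.Related (QuantumBruhat.zeroWord a) (QuantumBruhat.zeroWord b))) ∧
    ((∀ u w : QuantumBruhat.Comp n,
        QuantumBruhat.IsMinimalNonzero 4 u w ↔
          ∃ a : Fin 4 ↪o Fin n,
            QuantumBruhat.PairRelated
              (QuantumBruhat.leftWord a, QuantumBruhat.rightWord a) (u, w)) ∧
      (∀ a b : Fin 4 ↪o Fin n,
        QuantumBruhat.PairRelated
          (QuantumBruhat.leftWord a, QuantumBruhat.rightWord a)
          (QuantumBruhat.leftWord b, QuantumBruhat.rightWord b))) := by
  refine ⟨⟨fun w => ⟨fun h => ?_, ?_⟩, fun a b => ?_⟩, fun u w => ⟨fun h => ?_, ?_⟩, fun a b => ?_⟩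
  -- The minimal equivalence provides five indices in `Fin n`; any choice of them will do, since the
  -- class of `zeroWord a` does not depend on `a`.
  · obtain ⟨g, hg, -⟩ := QuantumBruhat.mem_zeroOrbit_of_isMinimalZero h
    obtain ⟨a⟩ := QuantumBruhat.exists_orderEmb hg
    exact ⟨a, (QuantumBruhat.related_zeroWord_iff a).2 h⟩
  · rintro ⟨a, h⟩
    exact (QuantumBruhat.related_zeroWord_iff a).1 h
  · rw [QuantumBruhat.related_zeroWord_iff a, ← QuantumBruhat.related_zeroWord_iff b]
    exact Relation.EqvGen.refl _
  · obtain ⟨g, hg, -⟩ := QuantumBruhat.mem_pairOrbit_of_isMinimalNonzero h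
    obtain ⟨a⟩ := QuantumBruhat.exists_orderEmb hg
    exact ⟨a, (QuantumBruhat.pairRelated_words_iff a).2 h⟩
  · rintro ⟨a, h⟩
    exact (QuantumBruhat.pairRelated_words_iff a).1 h
  · rw [QuantumBruhat.pairRelated_words_iff a, ← QuantumBruhat.pairRelated_words_iff b]
    exact Relation.EqvGen.refl _
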